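/- Let $\ell = 2k+1 \ge 5$ be prime, put $e(x)=e^{2\pi i x}$, $\zeta_\ell = e(1/\ell)$, and $q^x = e(x\tau)$ for $\tau$ in the upper half plane $\mathbb{H}$. For $a=(a_1,a_2)\in\mathbb{Q}^2$ let $$g_a(\tau) = -q^{\frac12 \mathbf{B}_2(a_1)}\, e\!\left(\tfrac{a_2(a_1-1)}{2}\right)\prod_{n=1}^\infty \bigl(1-q^{n-1+a_1}e(a_2)\bigr)\bigl(1-q^{n-a_1}e(-a_2)\bigr), \qquad \mathbf{B}_2(x)=\{x\}^2-\{x\}+\tfrac16,$$ be the Siegel function, where $\{x\}$ is the fractional part of $x$, and for $1\le m\le k-1$ let $$s_{\ell,m}(\tau)=\prod_{j=1}^m \frac{g_{(2j/\ell,\,0)}(\ell\tau)}{g_{(j/\ell,\,0)}(\ell\tau)}.$$ Let $U_\ell$ be the group of modular units of level $\ell$ defined over $\mathbb{Q}(\zeta_\ell)$: the holomorphic functions on $\mathbb{H}$ without zeros that are invariant under $\Gamma(\ell)$, meromorphic at all cusps, and whose Fourier expansion $\sum_n c_n q^{n/\ell}$ has all coefficients in $\mathbb{Q}(\zeta_\ell)$.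 Let $U_\ell^+\subseteq U_\ell$ be the subgroup of those functions that have order $0$ at every cusp of $X(\ell)$ not lying above the cusp $\infty$ of $X_0(\ell)$. Let $U_\ell^R = \langle s_{\ell,m} : 1\le m\le k-1\rangle$, and let $d$ be the order of $2$ in $(\mathbb{Z}/\ell\mathbb{Z})^\times/\{\pm1\}$. Then $U_\ell^R\subseteq U_\ell^+$, and the abelian group $U_\ell^R$ has rank $$\mathrm{Rank}(U_\ell^R)=k-\frac{k}{d}.$$ In particular, if $2$ generates $(\mathbb{Z}/\ell\mathbb{Z})^\times/\{\pm1\}$, then $U_\ell^R\times\mathbb{Q}(\zeta_\ell)^\times=U_\ell^+$; that is, $U_\ell^+$ is the internal direct product of $U_\ell^R$ and the group $\mathbb{Q}(\zeta_\ell)^\times$ of nonzero constant functions with value in $\mathbb{Q}(\zeta_\ell)$. -/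

import Mathlib

namespace ModUnits

open UpperHalfPlane CongruenceSubgroup IntermediateField
open scoped MatrixGroups OnePoint Manifold

noncomputable section

/-- `e x = exp (2 π i x)`. With `q = e τ`, the power `q ^ x` is `e (x * τ)`. -/
def e (x : ℂ) : ℂ := Complex.exp (2 * Real.pi * Complex.I * x)

/-- The second Bernoulli polynomial evaluated at the fractional part of the argument. -/
def B₂ (x : ℚ) : ℚ := Int.fract x ^ 2 - Int.fract x + 1 / 6

/-- The `n`-th factor of the infinite product defining a Siegel function, for `n = 0, 1, 2, …`:
`(1 - q ^ (n + a₁) e(a₂)) (1 - q ^ (n + 1 - a₁) e(-a₂))`. -/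
def siegelFactor (a₁ a₂ : ℚ) (τ : ℂ) (n : ℕ) : ℂ :=
  (1 - e ((n + a₁) * τ) * e a₂) * (1 - e ((n + 1 - a₁) * τ) * e (-a₂))

/-- The Siegel function `g_{(a₁, a₂)}(τ)`. -/
def siegel (a₁ a₂ : ℚ) (τ : ℂ) : ℂ :=
  -e ((B₂ a₁ : ℂ) / 2 * τ) * e (a₂ * (a₁ - 1) / 2) * ∏' n : ℕ, siegelFactor a₁ a₂ τ n

/-- The function `s_{ℓ, m}(τ) = ∏_{j = 1}^m g_{(2j/ℓ, 0)}(ℓτ) / g_{(j/ℓ, 0)}(ℓτ)`. -/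
def s (ℓ m : ℕ) (τ : ℍ) : ℂ :=
  ∏ j ∈ Finset.Icc 1 m,
    siegel (2 * j / ℓ) 0 (ℓ * (τ : ℂ)) / siegel (j / ℓ) 0 (ℓ * (τ : ℂ))

/-- The number field `ℚ(ζ_ℓ) ⊆ ℂ`, where `ζ_ℓ = e(1/ℓ)`. -/
def cycField (ℓ : ℕ) : IntermediateField ℚ ℂ := ℚ⟮e (1 / ℓ)⟯

/-- `f(τ) = ∑_{n ∈ ℤ} c n q ^ (n/ℓ)` on the upper half plane, with only finitely many nonzero
coefficients of negative index. -/
def HasFourierExpansion (ℓ : ℕ) (f : ℍ → ℂ) (c : ℤ → ℂ) : Prop :=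
  (∃ N : ℤ, ∀ n < N, c n = 0) ∧
    ∀ τ : ℍ, HasSum (fun n : ℤ => c n * e ((n : ℂ) / ℓ * (τ : ℂ))) (f τ)

/-- `f` is a modular unit of level `ℓ` with Fourier coefficients in `ℚ(ζ_ℓ)`: a function on the
upper half plane, holomorphic and without zeros there, invariant under `Γ(ℓ)`, meromorphic at all
cusps `γ∞`, and whose Fourier expansion is defined over `ℚ(ζ_ℓ)`. -/
structure IsModularUnit (ℓ : ℕ) (f : ℍ → ℂ) : Prop where
  holomorphic : MDifferentiable 𝓘(ℂ) 𝓘(ℂ) f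
  ne_zero : ∀ τ, f τ ≠ 0
  invariant : ∀ γ ∈ Gamma ℓ, ∀ τ : ℍ, f (γ • τ) = f τ
  meromorphic_at_cusps : ∀ γ : SL(2, ℤ), ∃ c, HasFourierExpansion ℓ (fun τ => f (γ • τ)) c
  coeff_mem : ∃ c, HasFourierExpansion ℓ f c ∧ ∀ n, c n ∈ cycField ℓ

/-- The unit group `U_ℓ`, inside the group of all nowhere vanishing functions on `ℍ`. -/
def U (ℓ : ℕ) : Set (ℍ → ℂ)ˣ := {f | IsModularUnit ℓ (f : ℍ → ℂ)}

/-- The cusp `γ∞ ∈ ℚ ∪ {∞}`. -/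
def cusp (γ : SL(2, ℤ)) : OnePoint ℚ := Matrix.SpecialLinearGroup.mapGL ℚ γ • (∞ : OnePoint ℚ)

/-- The set `𝒜_ℓ` of cusps of `X(ℓ)` lying above the cusp `∞` of `X_0(ℓ)`, given by its inverse
image in `ℚ ∪ {∞}`, that is, the `Γ_0(ℓ)`-orbit of `∞`. -/
def cuspsAboveInfty (ℓ : ℕ) : Set (OnePoint ℚ) := {β | ∃ δ ∈ Gamma0 ℓ, β = cusp δ}

/-- `f` has order `n` at the cusp `γ∞`: the smallest power of `q ^ (1/ℓ)` in the Fourier expansion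
of `f ∘ γ` is the `n`-th. -/
def HasOrderAtCusp (ℓ : ℕ) (f : ℍ → ℂ) (γ : SL(2, ℤ)) (n : ℤ) : Prop :=
  ∃ c, HasFourierExpansion ℓ (fun τ => f (γ • τ)) c ∧ c n ≠ 0 ∧ ∀ i < n, c i = 0

/-- `U_ℓ^+`: the modular units of level `ℓ` whose zeros and poles are supported on `𝒜_ℓ`, that is,
which have order `0` at all other cusps. -/
def UPlus (ℓ : ℕ) : Set (ℍ → ℂ)ˣ :=
  {f | f ∈ U ℓ ∧ ∀ γ : SL(2, ℤ), cusp γ ∉ cuspsAboveInfty ℓ → HasOrderAtCusp ℓ f γ 0}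

/-- The group `ℚ(ζ_ℓ)^×` of nonzero constant functions with value in `ℚ(ζ_ℓ)`. -/
def constants (ℓ : ℕ) : Subgroup (ℍ → ℂ)ˣ :=
  (Units.map (((Pi.constRingHom ℍ ℂ).comp (algebraMap (cycField ℓ) ℂ) :
    cycField ℓ →+* (ℍ → ℂ)) : cycField ℓ →* (ℍ → ℂ))).range

/-- The class of `2` in `(ℤ/ℓ)^× / {±1}`, for odd `ℓ`. -/
def twoClass (ℓ : ℕ) (h : Odd ℓ) : (ZMod ℓ)ˣ ⧸ Subgroup.zpowers (-1 : (ZMod ℓ)ˣ) :=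
  QuotientGroup.mk (ZMod.unitOfCoprime 2 (Nat.coprime_two_left.mpr h))

theorem e_ne_zero (x : ℂ) : e x ≠ 0 := Complex.exp_ne_zero _

theorem norm_e_mul {x : ℝ} {τ : ℂ} :
    ‖e (x * τ)‖ = Real.exp (-2 * Real.pi * τ.im) ^ x := by
  rw [e, Complex.norm_exp, ← Real.exp_mul]
  congr 1
  simp
  ring

theorem siegel_ne_zero {a : ℚ} (h0 : 0 < a) (h1 : a < 1) {τ : ℂ} (hτ : 0 < τ.im) :
    siegel a 0 τ ≠ 0 := by
  set r : ℝ := Real.exp (-2 * Real.pi * τ.im) with hr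
  have hr0 : 0 < r := Real.exp_pos _
  have hr1 : r < 1 := by
    rw [hr, Real.exp_lt_one_iff]
    nlinarith [mul_pos Real.pi_pos hτ]
  have key (b : ℝ) (hb : 0 < b) : ∏' n : ℕ, (1 + -e ((n + b : ℝ) * τ)) ≠ 0 ∧
      Multipliable fun n : ℕ => (1 + -e ((n + b : ℝ) * τ)) := by
    have hs : Summable fun n : ℕ => ‖-e ((n + b : ℝ) * τ)‖ := by
      have : (fun n : ℕ => ‖-e ((n + b : ℝ) * τ)‖) = fun n : ℕ => r ^ n * r ^ b := by
        ext n
        rw [norm_neg, norm_e_mul, Real.rpow_add hr0, Real.rpow_natCast]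
      rw [this]
      exact (summable_geometric_of_lt_one hr0.le hr1).mul_right _
    refine ⟨tprod_one_add_ne_zero_of_summable (fun n => ?_) hs,
      multipliable_one_add_of_summable hs⟩
    intro h
    have h2 : e ((n + b : ℝ) * τ) = 1 := by linear_combination -h
    have h3 : ‖e ((n + b : ℝ) * τ)‖ < 1 := by
      rw [norm_e_mul]
      exact Real.rpow_lt_one hr0.le hr1 (by positivity)
    rw [h2] at h3
    simp at h3
  obtain ⟨hA, hA'⟩ := key a (by exact_mod_cast h0)
  obtain ⟨hB, hB'⟩ := key (1 - a) (by
    have : (a : ℝ) < 1 := by exact_mod_cast h1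
    linarith)
  have hprod : ∏' n : ℕ, siegelFactor a 0 τ n =
      (∏' n : ℕ, (1 + -e ((n + a : ℝ) * τ))) *
        ∏' n : ℕ, (1 + -e ((n + (1 - a) : ℝ) * τ)) := by
    rw [← hA'.tprod_mul hB']
    congr 1
    ext n
    have : e 0 = 1 := by simp [e]
    simp [siegelFactor, this, sub_eq_add_neg, add_assoc]
  rw [siegel, hprod]
  exact mul_ne_zero (mul_ne_zero (neg_ne_zero.mpr (e_ne_zero _)) (e_ne_zero _)) (mul_ne_zero hA hB)

theorem s_ne_zero {ℓ m : ℕ} (h : 2 * m < ℓ) (τ : ℍ) : s ℓ m τ ≠ 0 := by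
  have hℓ : (0 : ℚ) < ℓ := by exact_mod_cast (by omega : 0 < ℓ)
  have hτ : 0 < ((ℓ : ℂ) * (τ : ℂ)).im := by
    have h1 : (0 : ℝ) < ℓ := by exact_mod_cast hℓ
    simpa using mul_pos h1 τ.im_pos
  refine Finset.prod_ne_zero_iff.mpr fun j hj => ?_
  rw [Finset.mem_Icc] at hj
  have hj0 : (0 : ℚ) < j := by exact_mod_cast (by omega : 0 < j)
  have hj1 : (2 * j : ℚ) < ℓ := by exact_mod_cast (by omega : 2 * j < ℓ)
  refine div_ne_zero (siegel_ne_zero (by positivity) ?_ hτ) (siegel_ne_zero (by positivity) ?_ hτ)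
  · rwa [div_lt_one hℓ]
  · rw [div_lt_one hℓ]
    linarith

/-- `s_{ℓ, m}` as an element of the group of nowhere vanishing functions on `ℍ`. -/
def sUnit (ℓ m : ℕ) (h : 2 * m < ℓ) : (ℍ → ℂ)ˣ where
  val := s ℓ m
  inv := fun τ => (s ℓ m τ)⁻¹
  val_inv := by
    ext τ
    exact mul_inv_cancel₀ (s_ne_zero h τ)
  inv_val := by
    ext τ
    exact inv_mul_cancel₀ (s_ne_zero h τ)

/-- `U_ℓ^R`, for `ℓ = 2k + 1`: the group generated by the `s_{ℓ, m}` with `1 ≤ m ≤ k - 1`. -/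
def UR (k : ℕ) : Subgroup (ℍ → ℂ)ˣ :=
  Subgroup.closure
    {f | ∃ (m : ℕ) (_ : 1 ≤ m) (hm : m ≤ k - 1), f = sUnit (2 * k + 1) m (by omega)}

end

end ModUnits

/-! Let G = `Cl ℓ`, a group of order k. Up to a factor depending on τ but not on j, the function
g_{(j/ℓ,0)}(ℓτ) is an odd theta function whose index j matters, up to sign, only modulo ℓ and ±1, so
the Siegel function is attached to the class of j in G. For v : G → ℤ let `EP v` be the product of
these functions with exponents v. If the exponents sum to 0, every factor common to all classes
cancels. The theta transformations then show that `EP v` is a unit of level ℓ, that Γ₀(ℓ) translates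
v up to constants, and that the order is 0 at the cusps not above ∞. The logarithmic derivative of
the Euler product of `EP v` has divisor sums of d · v(class of d) as coefficients; it determines v,
so `EP` is injective in degree 0, even modulo constants (`eq_zero_of_EP_const`).

With g the class of 2, s_{ℓ,m} is `EP` of (g − 1)([1] + ⋯ + [m]). The partial sums with m ≤ k form a
basis of ℤ[G], and g − 1 kills the one with m = k, so U_ℓ^R is the isomorphic image of (g − 1)ℤ[G]
(`mem_UR_iff`). The kernel of g − 1 consists of the functions on G/⟨g⟩ and has rank k/d, which gives
the rank. If g generates G, the image is the whole augmentation ideal.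

It remains to write every f in U_ℓ^+ as c · `EP v`. A unit with equal orders at all cusps above ∞
and order 0 elsewhere is constant, since it or its inverse is bounded at every cusp. Hence the order
map is injective on degree 0 modulo constant vectors, and a nonvanishing determinant, whose value is
never needed, makes some power f^N of the form c · `EP v` (`exists_pow_eq`).

The last point is saturation: f^p = c · `EP v` with p prime forces p ∣ v (`dvd_of_pow_eq`). After a
twist f is invariant under T. Lagrange interpolation over the SL₂(ℤ)-orbit of an auxiliary `EP`,
with the integrality of j, makes f a quotient of complex combinations of integral q-series.
Normalized, f is a p-th root of an integral series with constant term 1, hence rational, hence a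
quotient of integral series. An integral series that is the p-th power of such a quotient has
derivative 0 modulo p, and the divisor sums then give p ∣ v(x) for each class x. -/

namespace ModUnits
open UpperHalfPlane CongruenceSubgroup IntermediateField
open scoped MatrixGroups OnePoint Manifold Topology
open Filter
noncomputable section

/-! ### The Jacobi triple product -/

section

/-- `1 / ((1 - q) ⋯ (1 - q ^ m))`, and `0` for negative `m`. -/
def qInv (q : ℂ) (m : ℤ) : ℂ :=
  if m < 0 then 0 else ∏ i ∈ Finset.range m.toNat, (1 - q ^ (i + 1))⁻¹

theorem one_sub_pow_succ_ne_zero {q : ℂ} (hq : ‖q‖ < 1) (n : ℕ) : 1 - q ^ (n + 1) ≠ 0 := by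
  intro h
  have h1 : q ^ (n + 1) = 1 := by linear_combination -h
  have h2 : ‖q‖ ^ (n + 1) < 1 := pow_lt_one₀ (norm_nonneg _) hq (by omega)
  rw [← norm_pow, h1] at h2
  simp at h2

/-- The value 0 at negative arguments is what makes the recursion hold for all integers: at m = 0
the factor 1 − q^0 vanishes. -/
theorem qInv_sub_one {q : ℂ} (hq : ‖q‖ < 1) (m : ℤ) :
    qInv q (m - 1) = (1 - q ^ m) * qInv q m := by
  rcases lt_trichotomy m 0 with h | rfl | h
  · simp [qInv, h, show m - 1 < 0 by omega]
  · simp [qInv]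
  · obtain ⟨n, rfl⟩ : ∃ n : ℕ, m = n + 1 := ⟨(m - 1).toNat, by omega⟩
    have h1 : ¬ ((n : ℤ) + 1 - 1 < 0) := by omega
    have h2 : ¬ ((n : ℤ) + 1 < 0) := by omega
    have h3 : ((n : ℤ) + 1 - 1).toNat = n := by omega
    have h4 : ((n : ℤ) + 1).toNat = n + 1 := by omega
    have h5 : q ^ ((n : ℤ) + 1) = q ^ (n + 1) := by norm_cast
    rw [qInv, qInv, if_neg h1, if_neg h2, h3, h4, Finset.prod_range_succ, h5]
    field_simp [one_sub_pow_succ_ne_zero hq n]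

/-- The terms of the bilateral theta series in the variables `q` and `w`. -/
def thetaTerm (q w : ℂ) (k : ℤ) : ℂ := (-1) ^ k * q ^ (k * (k - 1) / 2) * w ^ k

theorem thetaTerm_succ {q w : ℂ} (hq : q ≠ 0) (hw : w ≠ 0) (k : ℤ) :
    thetaTerm q w (k + 1) = -(q ^ k * w) * thetaTerm q w k := by
  have : (k + 1) * (k + 1 - 1) / 2 = k * (k - 1) / 2 + k := by
    rw [show (k + 1) * (k + 1 - 1) = k * (k - 1) + k * 2 by ring]
    exact Int.add_mul_ediv_right _ _ (by norm_num)
  rw [thetaTerm, thetaTerm, this, zpow_add₀ hq, zpow_add_one₀ hw, zpow_add_one₀ (by norm_num)]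
  ring

/-- The q-binomial theorem for 2N factors, divided by (1 − q) ⋯ (1 − q^{2N}). The terms vanish
unless |k| ≤ N, so the sum is finite and the induction is formal. -/
theorem finite_triple_product {q w : ℂ} (hq : ‖q‖ < 1) (hq0 : q ≠ 0) (hw : w ≠ 0) (N : ℕ) :
    HasSum (fun k : ℤ => thetaTerm q w k * (qInv q (N - k) * qInv q (N + k)))
      ((∏ n ∈ Finset.range N, (1 - q ^ n * w) * (1 - q ^ (n + 1) * w⁻¹)) *
        ∏ i ∈ Finset.range (2 * N), (1 - q ^ (i + 1))⁻¹) := by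
  induction N with
  | zero =>
    have : HasSum (fun k : ℤ => thetaTerm q w k * (qInv q ((0 : ℕ) - k) * qInv q ((0 : ℕ) + k)))
        (thetaTerm q w 0 * (qInv q ((0 : ℕ) - 0) * qInv q ((0 : ℕ) + 0))) := by
      refine hasSum_single (0 : ℤ) fun k hk => ?_
      rcases lt_or_gt_of_ne hk with h | h
      · simp [qInv, h]
      · simp [qInv, h]
    simpa [thetaTerm, qInv] using this
  | succ N ih =>
    set t : ℤ → ℂ := fun k => thetaTerm q w k * (qInv q (N - k) * qInv q (N + k)) with ht
    set P := (∏ n ∈ Finset.range N, (1 - q ^ n * w) * (1 - q ^ (n + 1) * w⁻¹)) *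
        ∏ i ∈ Finset.range (2 * N), (1 - q ^ (i + 1))⁻¹ with hP
    replace ih : HasSum t P := ih
    have hm : HasSum (fun k => t (k - 1)) P :=
      (Equiv.hasSum_iff (f := t) (Equiv.subRight (1 : ℤ))).mpr ih
    have hp : HasSum (fun k => t (k + 1)) P :=
      (Equiv.hasSum_iff (f := t) (Equiv.addRight (1 : ℤ))).mpr ih
    have n1 := one_sub_pow_succ_ne_zero hq (2 * N)
    have n2 := one_sub_pow_succ_ne_zero hq (2 * N + 1)
    -- The new factors multiply out to 1 + q^{2N+1} − q^N w − q^{N+1} w⁻¹; the powers of w are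
    -- absorbed by shifting the summation index by one.
    have key := ((((ih.mul_left (1 + q ^ (2 * N + 1))).sub (hm.mul_left (q ^ N * w))).sub
      (hp.mul_left (q ^ (N + 1) * w⁻¹)))).mul_left
        ((1 - q ^ (2 * N + 1))⁻¹ * (1 - q ^ (2 * N + 1 + 1))⁻¹)
    refine (congrArg₂ (fun a b => HasSum a b) ?_ ?_).mp key
    · symm
      funext k
      have e1 : thetaTerm q w k = -(q ^ (k - 1) * w) * thetaTerm q w (k - 1) := by
        simpa using thetaTerm_succ hq0 hw (k - 1)
      have e2 := thetaTerm_succ hq0 hw k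
      set A := qInv q (N + 1 - k) with hA
      set B := qInv q (N + 1 + k) with hB
      set x := q ^ ((N : ℤ) + 1 - k) with hx
      set y := q ^ ((N : ℤ) + 1 + k) with hy
      have hx' : q ^ ((N : ℤ) - k) = x / q := by
        rw [hx, show (N : ℤ) + 1 - k = N - k + 1 by ring, zpow_add_one₀ hq0]; field_simp
      have hy' : q ^ ((N : ℤ) + k) = y / q := by
        rw [hy, show (N : ℤ) + 1 + k = N + k + 1 by ring, zpow_add_one₀ hq0]; field_simp
      have a1 : qInv q (N - k) = (1 - x) * A := by
        rw [hA, hx, ← qInv_sub_one hq]; congr 1; ring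
      have b1 : qInv q (N + k) = (1 - y) * B := by
        rw [hB, hy, ← qInv_sub_one hq]; congr 1; ring
      have a2 : qInv q (N - (k + 1)) = (1 - x / q) * ((1 - x) * A) := by
        rw [← a1, ← hx', ← qInv_sub_one hq]; congr 1; ring
      have b2 : qInv q (N + (k - 1)) = (1 - y / q) * ((1 - y) * B) := by
        rw [← b1, ← hy', ← qInv_sub_one hq]; congr 1; ring
      have a3 : qInv q (N - (k - 1)) = A := by rw [hA]; congr 1; ring
      have b3 : qInv q (N + (k + 1)) = B := by rw [hB]; congr 1; ring
      have hxy : x * y = q ^ (2 * N + 1 + 1) := by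
        rw [hx, hy, ← zpow_add₀ hq0, ← zpow_natCast]; congr 1; push_cast; ring
      have hxy' : q ^ (2 * N + 1) = x * y / q := by
        rw [hxy, pow_succ q (2 * N + 1), mul_div_cancel_right₀ _ hq0]
      have hxk : x * q ^ (k - 1) = q ^ N := by
        rw [hx, ← zpow_add₀ hq0, ← zpow_natCast]; congr 1; ring
      have hyk : q ^ (N + 1) * q ^ k = y := by
        rw [hy, ← zpow_natCast, ← zpow_add₀ hq0]; congr 1
      have f1 : q ^ N * w * t (k - 1) = -x * (thetaTerm q w k * (A * qInv q (N + (k - 1)))) := by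
        simp only [ht]
        rw [a3, e1, ← hxk]; ring
      have f2 : q ^ (N + 1) * w⁻¹ * t (k + 1) =
          -y * (thetaTerm q w k * (qInv q (N - (k + 1)) * B)) := by
        simp only [ht]
        rw [b3, e2, ← hyk]; field_simp
      rw [f1, f2, ht]
      simp only
      rw [a1, b1, a2, b2]
      have g1 : (((N + 1 : ℕ) : ℤ) - k) = N + 1 - k := by push_cast; ring
      have g2 : (((N + 1 : ℕ) : ℤ) + k) = N + 1 + k := by push_cast; ring
      rw [g1, g2, ← hA, ← hB, ← hxy, hxy']
      rw [hxy'] at n1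
      rw [← hxy] at n2
      replace n1 : q - x * y ≠ 0 := by
        intro h
        apply n1
        rw [← sub_eq_zero.mp h, div_self hq0, sub_self]
      field_simp
      ring
    · symm
      rw [show 2 * (N + 1) = 2 * N + 1 + 1 by ring, Finset.prod_range_succ, Finset.prod_range_succ,
        Finset.prod_range_succ, hP]
      have h : w * w⁻¹ = 1 := mul_inv_cancel₀ hw
      linear_combination (-(∏ n ∈ Finset.range N, (1 - q ^ n * w) * (1 - q ^ (n + 1) * w⁻¹)) *
        (∏ i ∈ Finset.range (2 * N), (1 - q ^ (i + 1))⁻¹) * (1 - q ^ (2 * N + 1))⁻¹ *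
        (1 - q ^ (2 * N + 1 + 1))⁻¹ * (-q ^ (2 * N + 1))) * h

theorem multipliable_one_sub_pow_mul {q : ℂ} (hq : ‖q‖ < 1) (w : ℂ) :
    Multipliable fun n : ℕ => (1 - q ^ n * w) := by
  have : Summable fun n : ℕ => ‖-(q ^ n * w)‖ := by
    simp only [norm_neg, norm_mul, norm_pow]
    exact (summable_geometric_of_lt_one (norm_nonneg _) hq).mul_right _
  simpa [sub_eq_add_neg] using multipliable_one_add_of_summable this

theorem multipliable_one_sub_pow_succ_mul {q : ℂ} (hq : ‖q‖ < 1) (w : ℂ) :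
    Multipliable fun n : ℕ => (1 - q ^ (n + 1) * w) := by
  simpa [pow_succ, mul_assoc] using multipliable_one_sub_pow_mul hq (q * w)

theorem euler_product_ne_zero {q : ℂ} (hq : ‖q‖ < 1) : ∏' n : ℕ, (1 - q ^ (n + 1)) ≠ 0 := by
  have : Summable fun n : ℕ => ‖-(q ^ (n + 1))‖ := by
    simp only [norm_neg, pow_succ, norm_mul, norm_pow]
    exact (summable_geometric_of_lt_one (norm_nonneg _) hq).mul_right _
  have h := tprod_one_add_ne_zero_of_summable (f := fun n : ℕ => -(q ^ (n + 1)))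
    (fun n => by simpa [sub_eq_add_neg] using one_sub_pow_succ_ne_zero hq n) this
  simpa [sub_eq_add_neg] using h

/-- The Jacobi triple product identity. -/
theorem triple_product {q w : ℂ} (hq : ‖q‖ < 1) (hq0 : q ≠ 0) (hw : w ≠ 0)
    (hs : Summable (thetaTerm q w)) :
    ∑' k : ℤ, thetaTerm q w k = (∏' n : ℕ, (1 - q ^ (n + 1))) *
      ∏' n : ℕ, (1 - q ^ n * w) * (1 - q ^ (n + 1) * w⁻¹) := by
  set E := ∏' n : ℕ, (1 - q ^ (n + 1)) with hE
  have hE0 : E ≠ 0 := euler_product_ne_zero hq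
  have hE1 : Tendsto (fun N => ∏ i ∈ Finset.range N, (1 - q ^ (i + 1))⁻¹) atTop (𝓝 E⁻¹) := by
    have := (multipliable_one_sub_pow_succ_mul hq 1).hasProd.tendsto_prod_nat
    simp only [mul_one] at this
    simpa using this.inv₀ hE0
  have hq1 : Tendsto (qInv q) atTop (𝓝 E⁻¹) := by
    have h1 : Tendsto (fun m : ℤ => ∏ i ∈ Finset.range m.toNat, (1 - q ^ (i + 1))⁻¹) atTop
        (𝓝 E⁻¹) := hE1.comp (tendsto_atTop_atTop.mpr fun b => ⟨b, fun a ha => by omega⟩)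
    refine h1.congr' ?_
    filter_upwards [eventually_ge_atTop 0] with m hm
    simp [qInv, not_lt.mpr hm]
  obtain ⟨M, hM⟩ : ∃ M : ℝ, ∀ m : ℤ, ‖qInv q m‖ ≤ M := by
    obtain ⟨M, hM⟩ := (Metric.isBounded_range_of_tendsto _ hE1).exists_norm_le
    refine ⟨max M 0, fun m => ?_⟩
    by_cases h : m < 0
    · simp [qInv, h]
    · rw [qInv, if_neg h]
      exact (hM _ ⟨_, rfl⟩).trans (le_max_left _ _)
  have hM0 : 0 ≤ M := (norm_nonneg _).trans (hM 0)
  -- Let N → ∞ in the finite identity. For fixed k both values of `qInv` tend to E⁻¹, and they are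
  -- uniformly bounded, so the theta terms dominate.
  have lim1 : Tendsto (fun N : ℕ => ∑' k : ℤ, thetaTerm q w k * (qInv q (N - k) * qInv q (N + k)))
      atTop (𝓝 (∑' k : ℤ, thetaTerm q w k * (E⁻¹ * E⁻¹))) := by
    refine tendsto_tsum_of_dominated_convergence (bound := fun k => ‖thetaTerm q w k‖ * (M * M))
      (hs.norm.mul_right _) (fun k => ?_) (Eventually.of_forall fun N k => ?_)
    · refine Tendsto.const_mul _ (Tendsto.mul (hq1.comp ?_) (hq1.comp ?_))
      · exact tendsto_atTop_add_const_right _ (-k) tendsto_natCast_atTop_atTop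
      · exact tendsto_atTop_add_const_right _ k tendsto_natCast_atTop_atTop
    · rw [norm_mul, norm_mul]
      gcongr <;> exact hM _
  have lim2 := ((multipliable_one_sub_pow_mul hq w).mul
    (multipliable_one_sub_pow_succ_mul hq w⁻¹)).hasProd.tendsto_prod_nat.mul
      (hE1.comp (tendsto_id.const_mul_atTop' (show 0 < 2 by norm_num)))
  have := tendsto_nhds_unique lim1
    (lim2.congr fun N => ((finite_triple_product hq hq0 hw N).tsum_eq).symm)
  rw [tsum_mul_right] at this
  have h2 : E * E⁻¹ = 1 := mul_inv_cancel₀ hE0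
  linear_combination E * E * this - (∑' k : ℤ, thetaTerm q w k) * (E * E⁻¹ + 1) * h2 +
    (∏' b : ℕ, (1 - q ^ b * w) * (1 - q ^ (b + 1) * w⁻¹)) * E * h2

end

/-! ### The odd theta function and its transformation under SL₂(ℤ) -/

section

theorem e_add (x y : ℂ) : e (x + y) = e x * e y := by
  rw [e, e, e, ← Complex.exp_add]; ring_nf

theorem e_neg (x : ℂ) : e (-x) = (e x)⁻¹ := by
  rw [e, e, ← Complex.exp_neg]; ring_nf

theorem e_sub (x y : ℂ) : e (x - y) = e x / e y := by
  rw [sub_eq_add_neg, e_add, e_neg, div_eq_mul_inv]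

@[simp] theorem e_zero : e 0 = 1 := by simp [e]

theorem e_int_mul (n : ℤ) (x : ℂ) : e (n * x) = e x ^ n := by
  rw [e, e, ← Complex.exp_int_mul]; ring_nf

theorem e_nat_mul (n : ℕ) (x : ℂ) : e (n * x) = e x ^ n := by
  exact_mod_cast e_int_mul n x

@[simp] theorem e_one : e 1 = 1 := by
  rw [e, mul_one, Complex.exp_two_pi_mul_I]

@[simp] theorem e_int (n : ℤ) : e n = 1 := by
  have := e_int_mul n 1
  simpa using this

theorem e_half : e (1 / 2) = -1 := by
  rw [e, show 2 * (Real.pi : ℂ) * Complex.I * (1 / 2) = Real.pi * Complex.I by ring,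
    Complex.exp_pi_mul_I]

theorem e_int_div_two (n : ℤ) : e (n / 2) = (-1) ^ n := by
  rw [← e_half, ← e_int_mul]; ring_nf

theorem norm_e_lt_one {τ : ℂ} (hτ : 0 < τ.im) : ‖e τ‖ < 1 := by
  have := norm_e_mul (x := 1) (τ := τ)
  simp only [Complex.ofReal_one, one_mul, Real.rpow_one] at this
  rw [this, Real.exp_lt_one_iff]
  nlinarith [mul_pos Real.pi_pos hτ]

/-- The odd Jacobi theta function. -/
def th (z τ : ℂ) : ℂ := e (τ / 8 - z / 2) * jacobiTheta₂ (z + 1 / 2 - τ / 2) τ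

theorem jacobiTheta₂_term_eq_thetaTerm (n : ℤ) (z τ : ℂ) :
    jacobiTheta₂_term n (z + 1 / 2 - τ / 2) τ = thetaTerm (e τ) (e z) n := by
  obtain ⟨m, hm⟩ : ∃ m : ℤ, n * (n - 1) = m * 2 := by
    obtain ⟨m, hm⟩ := Int.even_mul_pred_self n
    exact ⟨m, by rw [hm]; ring⟩
  have hm' : (n : ℂ) * (n - 1) = m * 2 := by exact_mod_cast hm
  rw [thetaTerm, hm, Int.mul_ediv_cancel _ (by norm_num), ← e_int_mul, ← e_int_mul,
    ← e_int_div_two, ← e_add, ← e_add, jacobiTheta₂_term, e]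
  congr 1
  linear_combination (Real.pi * Complex.I * τ) * hm'

theorem th_eq_prod (z : ℂ) {τ : ℂ} (hτ : 0 < τ.im) :
    th z τ = e (τ / 8 - z / 2) * ((∏' n : ℕ, (1 - e τ ^ (n + 1))) *
      ∏' n : ℕ, (1 - e τ ^ n * e z) * (1 - e τ ^ (n + 1) * (e z)⁻¹)) := by
  have hs : Summable (thetaTerm (e τ) (e z)) := by
    have := (summable_jacobiTheta₂_term_iff (z + 1 / 2 - τ / 2) τ).mpr hτ
    simpa only [jacobiTheta₂_term_eq_thetaTerm] using this
  rw [th, ← triple_product (norm_e_lt_one hτ) (e_ne_zero _) (e_ne_zero _) hs, jacobiTheta₂]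
  simp only [jacobiTheta₂_term_eq_thetaTerm]

theorem jacobiTheta₂_add_tau (z τ : ℂ) :
    jacobiTheta₂ (z + 1 / 2 - τ / 2 + τ) τ = -e (-z) * jacobiTheta₂ (z + 1 / 2 - τ / 2) τ := by
  rw [jacobiTheta₂_add_left']
  congr 1
  have : -e (-z) = e (-1 / 2 - z) := by
    rw [sub_eq_add_neg, e_add, show (-1 / 2 : ℂ) = -(1 / 2) by ring, e_neg (1 / 2), e_half]
    norm_num
  rw [this, e]
  congr 1
  ring

theorem th_neg (z τ : ℂ) : th (-z) τ = -th z τ := by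
  have h : jacobiTheta₂ (-z + 1 / 2 - τ / 2) τ = -e (-z) * jacobiTheta₂ (z + 1 / 2 - τ / 2) τ := by
    rw [← jacobiTheta₂_neg_left, ← jacobiTheta₂_add_tau, ← jacobiTheta₂_add_left]
    congr 1
    ring
  rw [th, th, h, show τ / 8 - -z / 2 = τ / 8 - z / 2 + z by ring, e_add, e_neg]
  field_simp [e_ne_zero]

theorem th_add_one (z τ : ℂ) : th (z + 1) τ = -th z τ := by
  rw [th, th, show z + 1 + 1 / 2 - τ / 2 = z + 1 / 2 - τ / 2 + 1 by ring, jacobiTheta₂_add_left,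
    show τ / 8 - (z + 1) / 2 = τ / 8 - z / 2 - 1 / 2 by ring, e_sub _ (1 / 2), e_half]
  ring

theorem th_add_tau (z τ : ℂ) : th (z + τ) τ = -e (-τ / 2 - z) * th z τ := by
  rw [th, th, show z + τ + 1 / 2 - τ / 2 = z + 1 / 2 - τ / 2 + τ by ring, jacobiTheta₂_add_tau,
    show τ / 8 - (z + τ) / 2 = τ / 8 - z / 2 + -τ / 2 by ring, e_add _ (-τ / 2),
    sub_eq_add_neg (-τ / 2), e_add (-τ / 2)]
  ring

theorem th_add_int (z τ : ℂ) (n : ℤ) : th (z + n) τ = (-1) ^ n * th z τ := by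
  induction n with
  | zero => simp
  | succ n ih =>
    push_cast at ih ⊢
    rw [← add_assoc, th_add_one, ih, zpow_add_one₀ (by norm_num)]
    ring
  | pred n ih =>
    have := th_add_one (z + (-(n : ℤ) - 1 : ℤ)) τ
    rw [add_assoc] at this
    push_cast at this ih ⊢
    rw [sub_add_cancel, ih] at this
    rw [zpow_sub_one₀ (by norm_num)]
    linear_combination this

theorem th_add_int_mul_tau (z τ : ℂ) (n : ℤ) :
    th (z + n * τ) τ = (-1) ^ n * e (-(n ^ 2) * τ / 2 - n * z) * th z τ := by
  induction n with
  | zero => simp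
  | succ n ih =>
    push_cast at ih ⊢
    have h := th_add_tau (z + n * τ) τ
    rw [show z + ((n : ℂ) + 1) * τ = z + n * τ + τ by ring, h, ih, zpow_add_one₀ (by norm_num),
      show -((n : ℂ) + 1) ^ 2 * τ / 2 - (n + 1) * z
        = (-τ / 2 - (z + n * τ)) + (-(n : ℂ) ^ 2 * τ / 2 - n * z) by ring, e_add]
    ring
  | pred n ih =>
    push_cast at ih ⊢
    have h := th_add_tau (z + (-(n : ℂ) - 1) * τ) τ
    rw [show z + (-(n : ℂ) - 1) * τ + τ = z + -n * τ by ring, ih] at h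
    rw [zpow_sub_one₀ (by norm_num),
      show -(-(n : ℂ) - 1) ^ 2 * τ / 2 - (-n - 1) * z
        = (-(-(n : ℂ)) ^ 2 * τ / 2 - -n * z) - (-τ / 2 - (z + (-(n : ℂ) - 1) * τ)) by ring, e_sub]
    have hne := e_ne_zero (-τ / 2 - (z + (-(n : ℂ) - 1) * τ))
    generalize e (-τ / 2 - (z + (-(n : ℂ) - 1) * τ)) = E₂ at h hne ⊢
    generalize e (-(-(n : ℂ)) ^ 2 * τ / 2 - -n * z) = E₁ at h ⊢
    generalize th (z + (-(n : ℂ) - 1) * τ) τ = A at h ⊢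
    field_simp
    linear_combination h

theorem th_tau_add_one (z τ : ℂ) : th z (τ + 1) = e (1 / 8) * th z τ := by
  have h (w : ℂ) : jacobiTheta₂ w (τ + 1) = jacobiTheta₂ (w + 1 / 2) τ := by
    rw [jacobiTheta₂, jacobiTheta₂]
    congr 1
    funext n
    obtain ⟨m, hm⟩ : ∃ m : ℤ, n * (n - 1) = m * 2 := by
      obtain ⟨m, hm⟩ := Int.even_mul_pred_self n
      exact ⟨m, by rw [hm]; ring⟩
    have hm' : (n : ℂ) * (n - 1) = m * 2 := by exact_mod_cast hm
    rw [jacobiTheta₂_term, jacobiTheta₂_term, Complex.exp_eq_exp_iff_exists_int]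
    exact ⟨m, by linear_combination (Real.pi * Complex.I) * hm'⟩
  rw [th, th, h, show (τ + 1) / 8 - z / 2 = 1 / 8 + (τ / 8 - z / 2) by ring, e_add,
    show z + 1 / 2 - (τ + 1) / 2 + 1 / 2 = z + 1 / 2 - τ / 2 by ring]
  ring

theorem th_neg_inv (z : ℂ) {τ : ℂ} (hτ : τ ≠ 0) :
    th (z / τ) (-1 / τ) =
      -((-Complex.I * τ) ^ (1 / 2 : ℂ) * e (1 / 4)) * e (z ^ 2 / (2 * τ)) * th z τ := by
  -- The added τ is needed because z/τ + 1/2 − (−1/τ)/2 equals (z + 1/2 + τ/2)/τ.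
  set Z := z + 1 / 2 - τ / 2 + τ with hZ
  have h1 := jacobiTheta₂_functional_equation Z τ
  have hne : (-Complex.I * τ) ^ (1 / 2 : ℂ) ≠ 0 := by
    rw [Complex.cpow_ne_zero_iff]
    left
    simp [hτ]
  have h2 : Complex.exp (-Real.pi * Complex.I * Z ^ 2 / τ) = (e (Z ^ 2 / (2 * τ)))⁻¹ := by
    rw [← e_neg, e]
    congr 1
    field_simp
  rw [jacobiTheta₂_add_tau, h2] at h1
  rw [th, th, show z / τ + 1 / 2 - -1 / τ / 2 = Z / τ by rw [hZ]; field_simp; ring]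
  have h3 : jacobiTheta₂ (Z / τ) (-1 / τ) = (-Complex.I * τ) ^ (1 / 2 : ℂ) * e (Z ^ 2 / (2 * τ)) *
      (-e (-z) * jacobiTheta₂ (z + 1 / 2 - τ / 2) τ) := by
    rw [h1]
    field_simp [e_ne_zero]
  have h4 : e (-1 / τ / 8 - z / τ / 2) * (e (Z ^ 2 / (2 * τ)) * e (-z)) =
      e (1 / 4) * (e (z ^ 2 / (2 * τ)) * e (τ / 8 - z / 2)) := by
    simp only [← e_add]
    congr 1
    rw [hZ]
    field_simp
    ring
  rw [h3]
  linear_combination -((-Complex.I * τ) ^ (1 / 2 : ℂ) * jacobiTheta₂ (z + 1 / 2 - τ / 2) τ) * h4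

/-- The factor of automorphy `c τ + d`. -/
def autFactor (γ : SL(2, ℤ)) (τ : ℍ) : ℂ := (γ 1 0 : ℂ) * τ + γ 1 1

theorem autFactor_eq_denom (γ : SL(2, ℤ)) (τ : ℍ) : autFactor γ τ = denom γ τ := by
  simp [autFactor, denom]

theorem autFactor_ne_zero (γ : SL(2, ℤ)) (τ : ℍ) : autFactor γ τ ≠ 0 := by
  rw [autFactor_eq_denom]
  exact denom_ne_zero _ _

theorem coe_smul_eq (γ : SL(2, ℤ)) (τ : ℍ) :
    ((γ • τ : ℍ) : ℂ) = ((γ 0 0 : ℂ) * τ + γ 0 1) / autFactor γ τ := by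
  rw [UpperHalfPlane.specialLinearGroup_apply]
  simp [autFactor]

theorem autFactor_mul (γ γ' : SL(2, ℤ)) (τ : ℍ) :
    autFactor (γ * γ') τ = autFactor γ (γ' • τ) * autFactor γ' τ := by
  have n2 := autFactor_ne_zero γ' τ
  have c2 : autFactor γ (γ' • τ) * autFactor γ' τ =
      (γ 1 0 : ℂ) * (γ' 0 0 * τ + γ' 0 1) + γ 1 1 * autFactor γ' τ := by
    rw [autFactor, coe_smul_eq]
    field_simp
  have c1 : ((γ * γ') 1 0 : ℤ) = γ 1 0 * γ' 0 0 + γ 1 1 * γ' 1 0 := by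
    simp [Matrix.mul_apply, Fin.sum_univ_two]
  have c3 : ((γ * γ') 1 1 : ℤ) = γ 1 0 * γ' 0 1 + γ 1 1 * γ' 1 1 := by
    simp [Matrix.mul_apply, Fin.sum_univ_two]
  rw [c2, autFactor, autFactor, c1, c3]
  push_cast
  ring

theorem det_eq_one (γ : SL(2, ℤ)) : γ 0 0 * γ 1 1 - γ 0 1 * γ 1 0 = 1 := by
  have := γ.det_coe
  rwa [Matrix.det_fin_two] at this

/-- The transformation is checked on S and T and propagated by the cocycle relation. Only the
independence of κ from z is recorded: κ may depend on τ, as it cancels in products of degree 0, so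
no eighth roots of unity or square roots have to be tracked. -/
theorem th_transform (γ : SL(2, ℤ)) : ∀ τ : ℍ, ∃ κ : ℂ, κ ≠ 0 ∧ ∀ z : ℂ,
    th (z / autFactor γ τ) (γ • τ : ℍ) =
      κ * e ((γ 1 0 : ℂ) * z ^ 2 / (2 * autFactor γ τ)) * th z τ := by
  have hγ : γ ∈ Subgroup.closure {ModularGroup.S, ModularGroup.T} := by
    rw [SpecialLinearGroup.SL2Z_generators]; trivial
  induction hγ using Subgroup.closure_induction with
  | mem γ h =>
    intro τ
    rcases h with rfl | rfl
    · have h0 : (τ : ℂ) ≠ 0 := τ.ne_zero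
      have h1 : autFactor ModularGroup.S τ = τ := by simp [autFactor, ModularGroup.S]
      have h2 : ((ModularGroup.S • τ : ℍ) : ℂ) = -1 / τ := by
        rw [coe_smul_eq, h1]; simp [ModularGroup.S]
      refine ⟨-((-Complex.I * τ) ^ (1 / 2 : ℂ) * e (1 / 4)), ?_, fun z => ?_⟩
      rotate_left
      · rw [h1, h2, th_neg_inv z h0]
        simp [ModularGroup.S]
      · refine neg_ne_zero.mpr (mul_ne_zero ?_ (e_ne_zero _))
        rw [Complex.cpow_ne_zero_iff]
        left
        simp [h0]
    · have h1 : autFactor ModularGroup.T τ = 1 := by simp [autFactor, ModularGroup.T]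
      have h2 : ((ModularGroup.T • τ : ℍ) : ℂ) = τ + 1 := by
        rw [coe_smul_eq, h1]; simp [ModularGroup.T]
      refine ⟨e (1 / 8), e_ne_zero _, fun z => ?_⟩
      rw [h1, h2, div_one, th_tau_add_one]
      simp [ModularGroup.T]
  | one =>
    intro τ
    exact ⟨1, one_ne_zero, fun z => by simp [autFactor]⟩
  | mul γ γ' _ _ h h' =>
    intro τ
    obtain ⟨κ', hκ', H'⟩ := h' τ
    obtain ⟨κ, hκ, H⟩ := h (γ' • τ)
    refine ⟨κ * κ', mul_ne_zero hκ hκ', fun z => ?_⟩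
    have n1 := autFactor_ne_zero γ (γ' • τ)
    have n2 := autFactor_ne_zero γ' τ
    rw [mul_smul, autFactor_mul, mul_comm (autFactor γ _), ← div_div, H, H']
    suffices h0 : e ((γ 1 0 : ℂ) * (z / autFactor γ' τ) ^ 2 / (2 * autFactor γ (γ' • τ))) *
        e ((γ' 1 0 : ℂ) * z ^ 2 / (2 * autFactor γ' τ)) =
        e (((γ * γ') 1 0 : ℤ) * z ^ 2 / (2 * (autFactor γ' τ * autFactor γ (γ' • τ)))) by
      rw [← h0]; ring
    rw [← e_add]
    congr 1
    have c1 : ((γ * γ') 1 0 : ℤ) = γ 1 0 * γ' 0 0 + γ 1 1 * γ' 1 0 := by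
      simp [Matrix.mul_apply, Fin.sum_univ_two]
    have c2 : autFactor γ (γ' • τ) * autFactor γ' τ =
      (γ 1 0 : ℂ) * (γ' 0 0 * τ + γ' 0 1) + γ 1 1 * autFactor γ' τ := by
      rw [autFactor, coe_smul_eq]
      field_simp
    have c3 : (γ' 0 0 : ℂ) * γ' 1 1 - γ' 0 1 * γ' 1 0 = 1 := by exact_mod_cast det_eq_one γ'
    have c4 : autFactor γ' τ = (γ' 1 0 : ℂ) * τ + γ' 1 1 := rfl
    rw [c1]
    push_cast
    have c5 : ((γ 1 0 : ℂ) * γ' 0 0 + γ 1 1 * γ' 1 0) * autFactor γ' τ = γ 1 0 +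
        γ' 1 0 * (autFactor γ (γ' • τ) * autFactor γ' τ) := by
      rw [c2, c4]
      linear_combination (γ 1 0 : ℂ) * c3
    field_simp
    linear_combination -z ^ 2 * c5
  | inv γ _ h =>
    intro τ
    obtain ⟨κ, hκ, H⟩ := h (γ⁻¹ • τ)
    refine ⟨κ⁻¹, inv_ne_zero hκ, fun z => ?_⟩
    have n1 := autFactor_ne_zero γ (γ⁻¹ • τ)
    have n2 := autFactor_ne_zero γ⁻¹ τ
    have n3 : autFactor γ (γ⁻¹ • τ) * autFactor γ⁻¹ τ = 1 := by
      rw [← autFactor_mul]; simp [autFactor]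
    have h1 := H (z / autFactor γ⁻¹ τ)
    rw [smul_inv_smul, div_div, mul_comm (autFactor γ⁻¹ τ), n3, div_one] at h1
    have c1 : (γ⁻¹ 1 0 : ℤ) = -γ 1 0 := by
      simp [Matrix.SpecialLinearGroup.SL2_inv_expl]
    rw [h1, c1]
    push_cast
    have h2 : e (-(γ 1 0 : ℂ) * z ^ 2 / (2 * autFactor γ⁻¹ τ)) *
        e ((γ 1 0 : ℂ) * (z / autFactor γ⁻¹ τ) ^ 2 / (2 * autFactor γ (γ⁻¹ • τ))) = 1 := by
      rw [← e_add, ← e_zero]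
      congr 1
      field_simp
      linear_combination -(γ 1 0 : ℂ) * z ^ 2 * n3
    rw [mul_assoc κ, ← mul_assoc, mul_assoc κ⁻¹, mul_comm (e _) κ, ← mul_assoc κ⁻¹,
      inv_mul_cancel₀ hκ, one_mul, ← mul_assoc, h2, one_mul]

end

/-! ### Theta functions attached to an index modulo ℓ -/

section

/-- The theta function proportional to `siegel (j / ℓ) 0 (ℓ * τ)`, for any integer `j`. -/
def thE (ℓ : ℕ) (j : ℤ) (τ : ℂ) : ℂ := e (j ^ 2 * τ / (2 * ℓ)) * th (j * τ) (ℓ * τ)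

theorem thE_neg (ℓ : ℕ) (j : ℤ) (τ : ℂ) : thE ℓ (-j) τ = -thE ℓ j τ := by
  rw [thE, thE]
  push_cast
  rw [neg_mul, th_neg]
  ring_nf

/-- The Gaussian prefactor in `thE` is chosen to cancel the quasi-period factor of `th`. With
oddness, only the class of j modulo ℓ and ±1 matters, up to sign. -/
theorem thE_add_mul {ℓ : ℕ} (hℓ : ℓ ≠ 0) (j m : ℤ) (τ : ℂ) :
    thE ℓ (j + m * ℓ) τ = (-1) ^ m * thE ℓ j τ := by
  have hℓ' : (ℓ : ℂ) ≠ 0 := by exact_mod_cast hℓ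
  have h := th_add_int_mul_tau (j * τ) (ℓ * τ) m
  rw [thE, thE]
  push_cast
  rw [show ((j : ℂ) + m * ℓ) * τ = j * τ + m * (ℓ * τ) by ring, h]
  have h2 : e (((j : ℂ) + m * ℓ) ^ 2 * τ / (2 * ℓ)) * e (-(m : ℂ) ^ 2 * (ℓ * τ) / 2 - m * (j * τ)) =
      e (j ^ 2 * τ / (2 * ℓ)) := by
    rw [← e_add]
    congr 1
    field_simp
    ring
  linear_combination (-1) ^ m * th (j * τ) (ℓ * τ) * h2

theorem thE_eq_siegel {ℓ : ℕ} {j : ℕ} (hj : 0 < j) (hjℓ : j < ℓ) (τ : ℍ) :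
    thE ℓ j τ = -(e (ℓ * τ / 24) * ∏' n : ℕ, (1 - e (ℓ * (τ : ℂ)) ^ (n + 1))) *
      siegel (j / ℓ) 0 (ℓ * (τ : ℂ)) := by
  have hℓ : (ℓ : ℂ) ≠ 0 := by exact_mod_cast (by omega : ℓ ≠ 0)
  have hℓ0 : (0 : ℝ) < ℓ := by exact_mod_cast (by omega : 0 < ℓ)
  have hτ : 0 < ((ℓ : ℂ) * (τ : ℂ)).im := by simpa using mul_pos hℓ0 τ.im_pos
  have hfr : Int.fract ((j : ℚ) / ℓ) = j / ℓ := by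
    rw [Int.fract_eq_self]
    have : (0 : ℚ) < ℓ := by exact_mod_cast (by omega : 0 < ℓ)
    refine ⟨by positivity, ?_⟩
    rw [div_lt_one this]
    exact_mod_cast hjℓ
  rw [thE, th_eq_prod _ hτ, siegel, B₂, hfr]
  have h1 : ∀ n : ℕ, siegelFactor (j / ℓ) 0 (ℓ * τ) n =
      (1 - e (ℓ * τ) ^ n * e (j * τ)) * (1 - e (ℓ * τ) ^ (n + 1) * (e (j * τ))⁻¹) := by
    intro n
    rw [siegelFactor]
    simp only [Rat.cast_zero, neg_zero, e_zero, mul_one]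
    rw [← e_nat_mul, ← e_nat_mul, ← e_neg, ← e_add, ← e_add]
    push_cast
    congr 3 <;> · field_simp; try ring
  simp only [h1]
  have h2 : e ((j : ℂ) ^ 2 * τ / (2 * ℓ)) * e (ℓ * τ / 8 - j * τ / 2) = e (ℓ * τ / 24) *
      e ((((j / ℓ : ℚ) ^ 2 - (j / ℓ : ℚ) + 1 / 6 : ℚ) : ℂ) / 2 * (ℓ * τ)) := by
    rw [← e_add, ← e_add]
    congr 1
    push_cast
    field_simp
    ring
  simp only [Rat.cast_zero, zero_mul, zero_div, e_zero, mul_one, Int.cast_natCast]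
  rw [← mul_assoc, h2]
  ring

/-- Conjugation by diag(ℓ, 1) turns γ into an element of SL₂(ℤ) acting on ℓτ. The Gaussian factor of
`th_transform` cancels that of `thE` up to a root of unity, and the index is multiplied by the upper
left entry. -/
theorem thE_Gamma0 {ℓ : ℕ} (hℓ : ℓ ≠ 0) {γ : SL(2, ℤ)} {c : ℤ} (hc : γ 1 0 = ℓ * c) (τ : ℍ) :
    ∃ κ : ℂ, κ ≠ 0 ∧ ∀ j : ℤ, thE ℓ j (γ • τ : ℍ) =
      κ * (e ((j ^ 2 * (γ 0 0 * γ 0 1) : ℤ) / (2 * ℓ)) * (-1) ^ (j * γ 0 1) *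
        thE ℓ (j * γ 0 0) τ) := by
  have hℓ' : (ℓ : ℂ) ≠ 0 := by exact_mod_cast hℓ
  have hℓ0 : (0 : ℝ) < ℓ := by exact_mod_cast (by omega : 0 < ℓ)
  have hdet := det_eq_one γ
  let γ' : SL(2, ℤ) := ⟨!![γ 0 0, ℓ * γ 0 1; c, γ 1 1], by
    rw [Matrix.det_fin_two_of]; rw [hc] at hdet; linarith⟩
  let τ' : ℍ := ⟨ℓ * τ, by simpa using mul_pos hℓ0 τ.im_pos⟩
  have hτ' : (τ' : ℂ) = ℓ * τ := rfl
  have e00 : γ' 0 0 = γ 0 0 := rfl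
  have e01 : γ' 0 1 = ℓ * γ 0 1 := rfl
  have e10 : γ' 1 0 = c := rfl
  have e11 : γ' 1 1 = γ 1 1 := rfl
  have ha : autFactor γ' τ' = autFactor γ τ := by
    rw [autFactor, autFactor, hτ', e10, e11, hc]; push_cast; ring
  have hn := autFactor_ne_zero γ τ
  have hs : ((γ' • τ' : ℍ) : ℂ) = ℓ * (γ • τ : ℍ) := by
    rw [coe_smul_eq, coe_smul_eq, ha, hτ', e00, e01]; push_cast; ring
  obtain ⟨κ, hκ, H⟩ := th_transform γ' τ'
  refine ⟨κ, hκ, fun j => ?_⟩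
  have h1 := H (j * (γ 0 0 * τ + γ 0 1))
  have hz : (j : ℂ) * (γ 0 0 * τ + γ 0 1) / autFactor γ τ = j * (γ • τ : ℍ) := by
    rw [coe_smul_eq]; ring
  rw [ha, hs, hz, hτ', e10] at h1
  have h2 := th_add_int ((j * γ 0 0 : ℤ) * τ) (ℓ * τ) (j * γ 0 1)
  rw [show ((j * γ 0 0 : ℤ) * τ : ℂ) + (j * γ 0 1 : ℤ) = j * (γ 0 0 * τ + γ 0 1) by
    push_cast; ring] at h2
  rw [thE, thE, h1, h2]
  have h3 : e ((j : ℂ) ^ 2 * (γ • τ : ℍ) / (2 * ℓ)) *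
      e ((c : ℂ) * (j * (γ 0 0 * τ + γ 0 1)) ^ 2 / (2 * autFactor γ τ)) =
      e ((j ^ 2 * (γ 0 0 * γ 0 1) : ℤ) / (2 * ℓ)) *
        e (((j * γ 0 0 : ℤ) : ℂ) ^ 2 * τ / (2 * ℓ)) := by
    rw [← e_add, ← e_add]
    congr 1
    rw [coe_smul_eq]
    push_cast
    field_simp
    have h4 : autFactor γ τ = (ℓ : ℂ) * c * τ + γ 1 1 := by rw [autFactor, hc]; push_cast; ring
    have h5 : (γ 0 0 : ℂ) * γ 1 1 - γ 0 1 * (ℓ * c) = 1 := by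
      rw [hc] at hdet; exact_mod_cast hdet
    rw [h4]
    linear_combination (-(j : ℂ) ^ 2 * (γ 0 0 * τ + γ 0 1 : ℂ)) * h5
  linear_combination κ * ((-1) ^ (j * γ 0 1) * th ((j * γ 0 0 : ℤ) * τ) (ℓ * τ)) * h3

/-- Here diag(ℓ, 1)γ = γ′ · (1, x; 0, ℓ) with γ′ in SL₂(ℤ). The theta argument becomes the real
number jb/ℓ, which is what later makes the order 0 at these cusps. -/
theorem thE_not_Gamma0 {ℓ : ℕ} (hℓ : ℓ.Prime) {γ : SL(2, ℤ)} (hc : ¬ (ℓ : ℤ) ∣ γ 1 0) :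
    ∃ x b : ℤ, ¬ (ℓ : ℤ) ∣ b ∧ ∀ τ : ℍ, ∃ κ : ℂ, κ ≠ 0 ∧ ∀ j : ℤ, thE ℓ j (γ • τ : ℍ) =
      κ * (e (-(j ^ 2 * (γ 0 0 * b) : ℤ) / (2 * ℓ)) * (-1) ^ (j * γ 0 0) *
        th (j * b / ℓ) ((τ + x) / ℓ)) := by
  have hℓ' : (ℓ : ℂ) ≠ 0 := by exact_mod_cast hℓ.ne_zero
  have hℓ0 : (0 : ℝ) < ℓ := by exact_mod_cast hℓ.pos
  have hdet := det_eq_one γ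
  -- The lower left entry is invertible modulo ℓ, so x can be solved from the lower row.
  obtain ⟨x, d, hxd⟩ : ∃ x d : ℤ, γ 1 1 = γ 1 0 * x + ℓ * d := by
    have hcop : IsCoprime (γ 1 0) (ℓ : ℤ) :=
      ((Nat.prime_iff_prime_int.mp hℓ).coprime_iff_not_dvd.mpr hc).symm
    obtain ⟨u, v, huv⟩ := hcop
    exact ⟨u * γ 1 1, v * γ 1 1, by linear_combination (-γ 1 1) * huv⟩
  set b : ℤ := γ 0 1 - γ 0 0 * x with hb
  have hdet2 : ℓ * γ 0 0 * d - b * γ 1 0 = 1 := by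
    rw [hb]; rw [hxd] at hdet; linarith
  refine ⟨x, b, ?_, fun τ => ?_⟩
  · rintro ⟨m, hm⟩
    rw [hm] at hdet2
    have : (ℓ : ℤ) ∣ 1 := ⟨γ 0 0 * d - m * γ 1 0, by linarith⟩
    exact hℓ.one_lt.ne' (by exact_mod_cast Int.eq_one_of_dvd_one (by positivity) this)
  let γ' : SL(2, ℤ) := ⟨!![ℓ * γ 0 0, b; γ 1 0, d], by rw [Matrix.det_fin_two_of]; exact hdet2⟩
  let τ' : ℍ := ⟨(τ + x) / ℓ, by
    rw [← Complex.ofReal_natCast, Complex.div_ofReal_im]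
    have : 0 < ((τ : ℂ) + x).im := by simpa using τ.im_pos
    exact div_pos this hℓ0⟩
  have hτ' : (τ' : ℂ) = (τ + x) / ℓ := rfl
  have e00 : γ' 0 0 = ℓ * γ 0 0 := rfl
  have e01 : γ' 0 1 = b := rfl
  have e10 : γ' 1 0 = γ 1 0 := rfl
  have e11 : γ' 1 1 = d := rfl
  have hn := autFactor_ne_zero γ τ
  have h4 : autFactor γ τ = (γ 1 0 : ℂ) * τ + (γ 1 0 * x + ℓ * d) := by
    rw [autFactor, hxd]; push_cast; ring
  have ha : autFactor γ' τ' = autFactor γ τ / ℓ := by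
    rw [h4, autFactor, hτ', e10, e11]; field_simp; ring
  have hs : ((γ' • τ' : ℍ) : ℂ) = ℓ * (γ • τ : ℍ) := by
    rw [coe_smul_eq, coe_smul_eq, ha, hτ', e00, e01, hb]; push_cast; field_simp; ring
  obtain ⟨κ, hκ, H⟩ := th_transform γ' τ'
  refine ⟨κ, hκ, fun j => ?_⟩
  have h1 := H (j * (γ 0 0 * τ + γ 0 1) / ℓ)
  have hz : (j : ℂ) * (γ 0 0 * τ + γ 0 1) / ℓ / (autFactor γ τ / ℓ) = j * (γ • τ : ℍ) := by
    rw [coe_smul_eq]; field_simp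
  rw [ha, hs, hz, e10] at h1
  have h2 := th_add_int_mul_tau (j * b / ℓ) τ' (j * γ 0 0)
  rw [show (j : ℂ) * b / ℓ + (j * γ 0 0 : ℤ) * τ' = j * (γ 0 0 * τ + γ 0 1) / ℓ by
    rw [hτ', hb]; push_cast; field_simp; ring] at h2
  rw [h2] at h1
  rw [thE, h1, ← hτ']
  have h3 : e ((j : ℂ) ^ 2 * (γ • τ : ℍ) / (2 * ℓ)) *
      e ((γ 1 0 : ℂ) * (j * (γ 0 0 * τ + γ 0 1) / ℓ) ^ 2 / (2 * (autFactor γ τ / ℓ))) *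
      e (-((j * γ 0 0 : ℤ) : ℂ) ^ 2 * τ' / 2 - (j * γ 0 0 : ℤ) * (j * b / ℓ)) =
      e (-(j ^ 2 * (γ 0 0 * b) : ℤ) / (2 * ℓ)) := by
    rw [← e_add, ← e_add]
    congr 1
    rw [coe_smul_eq, hτ', hb]
    push_cast
    field_simp
    have h5 : (γ 0 0 : ℂ) * (γ 1 0 * x + ℓ * d) - γ 0 1 * γ 1 0 = 1 := by
      rw [hxd] at hdet; exact_mod_cast hdet
    rw [h4]
    linear_combination (-(j : ℂ) ^ 2 * (γ 0 0 * τ + γ 0 1 : ℂ)) * h5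
  linear_combination κ * ((-1) ^ (j * γ 0 0) * th (j * b / ℓ) τ') * h3

end

/-! ### Power series on the unit disc and Euler products -/

section

/-- The power series `p` converges to `F` on the open unit disc. -/
def Rep (p : PowerSeries ℂ) (F : ℂ → ℂ) : Prop :=
  ∀ z : ℂ, ‖z‖ < 1 → HasSum (fun n => p.coeff n * z ^ n) (F z)

theorem Rep.hasFPowerSeriesOnBall {p : PowerSeries ℂ} {F : ℂ → ℂ} (h : Rep p F) :
    HasFPowerSeriesOnBall F (.ofScalars ℂ fun n => p.coeff n) 0 1 := by
  constructor
  · refine le_of_forall_lt_imp_le_of_dense fun r hr => ?_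
    lift r to NNReal using hr.ne_top
    apply FormalMultilinearSeries.le_radius_of_summable
    simpa [mul_comm, mul_left_comm, mul_assoc] using (h (r : ℝ) (by simpa using hr)).summable.norm
  · simp
  · intro y hy
    rw [← ENNReal.coe_one, Metric.eball_coe, NNReal.coe_one, mem_ball_zero_iff] at hy
    simpa [mul_comm] using h y hy

theorem Rep.unique {p p' : PowerSeries ℂ} {F : ℂ → ℂ} (h : Rep p F) (h' : Rep p' F) : p = p' := by
  have := h.hasFPowerSeriesOnBall.hasFPowerSeriesAt.eq_formalMultilinearSeries
    h'.hasFPowerSeriesOnBall.hasFPowerSeriesAt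
  ext n
  exact congrFun (FormalMultilinearSeries.ofScalars_series_injective ℂ ℂ this) n

theorem Rep.differentiableOn {p : PowerSeries ℂ} {F : ℂ → ℂ} (h : Rep p F) :
    DifferentiableOn ℂ F (Metric.ball 0 1) := by
  have := h.hasFPowerSeriesOnBall.differentiableOn
  rwa [← ENNReal.coe_one, Metric.eball_coe, NNReal.coe_one] at this

theorem Rep.coeff_zero {p : PowerSeries ℂ} {F : ℂ → ℂ} (h : Rep p F) :
    F 0 = PowerSeries.coeff 0 p := by
  have h1 := h 0 (by simp)
  refine h1.unique ?_
  have := hasSum_single (f := fun n => p.coeff n * (0 : ℂ) ^ n) 0 (fun n hn => by simp [hn])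
  simpa using this

/-- The Taylor series at `0`. -/
def taylor (F : ℂ → ℂ) : PowerSeries ℂ :=
  .mk fun n => (n.factorial : ℂ)⁻¹ * iteratedDeriv n F 0

theorem rep_taylor {F : ℂ → ℂ} (h : DifferentiableOn ℂ F (Metric.ball 0 1)) :
    Rep (taylor F) F := by
  intro z hz
  have := Complex.hasSum_taylorSeries_on_ball h (z := z) (by simpa using hz)
  refine (congrArg (fun f => HasSum f _) (funext fun n => ?_)).mp this
  simp [taylor, mul_comm, mul_left_comm]

theorem Rep.add {p p' : PowerSeries ℂ} {F F' : ℂ → ℂ} (h : Rep p F) (h' : Rep p' F') :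
    Rep (p + p') (fun z => F z + F' z) := by
  intro z hz
  simpa [add_mul] using (h z hz).add (h' z hz)

theorem Rep.const_mul {p : PowerSeries ℂ} {F : ℂ → ℂ} (c : ℂ) (h : Rep p F) :
    Rep (c • p) (fun z => c * F z) := by
  intro z hz
  simpa [mul_assoc] using (h z hz).mul_left c

theorem Rep.mul {p p' : PowerSeries ℂ} {F F' : ℂ → ℂ} (h : Rep p F) (h' : Rep p' F') :
    Rep (p * p') (fun z => F z * F' z) := by
  intro z hz
  have h1 := (h z hz).summable.norm
  have h2 := (h' z hz).summable.norm
  have h3 := (summable_norm_sum_mul_antidiagonal_of_summable_norm h1 h2).of_norm.hasSum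
  rw [← tsum_mul_tsum_eq_tsum_sum_antidiagonal_of_summable_norm h1 h2, (h z hz).tsum_eq,
    (h' z hz).tsum_eq] at h3
  refine (congrArg (fun f => HasSum f _) (funext fun n => ?_)).mp h3
  rw [PowerSeries.coeff_mul, Finset.sum_mul]
  refine Finset.sum_congr rfl fun x hx => ?_
  rw [← Finset.HasAntidiagonal.mem_antidiagonal.mp hx, pow_add]
  ring

theorem rep_C (c : ℂ) : Rep (PowerSeries.C c) (fun _ => c) := by
  intro z _
  have := hasSum_single (f := fun n => (PowerSeries.C c).coeff n * z ^ n) 0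
    (fun n hn => by simp [PowerSeries.coeff_C, hn])
  simpa using this

theorem rep_X : Rep PowerSeries.X (fun z => z) := by
  intro z _
  have := hasSum_single (f := fun n => (PowerSeries.X : PowerSeries ℂ).coeff n * z ^ n) 1
    (fun n hn => by simp [PowerSeries.coeff_X, hn])
  simpa using this

theorem rep_one : Rep 1 (fun _ => 1) := by simpa using rep_C 1

theorem Rep.pow {p : PowerSeries ℂ} {F : ℂ → ℂ} (h : Rep p F) (n : ℕ) :
    Rep (p ^ n) (fun z => F z ^ n) := by
  induction n with
  | zero => simpa using rep_one
  | succ n ih => simpa [pow_succ] using ih.mul h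

theorem Rep.prod {ι : Type*} (s : Finset ι) {p : ι → PowerSeries ℂ} {F : ι → ℂ → ℂ}
    (h : ∀ i ∈ s, Rep (p i) (F i)) : Rep (∏ i ∈ s, p i) (fun z => ∏ i ∈ s, F i z) := by
  classical
  induction s using Finset.induction_on with
  | empty => simpa using rep_one
  | insert a s ha ih =>
    simp only [Finset.prod_insert ha]
    exact (h a (Finset.mem_insert_self _ _)).mul
      (ih fun i hi => h i (Finset.mem_insert_of_mem hi))

theorem Rep.congr {p : PowerSeries ℂ} {F F' : ℂ → ℂ} (h : Rep p F)
    (h' : ∀ z, ‖z‖ < 1 → F z = F' z) : Rep p F' := fun z hz => h' z hz ▸ h z hz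

/-- Locally uniform convergence passes to derivatives. This identifies the Taylor series of an
infinite product with the formal product, and so shows that its coefficients are integers. -/
theorem tendsto_coeff_of_tendstoLocallyUniformlyOn {p : ℕ → PowerSeries ℂ} {F : ℕ → ℂ → ℂ}
    {P : PowerSeries ℂ} {G : ℂ → ℂ} (hp : ∀ N, Rep (p N) (F N)) (hP : Rep P G)
    (h : TendstoLocallyUniformlyOn F G atTop (Metric.ball 0 1)) (n : ℕ) :
    Tendsto (fun N => (p N).coeff n) atTop (𝓝 (P.coeff n)) := by
  have key : ∀ n, (∀ N, DifferentiableOn ℂ (iteratedDeriv n (F N)) (Metric.ball 0 1)) ∧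
      TendstoLocallyUniformlyOn (fun N => iteratedDeriv n (F N)) (iteratedDeriv n G) atTop
        (Metric.ball 0 1) := by
    intro n
    induction n with
    | zero => simpa using ⟨fun N => (hp N).differentiableOn, h⟩
    | succ n ih =>
      simp only [iteratedDeriv_succ]
      exact ⟨fun N => (ih.1 N).deriv Metric.isOpen_ball,
        ih.2.deriv (Eventually.of_forall ih.1) Metric.isOpen_ball⟩
  have h1 (N) : (p N).coeff n = (n.factorial : ℂ)⁻¹ * iteratedDeriv n (F N) 0 := by
    rw [(hp N).unique (rep_taylor (hp N).differentiableOn), taylor, PowerSeries.coeff_mk]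
  have h2 : P.coeff n = (n.factorial : ℂ)⁻¹ * iteratedDeriv n G 0 := by
    rw [hP.unique (rep_taylor hP.differentiableOn), taylor, PowerSeries.coeff_mk]
  simp only [h1, h2]
  exact ((key n).2.tendsto_at (by simp)).const_mul _

/-- The product `∏ (1 - c_m z ^ (m + 1))`. -/
def eulerProd (c : ℕ → ℂ) (z : ℂ) : ℂ := ∏' m : ℕ, (1 - c m * z ^ (m + 1))

section eulerProd

variable {c : ℕ → ℂ} (hc : ∀ m, ‖c m‖ ≤ 1)

include hc

theorem summable_eulerProd {z : ℂ} (hz : ‖z‖ < 1) : Summable fun m => ‖-(c m * z ^ (m + 1))‖ := by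
  refine Summable.of_nonneg_of_le (fun _ => norm_nonneg _) (fun m => ?_)
    ((summable_nat_add_iff 1).mpr (summable_geometric_of_lt_one (norm_nonneg z) hz))
  rw [norm_neg, norm_mul, norm_pow]
  exact mul_le_of_le_one_left (by positivity) (hc m)

theorem multipliable_eulerProd {z : ℂ} (hz : ‖z‖ < 1) :
    Multipliable fun m => (1 - c m * z ^ (m + 1)) := by
  simpa [sub_eq_add_neg] using multipliable_one_add_of_summable (summable_eulerProd hc hz)

theorem eulerProd_ne_zero {z : ℂ} (hz : ‖z‖ < 1) : eulerProd c z ≠ 0 := by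
  have := tprod_one_add_ne_zero_of_summable (f := fun m => -(c m * z ^ (m + 1)))
    (fun m h => ?_) (summable_eulerProd hc hz)
  · simpa [eulerProd, sub_eq_add_neg] using this
  · have h1 : c m * z ^ (m + 1) = 1 := by linear_combination -h
    have h2 : ‖c m * z ^ (m + 1)‖ < 1 := by
      rw [norm_mul, norm_pow]
      exact (mul_le_of_le_one_left (by positivity) (hc m)).trans_lt
        (pow_lt_one₀ (norm_nonneg _) hz (by omega))
    rw [h1] at h2
    simp at h2

theorem hasProdLocallyUniformlyOn_eulerProd :
    HasProdLocallyUniformlyOn (fun m z => 1 - c m * z ^ (m + 1)) (eulerProd c)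
      (Metric.ball (0 : ℂ) 1) := by
  unfold eulerProd
  simp_rw [sub_eq_add_neg]
  apply hasProdLocallyUniformlyOn_of_forall_compact Metric.isOpen_ball
  intro K hK hcK
  rcases K.eq_empty_or_nonempty with hN | hN
  · simpa [hasProdUniformlyOn_iff_tendstoUniformlyOn, hN] using tendstoUniformlyOn_empty
  · obtain ⟨q₀, hq₀, _, HB⟩ := hcK.exists_sSup_image_eq_and_ge hN
      (show ContinuousOn (fun q : ℂ ↦ ‖q‖) K by fun_prop)
    refine ((summable_nat_add_iff 1).mpr (summable_geometric_of_lt_one (norm_nonneg _)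
      (by simpa [Metric.mem_ball, dist_zero_right] using hK hq₀))).hasProdUniformlyOn_nat_one_add
      hcK (.of_forall fun n x hx ↦ ?_) (fun _ ↦ by fun_prop)
    rw [norm_neg, norm_mul, norm_pow]
    exact (mul_le_of_le_one_left (by positivity) (hc n)).trans
      (pow_le_pow_left₀ (norm_nonneg _) (HB x hx) (n + 1))

theorem differentiableOn_eulerProd : DifferentiableOn ℂ (eulerProd c) (Metric.ball 0 1) :=
  (hasProdLocallyUniformlyOn_eulerProd hc).differentiableOn
    (.of_forall fun _ ↦ by simpa [Finset.prod_fn] using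
      DifferentiableOn.finsetProd (fun _ _ ↦ by fun_prop)) Metric.isOpen_ball

end eulerProd

theorem eulerProd_zero (c : ℕ → ℂ) : eulerProd c 0 = 1 := by simp [eulerProd]

open PowerSeries in
/-- The finite products in `ℤ⟦X⟧` approximating `eulerProd`, for exponents in `S`. -/
def eulerPoly (S : Set ℕ) [DecidablePred (· ∈ S)] (M : ℕ) : PowerSeries ℤ :=
  ∏ m ∈ Finset.range M, (1 - C (if m + 1 ∈ S then 1 else 0 : ℤ) * X ^ (m + 1))

/-- The power series `∏ (1 - X ^ n)`, the product over all positive elements `n` of `S`. -/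
def eulerSer (S : Set ℕ) [DecidablePred (· ∈ S)] : PowerSeries ℤ :=
  .mk fun n => (eulerPoly S n).coeff n

/-- The power series `∑ (∑ d) X ^ n`, the inner sum over all divisors of `n` in `S`. -/
def sigmaSer (S : Set ℕ) [DecidablePred (· ∈ S)] : PowerSeries ℤ :=
  .mk fun n => ∑ d ∈ n.divisors with d ∈ S, (d : ℤ)

section eulerSer

variable (S : Set ℕ) [DecidablePred (· ∈ S)]

theorem coeff_eulerPoly_of_le {n M : ℕ} (h : n ≤ M) :
    (eulerPoly S M).coeff n = (eulerSer S).coeff n := by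
  induction M, h using Nat.le_induction with
  | base => simp [eulerSer]
  | succ M hM ih =>
    rw [eulerPoly, Finset.prod_range_succ, ← eulerPoly, mul_sub, mul_one, map_sub, ih,
      mul_left_comm, PowerSeries.coeff_C_mul, PowerSeries.coeff_mul_X_pow',
      if_neg (show ¬ M + 1 ≤ n by omega)]
    simp

theorem coeff_zero_eulerSer : (eulerSer S).coeff 0 = 1 := by
  simp [eulerSer, eulerPoly]

theorem rep_eulerSer : Rep ((eulerSer S).map (Int.castRingHom ℂ))
    (eulerProd fun m => if m + 1 ∈ S then 1 else 0) := by
  set c : ℕ → ℂ := fun m => if m + 1 ∈ S then 1 else 0 with hc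
  have hc1 : ∀ m, ‖c m‖ ≤ 1 := fun m => by simp only [hc]; split_ifs <;> simp
  have h1 := rep_taylor (differentiableOn_eulerProd hc1)
  have h2 (N : ℕ) : Rep ((eulerPoly S N).map (Int.castRingHom ℂ))
      (fun z => ∏ m ∈ Finset.range N, (1 - c m * z ^ (m + 1))) := by
    rw [eulerPoly, map_prod]
    refine Rep.prod _ fun m _ => ?_
    have := rep_one.add ((rep_X.pow (m + 1)).const_mul (-c m))
    simp only [neg_mul, ← sub_eq_add_neg] at this
    convert this using 1
    simp only [hc]
    split_ifs <;> simp [sub_eq_add_neg]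
  have h3 := tendsto_coeff_of_tendstoLocallyUniformlyOn h2 h1
    (hasProdLocallyUniformlyOn_eulerProd hc1).tendstoLocallyUniformlyOn_finsetRange
  convert h1 using 1
  ext n
  refine tendsto_nhds_unique (tendsto_const_nhds.congr' ?_) (h3 n)
  filter_upwards [eventually_ge_atTop n] with N hN
  rw [PowerSeries.coeff_map, PowerSeries.coeff_map, coeff_eulerPoly_of_le S hN]

open PowerSeries in
/-- The expansion of the logarithmic derivative of `1 - X ^ d`. -/
def geomSer (d : ℕ) : PowerSeries ℤ := .mk fun n => if d ∣ n ∧ n ≠ 0 then (d : ℤ) else 0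

open PowerSeries in
theorem geomSer_mul (d : ℕ) :
    geomSer (d + 1) * (1 - X ^ (d + 1)) = C ((d + 1 : ℕ) : ℤ) * X ^ (d + 1) := by
  ext n
  rw [mul_sub, mul_one, map_sub, coeff_mul_X_pow', coeff_C_mul, coeff_X_pow]
  simp only [geomSer, coeff_mk]
  by_cases h : d + 1 ≤ n
  · obtain ⟨r, rfl⟩ := Nat.exists_eq_add_of_le h
    have h1 : d + 1 ∣ d + 1 + r ↔ d + 1 ∣ r := (Nat.dvd_add_right (dvd_refl _))
    by_cases hr : r = 0
    · subst hr; simp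
    · simp [h1, hr]
  · have h1 : ¬ (d + 1 ∣ n ∧ n ≠ 0) := by
      rintro ⟨h1, h2⟩
      exact h (Nat.le_of_dvd (Nat.pos_of_ne_zero h2) h1)
    have h2 : n ≠ d + 1 := by omega
    simp [h1, h2, h]

open PowerSeries in
theorem X_mul_derivative_eulerPoly (M : ℕ) :
    X * derivative ℤ (eulerPoly S M) =
      -(eulerPoly S M * ∑ m ∈ Finset.range M with m + 1 ∈ S, geomSer (m + 1)) := by
  induction M with
  | zero => simp [eulerPoly]
  | succ M ih =>
    rw [eulerPoly, Finset.prod_range_succ, ← eulerPoly, Finset.range_add_one, Finset.filter_insert]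
    by_cases h : M + 1 ∈ S
    · have h1 : X * derivative ℤ (1 - X ^ (M + 1) : PowerSeries ℤ) =
          -(geomSer (M + 1) * (1 - X ^ (M + 1))) := by
        rw [geomSer_mul]
        ext n
        rcases n with _ | n
        · simp
        · rw [coeff_succ_X_mul, coeff_derivative, map_sub, coeff_X_pow, map_neg,
            coeff_C_mul, coeff_X_pow, coeff_one]
          by_cases hn : n = M
          · subst hn; simp
          · simp [hn]
      rw [if_pos h, if_pos h, map_one, one_mul, Derivation.leibniz,
        Finset.sum_insert (by simp), smul_eq_mul,
        smul_eq_mul]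
      linear_combination eulerPoly S M * h1 + (1 - X ^ (M + 1)) * ih
    · rw [if_neg h, if_neg h, map_zero, zero_mul, sub_zero, mul_one, ih]

open PowerSeries in
-- Each factor 1 − X^d contributes −(dX^d + dX^{2d} + ⋯) to the logarithmic derivative; collecting
-- the powers of X gives divisor sums. For the n-th coefficient a finite truncation is enough.
theorem X_mul_derivative_eulerSer :
    X * derivative ℤ (eulerSer S) = -(eulerSer S * sigmaSer S) := by
  have h2 : ∀ n M, n ≤ M →
      (∑ m ∈ Finset.range M with m + 1 ∈ S, geomSer (m + 1)).coeff n = (sigmaSer S).coeff n := by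
    intro n M hn
    rw [map_sum, sigmaSer, coeff_mk]
    simp only [geomSer, coeff_mk]
    rw [← Finset.sum_filter, Finset.filter_filter]
    refine Finset.sum_bij (fun m _ => m + 1) ?_ ?_ ?_ ?_
    · intro m hm
      simp only [Finset.mem_filter, Finset.mem_range, Nat.mem_divisors] at hm ⊢
      tauto
    · intro a _ b _ h
      omega
    · intro d hd
      simp only [Finset.mem_filter, Nat.mem_divisors] at hd
      have h1 := Nat.pos_of_dvd_of_pos hd.1.1 (Nat.pos_of_ne_zero hd.1.2)
      have h2 := Nat.le_of_dvd (Nat.pos_of_ne_zero hd.1.2) hd.1.1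
      refine ⟨d - 1, ?_, by omega⟩
      simp only [Finset.mem_filter, Finset.mem_range]
      rw [show d - 1 + 1 = d by omega]
      exact ⟨by omega, hd.2, hd.1⟩
    · intro m _
      rfl
  ext n
  have h1 := congrArg (coeff n) (X_mul_derivative_eulerPoly S n)
  rcases n with _ | n
  · simp [sigmaSer]
  · rw [coeff_succ_X_mul, coeff_derivative] at h1 ⊢
    rw [coeff_eulerPoly_of_le S le_rfl, map_neg, coeff_mul] at h1
    rw [h1, map_neg, coeff_mul]
    congr 1
    refine Finset.sum_congr rfl fun x hx => ?_
    have := Finset.HasAntidiagonal.mem_antidiagonal.mp hx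
    rw [coeff_eulerPoly_of_le S (by omega), h2 _ _ (by omega)]

end eulerSer

end

/-! ### Classes modulo ±1 and Siegel functions as Euler products -/

section

/-- The group `(ℤ/ℓ)^× / {±1}`. -/
abbrev Cl (ℓ : ℕ) := (ZMod ℓ)ˣ ⧸ Subgroup.zpowers (-1 : (ZMod ℓ)ˣ)

theorem cl_eq_iff {ℓ : ℕ} (a b : (ZMod ℓ)ˣ) :
    ((a : Cl ℓ) = (b : Cl ℓ)) ↔ b = a ∨ b = -a := by
  rw [QuotientGroup.eq, Subgroup.mem_zpowers_iff]
  constructor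
  · rintro ⟨k, hk⟩
    rcases Int.even_or_odd k with h | h
    · rw [h.neg_one_zpow] at hk
      left
      rw [eq_comm, inv_mul_eq_one] at hk
      exact hk.symm
    · rw [h.neg_one_zpow] at hk
      right
      rw [eq_inv_mul_iff_mul_eq] at hk
      rw [← hk]; simp
  · rintro (rfl | rfl)
    · exact ⟨0, by simp⟩
    · exact ⟨1, by simp⟩

variable {ℓ : ℕ} [hp : Fact ℓ.Prime]

/-- The representative in `{1, …, ℓ - 1}` of a class. -/
def repr (x : Cl ℓ) : ℕ := ((Quotient.out x : (ZMod ℓ)ˣ) : ZMod ℓ).val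

theorem repr_lt (x : Cl ℓ) : repr x < ℓ := by
  have : NeZero ℓ := ⟨hp.out.ne_zero⟩
  exact ZMod.val_lt _

theorem repr_pos (x : Cl ℓ) : 0 < repr x := by
  rw [repr, Nat.pos_iff_ne_zero, Ne, ZMod.val_eq_zero]
  exact (Quotient.out x : (ZMod ℓ)ˣ).ne_zero

theorem cast_repr (x : Cl ℓ) : ((repr x : ℕ) : ZMod ℓ) = (Quotient.out x : (ZMod ℓ)ˣ) := by
  have : NeZero ℓ := ⟨hp.out.ne_zero⟩
  rw [repr, ZMod.natCast_zmod_val]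

theorem mk_out (x : Cl ℓ) : ((Quotient.out x : (ZMod ℓ)ˣ) : Cl ℓ) = x := Quotient.out_eq x

/-- The class of an integer prime to `ℓ` is `x`. -/
def IsClass (x : Cl ℓ) (j : ℤ) : Prop := ∃ u : (ZMod ℓ)ˣ, (u : ZMod ℓ) = j ∧ (u : Cl ℓ) = x

theorem isClass_repr (x : Cl ℓ) : IsClass x (repr x) :=
  ⟨Quotient.out x, by rw [Int.cast_natCast, cast_repr], mk_out x⟩

theorem isClass_iff (x : Cl ℓ) (j : ℤ) :
    IsClass x j ↔ (∃ m, j = repr x + m * ℓ) ∨ ∃ m, j = -repr x + m * ℓ := by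
  have key (i : ℤ) : (∃ m, j = i + m * ℓ) ↔ (j : ZMod ℓ) = i := by
    rw [eq_comm, ZMod.intCast_eq_intCast_iff_dvd_sub]
    constructor
    · rintro ⟨m, rfl⟩
      exact ⟨m, by ring⟩
    · rintro ⟨m, hm⟩
      exact ⟨m, by linarith⟩
  rw [key, key]
  push_cast
  rw [cast_repr]
  constructor
  · rintro ⟨u, h1, rfl⟩
    rcases (cl_eq_iff _ _).mp (mk_out (u : Cl ℓ)) with h | h
    · left; rw [← h1, ← h]
    · right
      rw [← h1]
      simpa using congrArg (Units.val) h
  · rintro (h | h)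
    · exact ⟨_, h.symm, mk_out x⟩
    · refine ⟨-Quotient.out x, by rw [h]; simp, ?_⟩
      conv_rhs => rw [← mk_out x]
      rw [cl_eq_iff]
      right; simp

theorem exists_isClass {j : ℤ} (hj : ¬ (ℓ : ℤ) ∣ j) : ∃ x : Cl ℓ, IsClass x j := by
  have : (j : ZMod ℓ) ≠ 0 := by rwa [Ne, ZMod.intCast_zmod_eq_zero_iff_dvd]
  exact ⟨(Units.mk0 _ this : (ZMod ℓ)ˣ), Units.mk0 _ this, rfl, rfl⟩

theorem IsClass.not_dvd {x : Cl ℓ} {j : ℤ} (h : IsClass x j) : ¬ (ℓ : ℤ) ∣ j := by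
  obtain ⟨u, hu, -⟩ := h
  rw [← ZMod.intCast_zmod_eq_zero_iff_dvd, ← hu]
  exact u.ne_zero

theorem IsClass.unique {x y : Cl ℓ} {j : ℤ} (h : IsClass x j) (h' : IsClass y j) : x = y := by
  obtain ⟨u, hu, rfl⟩ := h
  obtain ⟨v, hv, rfl⟩ := h'
  congr 1
  exact Units.ext (hu.trans hv.symm)

theorem IsClass.mul {x y : Cl ℓ} {i j : ℤ} (h : IsClass x i) (h' : IsClass y j) :
    IsClass (x * y) (i * j) := by
  obtain ⟨u, hu, rfl⟩ := h
  obtain ⟨v, hv, rfl⟩ := h'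
  exact ⟨u * v, by push_cast; rw [hu, hv], rfl⟩

/-- The positive integers in the class `x`. -/
def classSet (x : Cl ℓ) : Set ℕ := {m | IsClass x m}

instance (x : Cl ℓ) : DecidablePred (· ∈ classSet x) := Classical.decPred _

/-- The function `g_{(j/ℓ, 0)}(ℓτ)` for `j` in the class `x`. -/
def EC (x : Cl ℓ) (τ : ℍ) : ℂ := siegel (repr x / ℓ) 0 (ℓ * (τ : ℂ))

theorem siegel_one_sub {a : ℚ} (h0 : 0 < a) (h1 : a < 1) (τ : ℂ) :
    siegel (1 - a) 0 τ = siegel a 0 τ := by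
  have hB : B₂ (1 - a) = B₂ a := by
    rw [B₂, B₂, Int.fract_eq_self.mpr ⟨h0.le, h1⟩, Int.fract_eq_self.mpr ⟨by linarith, by linarith⟩]
    ring
  rw [siegel, siegel, hB]
  simp only [siegelFactor, Rat.cast_zero, zero_mul, zero_div, neg_zero, e_zero, mul_one]
  congr 2
  funext n
  rw [mul_comm]
  push_cast
  ring_nf

theorem siegel_eq_EC {j : ℕ} (hj : 0 < j) (hjℓ : j < ℓ) {x : Cl ℓ} (hx : IsClass x j) (τ : ℍ) :
    siegel (j / ℓ) 0 (ℓ * (τ : ℂ)) = EC x τ := by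
  have h1 := repr_lt x
  have h2 := repr_pos x
  have hℓ : (0 : ℚ) < ℓ := by exact_mod_cast (by omega : 0 < ℓ)
  have hℓ' : (0 : ℤ) < ℓ := by omega
  rcases (isClass_iff x j).mp hx with ⟨m, hm⟩ | ⟨m, hm⟩
  · have hm0 : m = 0 := by
      have : m < 1 := by by_contra h; nlinarith
      have : -1 < m := by by_contra h; nlinarith
      omega
    have : j = repr x := by rw [hm0] at hm; omega
    rw [this, EC]
  · have hm1 : m = 1 := by
      have : m < 2 := by by_contra h; nlinarith
      have : 0 < m := by by_contra h; nlinarith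
      omega
    have : (j : ℚ) / ℓ = 1 - repr x / ℓ := by
      rw [hm1] at hm
      have : (j : ℚ) = ℓ - repr x := by
        have : (j : ℤ) = ℓ - repr x := by omega
        exact_mod_cast this
      rw [this]; field_simp
    rw [this, EC, siegel_one_sub]
    · have : (0 : ℚ) < repr x := by exact_mod_cast h2
      positivity
    · rw [div_lt_one hℓ]; exact_mod_cast h1

theorem EC_ne_zero (x : Cl ℓ) (τ : ℍ) : EC x τ ≠ 0 := by
  have hℓ : (0 : ℚ) < ℓ := by exact_mod_cast hp.out.pos
  have h2 : (0 : ℚ) < repr x := by exact_mod_cast repr_pos x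
  refine siegel_ne_zero (by positivity) ?_ ?_
  · rw [div_lt_one hℓ]; exact_mod_cast repr_lt x
  · have h1 : (0 : ℝ) < ℓ := by exact_mod_cast hp.out.pos
    simpa using mul_pos h1 τ.im_pos

theorem exists_thE_eq_EC (τ : ℍ) : ∃ K : ℂ, K ≠ 0 ∧ ∀ x : Cl ℓ, thE ℓ (repr x) τ = K * EC x τ := by
  refine ⟨-(e (ℓ * τ / 24) * ∏' n : ℕ, (1 - e (ℓ * (τ : ℂ)) ^ (n + 1))), ?_, fun x => ?_⟩
  · refine neg_ne_zero.mpr (mul_ne_zero (e_ne_zero _) (euler_product_ne_zero (norm_e_lt_one ?_)))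
    have h1 : (0 : ℝ) < ℓ := by exact_mod_cast hp.out.pos
    simpa using mul_pos h1 τ.im_pos
  · exact thE_eq_siegel (repr_pos x) (repr_lt x) τ

theorem exists_thE_eq {x : Cl ℓ} {j : ℤ} (h : IsClass x j) :
    ∃ ε : ℂ, ε ≠ 0 ∧ ∀ τ : ℂ, thE ℓ j τ = ε * thE ℓ (repr x) τ := by
  rcases (isClass_iff x j).mp h with ⟨m, rfl⟩ | ⟨m, rfl⟩
  · exact ⟨(-1) ^ m, zpow_ne_zero _ (by norm_num), fun τ => thE_add_mul hp.out.ne_zero _ _ _⟩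
  · refine ⟨-(-1) ^ m, neg_ne_zero.mpr (zpow_ne_zero _ (by norm_num)), fun τ => ?_⟩
    rw [thE_add_mul hp.out.ne_zero, thE_neg]
    ring

theorem tprod_arith {b : ℕ} (hb : 0 < b) (z : ℂ) [DecidablePred (· ∈ {m | ∃ n, m = ℓ * n + b})] :
    ∏' n : ℕ, (1 - z ^ (ℓ * n + b)) =
      eulerProd (fun m => if m + 1 ∈ {m | ∃ n, m = ℓ * n + b} then 1 else 0) z := by
  have hinj : Function.Injective fun n => ℓ * n + (b - 1) := by
    intro m n h
    simpa [hp.out.ne_zero] using h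
  rw [eulerProd]
  refine Eq.trans ?_ (hinj.tprod_eq (f := fun m => 1 -
    (if m + 1 ∈ {m | ∃ n, m = ℓ * n + b} then (1 : ℂ) else 0) * z ^ (m + 1)) ?_)
  · congr 1
    funext n
    rw [if_pos ⟨n, by omega⟩, one_mul, show ℓ * n + (b - 1) + 1 = ℓ * n + b by omega]
  · intro m hm
    rw [Function.mem_mulSupport] at hm
    by_contra h
    apply hm
    rw [if_neg, zero_mul, sub_zero]
    rintro ⟨n, hn⟩
    exact h ⟨n, by simp only; omega⟩

/-- The characteristic function of the class `x`, shifted by one. -/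
def classChar (x : Cl ℓ) (m : ℕ) : ℂ := if m + 1 ∈ classSet x then 1 else 0

theorem norm_classChar_le (x : Cl ℓ) (m : ℕ) : ‖classChar x m‖ ≤ 1 := by
  rw [classChar]; split_ifs <;> simp

/-- The two halves of the Siegel product run over the exponents congruent to j and to −j modulo ℓ.
For odd ℓ these progressions are disjoint, and together they are the positive integers in the class.
-/
theorem EC_eq (hodd : ℓ ≠ 2) (x : Cl ℓ) (τ : ℍ) :
    EC x τ = -e ((B₂ (repr x / ℓ) : ℂ) / 2 * (ℓ * τ)) * eulerProd (classChar x) (e τ) := by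
  classical
  have hj := repr_pos x
  have hjℓ := repr_lt x
  have hℓ : (ℓ : ℂ) ≠ 0 := by exact_mod_cast hp.out.ne_zero
  set j := repr x with hjdef
  have hz := norm_e_lt_one τ.im_pos
  set z := e (τ : ℂ) with hzdef
  have h1 (n : ℕ) : siegelFactor (j / ℓ) 0 (ℓ * τ) n =
      (1 - z ^ (ℓ * n + j)) * (1 - z ^ (ℓ * n + (ℓ - j))) := by
    rw [siegelFactor]
    simp only [Rat.cast_zero, neg_zero, e_zero, mul_one]
    rw [hzdef, ← e_nat_mul, ← e_nat_mul]
    push_cast [Nat.cast_sub hjℓ.le]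
    congr 3 <;> field_simp
    ring
  have hm (b : ℕ) (hb : 0 < b) : Multipliable fun n : ℕ => (1 - z ^ (ℓ * n + b)) := by
    have hs : Summable fun n : ℕ => ‖-(z ^ (ℓ * n + b))‖ := by
      refine Summable.of_nonneg_of_le (fun _ => norm_nonneg _) (fun n => ?_)
        (summable_geometric_of_lt_one (norm_nonneg z) hz)
      rw [norm_neg, norm_pow]
      refine pow_le_pow_of_le_one (norm_nonneg _) hz.le ?_
      nlinarith [hp.out.one_lt]
    simpa [sub_eq_add_neg] using multipliable_one_add_of_summable hs
  rw [EC, siegel]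
  rw [← hjdef, tprod_congr h1, (hm j hj).tprod_mul (hm (ℓ - j) (by omega)), tprod_arith hj,
    tprod_arith (by omega : 0 < ℓ - j),
    eulerProd, eulerProd, eulerProd, ← (multipliable_eulerProd (fun m => by split_ifs <;> simp)
      hz).tprod_mul (multipliable_eulerProd (fun m => by split_ifs <;> simp) hz)]
  · simp only [Rat.cast_zero, zero_mul, zero_div, e_zero, mul_one]
    congr 2
    funext m
    have hiff : m + 1 ∈ classSet x ↔ (∃ n, m + 1 = ℓ * n + j) ∨ (∃ n, m + 1 = ℓ * n + (ℓ - j)) := by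
      rw [classSet, Set.mem_ofPred_eq, isClass_iff]
      have hℓ' : (0 : ℤ) < ℓ := by omega
      constructor
      · rintro (⟨n, hn⟩ | ⟨n, hn⟩)
        · have : 0 ≤ n := by by_contra h; push Not at h; push_cast at hn; nlinarith
          lift n to ℕ using this
          left; refine ⟨n, ?_⟩; zify; push_cast at hn; linarith
        · have : 1 ≤ n := by by_contra h; push Not at h; push_cast at hn; nlinarith
          right; refine ⟨(n - 1).toNat, ?_⟩
          zify [hjℓ.le]
          rw [Int.toNat_of_nonneg (by omega)]; push_cast at hn; linarith
      · rintro (⟨n, hn⟩ | ⟨n, hn⟩)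
        · left; refine ⟨n, ?_⟩; rw [hn]; push_cast; ring
        · right; refine ⟨n + 1, ?_⟩; rw [hn]; push_cast [Nat.cast_sub hjℓ.le]; ring
    have hdisj : ¬ ((∃ n, m + 1 = ℓ * n + j) ∧ (∃ n, m + 1 = ℓ * n + (ℓ - j))) := by
      rintro ⟨⟨n, hn⟩, ⟨n', hn'⟩⟩
      have h2 : (ℓ : ℤ) ∣ 2 * j := by
        refine ⟨n' + 1 - n, ?_⟩
        have : (ℓ : ℤ) * n + j = ℓ * n' + (ℓ - j) := by
          rw [hn] at hn'
          have := congrArg (Nat.cast : ℕ → ℤ) hn'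
          push_cast [Nat.cast_sub hjℓ.le] at this
          exact this
        linarith
      have h3 : ℓ ∣ 2 * j := by exact_mod_cast h2
      rcases hp.out.dvd_mul.mp h3 with h | h
      · exact hodd ((Nat.prime_dvd_prime_iff_eq hp.out Nat.prime_two).mp h)
      · exact absurd (Nat.le_of_dvd hj h) (by omega)
    rw [classChar]
    simp only [Set.mem_ofPred_eq, hiff]
    by_cases ha : ∃ n, m + 1 = ℓ * n + j
    · have hb : ¬ ∃ n, m + 1 = ℓ * n + (ℓ - j) := fun hb => hdisj ⟨ha, hb⟩
      rw [if_pos ha, if_neg hb, if_pos (Or.inl ha)]; ring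
    · by_cases hb : ∃ n, m + 1 = ℓ * n + (ℓ - j)
      · rw [if_neg ha, if_pos hb, if_pos (Or.inr hb)]; ring
      · rw [if_neg ha, if_neg hb, if_neg (not_or.mpr ⟨ha, hb⟩)]; ring

end

/-! ### Products of degree zero and their behaviour under SL₂(ℤ) -/

section

variable {ℓ : ℕ} [hp : Fact ℓ.Prime]

/-- `EC x` as a unit in the ring of functions on `ℍ`. -/
def EU (x : Cl ℓ) : (ℍ → ℂ)ˣ where
  val := EC x
  inv := fun τ => (EC x τ)⁻¹
  val_inv := by
    ext τ
    exact mul_inv_cancel₀ (EC_ne_zero x τ)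
  inv_val := by
    ext τ
    exact inv_mul_cancel₀ (EC_ne_zero x τ)

/-- Evaluation at `τ`, as a homomorphism on units. -/
def evalUnit (τ : ℍ) : (ℍ → ℂ)ˣ →* ℂˣ := Units.map (Pi.evalMonoidHom (fun _ : ℍ => ℂ) τ)

theorem coe_evalUnit (τ : ℍ) (f : (ℍ → ℂ)ˣ) : ((evalUnit τ f : ℂˣ) : ℂ) = (f : ℍ → ℂ) τ := rfl

theorem unit_ext {f g : (ℍ → ℂ)ˣ} (h : ∀ τ, (f : ℍ → ℂ) τ = (g : ℍ → ℂ) τ) : f = g :=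
  Units.ext (funext h)

theorem unit_ne_zero (f : (ℍ → ℂ)ˣ) (τ : ℍ) : (f : ℍ → ℂ) τ ≠ 0 := (evalUnit τ f).ne_zero

theorem unit_zpow_apply (f : (ℍ → ℂ)ˣ) (n : ℤ) (τ : ℍ) :
    ((f ^ n : (ℍ → ℂ)ˣ) : ℍ → ℂ) τ = (f : ℍ → ℂ) τ ^ n := by
  rw [← coe_evalUnit, map_zpow, Units.val_zpow_eq_zpow_val, coe_evalUnit]

theorem unit_inv_apply (f : (ℍ → ℂ)ˣ) (τ : ℍ) :
    ((f⁻¹ : (ℍ → ℂ)ˣ) : ℍ → ℂ) τ = ((f : ℍ → ℂ) τ)⁻¹ := by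
  rw [← coe_evalUnit, map_inv, Units.val_inv_eq_inv_val, coe_evalUnit]

theorem unit_prod_apply {ι : Type*} (S : Finset ι) (f : ι → (ℍ → ℂ)ˣ) (τ : ℍ) :
    ((∏ i ∈ S, f i : (ℍ → ℂ)ˣ) : ℍ → ℂ) τ = ∏ i ∈ S, (f i : ℍ → ℂ) τ := by
  rw [← coe_evalUnit, map_prod, Units.coe_prod]
  rfl

/-- The product `∏ₓ EU x ^ v x`. -/
def EP (v : Cl ℓ → ℤ) : (ℍ → ℂ)ˣ := ∏ x, EU x ^ v x

theorem EP_apply (v : Cl ℓ → ℤ) (τ : ℍ) : (EP v : ℍ → ℂ) τ = ∏ x, EC x τ ^ v x := by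
  rw [EP, unit_prod_apply]
  exact Finset.prod_congr rfl fun x _ => unit_zpow_apply _ _ _

theorem EP_add (v w : Cl ℓ → ℤ) : EP (v + w) = EP v * EP w := by
  simp only [EP, Pi.add_apply, zpow_add, Finset.prod_mul_distrib]

theorem EP_zero : EP (0 : Cl ℓ → ℤ) = 1 := by simp [EP]

theorem EP_zsmul (n : ℤ) (v : Cl ℓ → ℤ) : EP (n • v) = EP v ^ n := by
  simp only [EP, Pi.smul_apply, smul_eq_mul, mul_comm n, zpow_mul, Finset.prod_zpow]

theorem EP_single (x : Cl ℓ) : EP (Pi.single x 1) = EU x := by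
  rw [EP, Finset.prod_eq_single x]
  · simp
  · intro y _ hy
    simp [hy]
  · simp

/-- This is how all factors common to the classes (automorphy factors, eta-type products, q^{ℓ/12})
are discarded in degree 0. -/
theorem prod_const_mul_zpow {ι : Type*} [Fintype ι] {v : ι → ℤ} (hv : ∑ x, v x = 0) {κ : ℂ}
    (hκ : κ ≠ 0) (f : ι → ℂ) : ∏ x, (κ * f x) ^ v x = ∏ x, f x ^ v x := by
  have h (S : Finset ι) : ∏ x ∈ S, κ ^ v x = κ ^ ∑ x ∈ S, v x := by
    classical
    induction S using Finset.induction_on with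
    | empty => simp
    | insert a S ha ih => rw [Finset.prod_insert ha, Finset.sum_insert ha, ih, zpow_add₀ hκ]
  simp only [mul_zpow, Finset.prod_mul_distrib]
  rw [h, hv, zpow_zero, one_mul]

theorem EP_eq_thE {v : Cl ℓ → ℤ} (hv : ∑ x, v x = 0) (τ : ℍ) :
    (EP v : ℍ → ℂ) τ = ∏ x : Cl ℓ, thE ℓ (repr x) τ ^ v x := by
  obtain ⟨K, hK, h⟩ := exists_thE_eq_EC (ℓ := ℓ) τ
  simp only [h]
  rw [prod_const_mul_zpow hv hK, EP_apply]

theorem EP_mul_shift (v : Cl ℓ → ℤ) (A : Cl ℓ) (τ : ℍ) :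
    ∏ x, EC (x * A) τ ^ v x = (EP fun y => v (y * A⁻¹) : ℍ → ℂ) τ := by
  rw [EP_apply]
  refine Fintype.prod_equiv (Equiv.mulRight A) _ _ fun x => ?_
  simp

theorem EP_Gamma0 {v : Cl ℓ → ℤ} (hv : ∑ x, v x = 0) {γ : SL(2, ℤ)} {c : ℤ} (hc : γ 1 0 = ℓ * c)
    {A : Cl ℓ} (hA : IsClass A (γ 0 0)) :
    ∃ C : ℂ, C ≠ 0 ∧ ∀ τ : ℍ,
      (EP v : ℍ → ℂ) (γ • τ) = C * (EP fun y => v (y * A⁻¹) : ℍ → ℂ) τ := by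
  have hx (x : Cl ℓ) := exists_thE_eq ((isClass_repr x).mul hA)
  choose ε hε h using hx
  let ρ (j : ℤ) : ℂ := e ((j ^ 2 * (γ 0 0 * γ 0 1) : ℤ) / (2 * ℓ)) * (-1) ^ (j * γ 0 1)
  have hρ (j : ℤ) : ρ j ≠ 0 := mul_ne_zero (e_ne_zero _) (zpow_ne_zero _ (by norm_num))
  refine ⟨∏ x : Cl ℓ, (ρ (repr x) * ε x) ^ v x, Finset.prod_ne_zero_iff.mpr fun x _ =>
    zpow_ne_zero _ (mul_ne_zero (hρ _) (hε x)), fun τ => ?_⟩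
  obtain ⟨κ, hκ, hγ⟩ := thE_Gamma0 hp.out.ne_zero hc τ
  obtain ⟨K, hK, hE⟩ := exists_thE_eq_EC (ℓ := ℓ) τ
  rw [EP_eq_thE hv, ← EP_mul_shift, ← Finset.prod_mul_distrib]
  simp only [← mul_zpow]
  rw [← prod_const_mul_zpow hv (mul_ne_zero hκ hK) fun x => ρ (repr x) * ε x * EC (x * A) τ]
  refine Finset.prod_congr rfl fun x _ => ?_
  rw [hγ, h, hE]
  congr 1
  simp only [ρ]
  ring

/-- Modulo 2 the odd number l becomes 1, and the claim is a finite check over ℤ/2. It controls the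
signs in `EP_Gamma`. -/
theorem even_of_det {l m b c d : ℤ} (hl : Odd l) (h : (1 + l * m) * d - l * b * (l * c) = 1)
    (r : ℤ) : Even (r ^ 2 * ((1 + l * m) * b) + r * (l * b) + r * m) := by
  have key : ∀ m b c d r : ZMod 2, (1 + 1 * m) * d - 1 * b * (1 * c) = 1 →
      r ^ 2 * ((1 + 1 * m) * b) + r * (1 * b) + r * m = 0 := by decide
  have hl' : (l : ZMod 2) = 1 := ZMod.intCast_eq_one_iff_odd.mpr hl
  have h' := congrArg (Int.cast : ℤ → ZMod 2) h
  push_cast [hl'] at h'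
  rw [← ZMod.intCast_eq_zero_iff_even]
  push_cast [hl']
  exact key _ _ _ _ _ h'

/-- For γ in Γ(ℓ) the upper right entry is divisible by ℓ, so the quadratic root of unity in
`thE_Gamma0` is only a sign. The three signs cancel for each class separately, so no quadratic
condition on v is required. -/
theorem EP_Gamma (hodd : ℓ ≠ 2) {v : Cl ℓ → ℤ} (hv : ∑ x, v x = 0) {γ : SL(2, ℤ)}
    (hγ : γ ∈ Gamma ℓ) (τ : ℍ) : (EP v : ℍ → ℂ) (γ • τ) = (EP v : ℍ → ℂ) τ := by
  obtain ⟨h00, h01, h10, h11⟩ := Gamma_mem.mp hγ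
  have hℓ0 : (ℓ : ℂ) ≠ 0 := by exact_mod_cast hp.out.ne_zero
  rw [← Int.cast_one (R := ZMod ℓ), eq_comm, ZMod.intCast_eq_intCast_iff_dvd_sub] at h00
  rw [ZMod.intCast_zmod_eq_zero_iff_dvd] at h01 h10
  obtain ⟨m, hm⟩ := h00
  obtain ⟨b, hb⟩ := h01
  obtain ⟨c, hc⟩ := h10
  obtain ⟨κ, hκ, hγ⟩ := thE_Gamma0 hp.out.ne_zero hc τ
  have hdet := det_eq_one γ
  have hℓodd : Odd (ℓ : ℤ) := by
    have := hp.out.odd_of_ne_two hodd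
    exact_mod_cast this
  rw [EP_eq_thE hv, EP_eq_thE hv,
    ← prod_const_mul_zpow hv hκ fun x : Cl ℓ => thE ℓ (repr x) τ]
  refine Finset.prod_congr rfl fun x _ => ?_
  congr 1
  rw [hγ, show (repr x : ℤ) * γ 0 0 = repr x + (repr x * m) * ℓ by linear_combination repr x * hm,
    thE_add_mul hp.out.ne_zero, hb]
  have h1 : (((repr x : ℤ) ^ 2 * (γ 0 0 * (ℓ * b)) : ℤ) : ℂ) / (2 * ℓ) =
      (((repr x : ℤ) ^ 2 * (γ 0 0 * b) : ℤ) : ℂ) / 2 := by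
    push_cast
    field_simp
  rw [h1, e_int_div_two, ← zpow_add₀ (by norm_num : (-1 : ℂ) ≠ 0)]
  have h2 : Even ((repr x : ℤ) ^ 2 * (γ 0 0 * b) + repr x * (ℓ * b) + repr x * m) := by
    have h3 : γ 0 0 = 1 + ℓ * m := by linarith
    rw [h3, hb, hc] at hdet
    rw [h3]
    exact even_of_det hℓodd hdet _
  have h3 : (-1 : ℂ) ^ ((repr x : ℤ) ^ 2 * (γ 0 0 * b) + repr x * (ℓ * b) + repr x * m) = 1 :=
    h2.neg_one_zpow
  rw [zpow_add₀ (by norm_num : (-1 : ℂ) ≠ 0)] at h3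
  linear_combination κ * thE ℓ (repr x) τ * h3

theorem eulerProd_tendsto {c : ℕ → ℂ} (hc : ∀ m, ‖c m‖ ≤ 1) :
    Tendsto (eulerProd c) (𝓝 0) (𝓝 1) := by
  have h := (differentiableOn_eulerProd hc).continuousOn.continuousAt
    (Metric.ball_mem_nhds (0 : ℂ) one_pos)
  rwa [ContinuousAt, eulerProd_zero] at h

theorem tendsto_e_div (N : ℕ) (hN : 0 < N) :
    Tendsto (fun τ : ℍ => e ((τ : ℂ) / N)) atImInfty (𝓝 0) := by
  have := qParam_tendsto_atImInfty (h := N) (by exact_mod_cast hN)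
  refine this.congr fun τ => ?_
  rw [Function.Periodic.qParam, e]
  congr 1
  push_cast
  ring

theorem th_eq_eulerProd {u τ : ℂ} (hu : ‖e u‖ ≤ 1) (hu' : ‖(e u)⁻¹‖ ≤ 1) (hτ' : 0 < τ.im) :
    th u τ = e (τ / 8) * (∏' n : ℕ, (1 - e τ ^ (n + 1))) * (e (-(u / 2)) * (1 - e u) *
      eulerProd (fun _ => e u) (e τ) * eulerProd (fun _ => (e u)⁻¹) (e τ)) := by
  have hτ := norm_e_lt_one hτ'
  have h1 := multipliable_eulerProd (c := fun _ => e u) (fun _ => hu) hτ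
  have h2 := multipliable_eulerProd (c := fun _ => (e u)⁻¹) (fun _ => hu') hτ
  have h3 : ∏' n : ℕ, (1 - e τ ^ n * e u) = (1 - e u) * eulerProd (fun _ => e u) (e τ) := by
    rw [tprod_eq_zero_mul' ]
    · simp [eulerProd, mul_comm]
    · simpa [mul_comm] using h1
  rw [th_eq_prod _ hτ', sub_eq_add_neg, e_add,
    Multipliable.tprod_mul (multipliable_one_sub_pow_mul hτ _),
    h3]
  · have : ∏' n : ℕ, (1 - e τ ^ (n + 1) * (e u)⁻¹) = eulerProd (fun _ => (e u)⁻¹) (e τ) := by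
      simp [eulerProd, mul_comm]
    rw [this]; ring
  · simpa [mul_comm] using h2

theorem e_eq_one_iff (x : ℂ) : e x = 1 ↔ ∃ n : ℤ, x = n := by
  rw [e, Complex.exp_eq_one_iff]
  have : (2 * Real.pi * Complex.I : ℂ) ≠ 0 := Complex.two_pi_I_ne_zero
  refine exists_congr fun n => ⟨fun h => mul_left_cancel₀ this (by rw [h]; ring),
    fun h => by rw [h]; ring⟩

theorem norm_e_real (x : ℝ) : ‖e x‖ = 1 := by
  rw [e, Complex.norm_exp]
  simp

/-- By `thE_not_Gamma0` the theta arguments are the rationals u = jb/ℓ, so each factor tends, after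
removal of the common part, to a nonzero multiple of 1 − e(u). This is nonzero because ℓ divides
neither j nor b. -/
theorem EP_not_Gamma0 {v : Cl ℓ → ℤ} (hv : ∑ x, v x = 0) {γ : SL(2, ℤ)} (hc : ¬ (ℓ : ℤ) ∣ γ 1 0) :
    ∃ L : ℂ, L ≠ 0 ∧ Tendsto (fun τ : ℍ => (EP v : ℍ → ℂ) (γ • τ)) atImInfty (𝓝 L) := by
  obtain ⟨x₀, b, hb, h⟩ := thE_not_Gamma0 hp.out hc
  have hℓ0 : (ℓ : ℂ) ≠ 0 := by exact_mod_cast hp.out.ne_zero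
  have hℓpos : (0 : ℝ) < ℓ := by exact_mod_cast hp.out.pos
  let u (x : Cl ℓ) : ℂ := (repr x : ℤ) * b / ℓ
  have hu (x : Cl ℓ) : ‖e (u x)‖ = 1 := by
    have : u x = (((repr x : ℤ) * b / ℓ : ℝ) : ℂ) := by simp [u]
    rw [this, norm_e_real]
  have hu' (x : Cl ℓ) : ‖(e (u x))⁻¹‖ = 1 := by rw [norm_inv, hu, inv_one]
  have hu1 (x : Cl ℓ) : e (u x) ≠ 1 := by
    rw [Ne, e_eq_one_iff]
    rintro ⟨n, hn⟩
    rw [div_eq_iff hℓ0] at hn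
    have hn' : (repr x : ℤ) * b = n * ℓ := by exact_mod_cast hn
    have : (ℓ : ℤ) ∣ repr x * b := ⟨n, by rw [hn']; ring⟩
    rcases (Nat.prime_iff_prime_int.mp hp.out).dvd_or_dvd this with h | h
    · exact (isClass_repr x).not_dvd h
    · exact hb h
  let ρ (x : Cl ℓ) : ℂ := e (-(((repr x : ℤ) ^ 2 * (γ 0 0 * b) : ℤ) : ℂ) / (2 * ℓ)) *
    (-1) ^ ((repr x : ℤ) * γ 0 0)
  have hρ (x : Cl ℓ) : ρ x ≠ 0 := mul_ne_zero (e_ne_zero _) (zpow_ne_zero _ (by norm_num))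
  let q (τ : ℍ) : ℂ := e (((τ : ℂ) + x₀) / ℓ)
  have hq : Tendsto q atImInfty (𝓝 0) := by
    have := (tendsto_e_div ℓ hp.out.pos).mul_const (e (x₀ / ℓ))
    rw [zero_mul] at this
    refine this.congr fun τ => ?_
    rw [← e_add, ← add_div]
  have him (τ : ℍ) : 0 < (((τ : ℂ) + x₀) / ℓ).im := by
    have : (((τ : ℂ) + x₀) / ℓ).im = τ.im / ℓ := by
      rw [Complex.div_natCast_im]; simp
    rw [this]
    exact div_pos τ.im_pos hℓpos
  have hq1 (τ : ℍ) : ‖q τ‖ < 1 := norm_e_lt_one (him τ)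
  let G (x : Cl ℓ) (z : ℂ) : ℂ := ρ x * (e (-(u x / 2)) * (1 - e (u x)) *
      eulerProd (fun _ => e (u x)) z * eulerProd (fun _ => (e (u x))⁻¹) z)
  have hG (x : Cl ℓ) : Tendsto (fun τ => G x (q τ)) atImInfty
      (𝓝 (ρ x * (e (-(u x / 2)) * (1 - e (u x)) * 1 * 1))) := by
    have h1 := (eulerProd_tendsto (c := fun _ => e (u x)) fun _ => (hu x).le).comp hq
    have h2 := (eulerProd_tendsto (c := fun _ => (e (u x))⁻¹) fun _ => (hu' x).le).comp hq
    exact ((h1.const_mul _).mul h2).const_mul _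
  have hL (x : Cl ℓ) : ρ x * (e (-(u x / 2)) * (1 - e (u x)) * 1 * 1) ≠ 0 := by
    rw [mul_one, mul_one]
    exact mul_ne_zero (hρ x) (mul_ne_zero (e_ne_zero _) (sub_ne_zero.mpr (hu1 x).symm))
  refine ⟨_, ?_, (tendsto_finsetProd Finset.univ fun x _ =>
    (hG x).zpow₀ (v x) (Or.inl (hL x))).congr fun τ => ?_⟩
  · exact Finset.prod_ne_zero_iff.mpr fun x _ => zpow_ne_zero _ (hL x)
  · obtain ⟨κ, hκ, hγ⟩ := h τ
    set τ' : ℂ := ((τ : ℂ) + x₀) / ℓ with hτ'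
    have hE : κ * (e (τ' / 8) * ∏' n : ℕ, (1 - e τ' ^ (n + 1))) ≠ 0 :=
      mul_ne_zero hκ (mul_ne_zero (e_ne_zero _) (euler_product_ne_zero (hq1 τ)))
    rw [EP_eq_thE hv, ← prod_const_mul_zpow hv hE]
    refine Finset.prod_congr rfl fun x _ => ?_
    congr 1
    rw [hγ, th_eq_eulerProd (hu x).le (hu' x).le (him τ)]
    simp only [G, ρ, u, q, ← hτ']
    ring

/-- The integer `j (j - ℓ) / 2` for the representative `j` of `x`. -/
def wt (x : Cl ℓ) : ℤ := (repr x : ℤ) * (repr x - ℓ) / 2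

theorem two_mul_wt (hodd : ℓ ≠ 2) (x : Cl ℓ) : 2 * wt x = (repr x : ℤ) * (repr x - ℓ) := by
  have hℓodd : Odd (ℓ : ℤ) := by
    have := hp.out.odd_of_ne_two hodd
    exact_mod_cast this
  refine Int.mul_ediv_cancel' ?_
  rw [← even_iff_two_dvd]
  simp only [Int.even_mul, Int.even_sub, Int.not_even_iff_odd.mpr hℓodd]
  tauto

/-- The order at `∞` of `EP v`, for `v` of total degree zero. -/
def ordInfty (v : Cl ℓ → ℤ) : ℤ := ∑ x, v x * wt x

/-- The leading exponent (ℓ/2)B₂(j/ℓ) equals ℓ/12 + j(j − ℓ)/(2ℓ); the term ℓ/12 is common to all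
classes and drops out, leaving `wt` divided by ℓ. -/
theorem EP_eq (hodd : ℓ ≠ 2) {v : Cl ℓ → ℤ} (hv : ∑ x, v x = 0) (τ : ℍ) :
    (EP v : ℍ → ℂ) τ = e ((ordInfty v : ℂ) / ℓ * τ) * ∏ x, eulerProd (classChar x) (e τ) ^ v x := by
  have hℓ0 : (ℓ : ℂ) ≠ 0 := by exact_mod_cast hp.out.ne_zero
  have h1 (x : Cl ℓ) : EC x τ = -e (ℓ / 12 * τ) *
      (e (wt x * (τ / ℓ)) * eulerProd (classChar x) (e τ)) := by
    rw [EC_eq hodd, neg_mul, neg_mul, ← mul_assoc (e (ℓ / 12 * τ)), ← e_add]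
    congr 3
    have hℓ : (0 : ℚ) < ℓ := by exact_mod_cast hp.out.pos
    have h2 : (0 : ℚ) < repr x := by exact_mod_cast repr_pos x
    rw [B₂, Int.fract_eq_self.mpr ⟨by positivity, by
      rw [div_lt_one hℓ]; exact_mod_cast repr_lt x⟩]
    have h3 : (wt x : ℂ) = (repr x : ℂ) * (repr x - ℓ) / 2 := by
      rw [eq_div_iff two_ne_zero, mul_comm]
      exact_mod_cast two_mul_wt hodd x
    rw [h3]
    push_cast
    field_simp
    ring
  rw [EP_apply]
  simp only [h1]
  rw [prod_const_mul_zpow hv (neg_ne_zero.mpr (e_ne_zero _))]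
  simp only [mul_zpow, Finset.prod_mul_distrib]
  congr 1
  have h4 (S : Finset (Cl ℓ)) : ∏ x ∈ S, e (wt x * (τ / ℓ)) ^ v x =
      e (((∑ x ∈ S, v x * wt x : ℤ) : ℂ) * (τ / ℓ)) := by
    induction S using Finset.induction_on with
    | empty => simp [e_zero]
    | insert a S ha ih =>
      rw [Finset.prod_insert ha, Finset.sum_insert ha, ih, ← e_int_mul, ← e_add]
      congr 1
      push_cast
      ring
  rw [h4, ordInfty]
  congr 1
  ring

theorem EP_tendsto (hodd : ℓ ≠ 2) {v : Cl ℓ → ℤ} (hv : ∑ x, v x = 0) :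
    Tendsto (fun τ : ℍ => (EP v : ℍ → ℂ) τ * e (-((ordInfty v : ℂ) / ℓ) * τ)) atImInfty (𝓝 1) := by
  have h0 : Tendsto (fun τ : ℍ => e (τ : ℂ)) atImInfty (𝓝 0) := by
    simpa using tendsto_e_div 1 one_pos
  have h1 := tendsto_finsetProd Finset.univ fun (x : Cl ℓ) _ =>
    ((eulerProd_tendsto (norm_classChar_le x)).comp h0).zpow₀ (v x) (Or.inl one_ne_zero)
  simp only [one_zpow, Finset.prod_const_one] at h1
  refine h1.congr fun τ => ?_
  rw [EP_eq hodd hv, mul_right_comm, ← e_add]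
  simp [e_zero]

theorem eulerProd_differentiable {c : ℕ → ℂ} (hc : ∀ m, ‖c m‖ ≤ 1) :
    DifferentiableOn ℂ (fun z : ℂ => eulerProd c (e z)) {z | 0 < z.im} := by
  refine (differentiableOn_eulerProd hc).comp (t := Metric.ball 0 1) ?_ fun z hz => ?_
  · unfold e
    fun_prop
  · simpa using norm_e_lt_one hz

theorem EP_mdifferentiable (hodd : ℓ ≠ 2) {v : Cl ℓ → ℤ} (hv : ∑ x, v x = 0) :
    MDifferentiable 𝓘(ℂ) 𝓘(ℂ) (EP v : ℍ → ℂ) := by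
  rw [UpperHalfPlane.mdifferentiable_iff]
  have : DifferentiableOn ℂ (fun z : ℂ => e ((ordInfty v : ℂ) / ℓ * z) *
      ∏ x, eulerProd (classChar x) (e z) ^ v x) {z | 0 < z.im} := by
    refine DifferentiableOn.mul (by unfold e; fun_prop)
      (DifferentiableOn.fun_finsetProd fun x _ => ?_)
    refine (eulerProd_differentiable (norm_classChar_le x)).zpow (Or.inl fun z hz => ?_)
    exact eulerProd_ne_zero (norm_classChar_le x) (norm_e_lt_one hz)
  refine this.congr fun z hz => ?_
  rw [Function.comp_apply, EP_eq hodd hv, ofComplex_apply_of_im_pos hz]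

end

/-! ### Orders and Fourier expansions at cusps -/

section

theorem qParam_eq_e {h : ℕ} (τ : ℂ) : Function.Periodic.qParam h τ = e (τ / h) := by
  rw [Function.Periodic.qParam, e]
  congr 1
  push_cast
  ring

theorem exists_e_eq {h : ℕ} (hh : 0 < h) {z : ℂ} (h0 : z ≠ 0) (h1 : ‖z‖ < 1) :
    ∃ τ : ℍ, e (τ / h) = z := by
  have hh' : (0 : ℝ) < h := by exact_mod_cast hh
  refine ⟨⟨_, Function.Periodic.im_invQParam_pos_of_norm_lt_one hh' h1 h0⟩, ?_⟩
  rw [← qParam_eq_e]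
  exact Function.Periodic.qParam_right_inv hh'.ne' h0

theorem norm_e_div_lt_one {h : ℕ} (hh : 0 < h) (τ : ℍ) : ‖e ((τ : ℂ) / h)‖ < 1 := by
  refine norm_e_lt_one ?_
  have hh' : (0 : ℝ) < h := by exact_mod_cast hh
  rw [Complex.div_natCast_im]
  exact div_pos τ.im_pos hh'

/-- The map τ ↦ e(τ/h) sends ℍ onto the punctured unit disc, so convergence on ℍ is convergence on
the disc. -/
theorem rep_of_hasSum {h : ℕ} (hh : 0 < h) {p : PowerSeries ℂ} {f : ℍ → ℂ}
    (hf : ∀ τ : ℍ, HasSum (fun n => p.coeff n * e ((τ : ℂ) / h) ^ n) (f τ)) :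
    ∃ F, Rep p F ∧ ∀ τ : ℍ, F (e ((τ : ℂ) / h)) = f τ := by
  refine ⟨fun z => ∑' n, p.coeff n * z ^ n, fun z hz => ?_, fun τ => (hf τ).tsum_eq⟩
  by_cases h0 : z = 0
  · subst h0
    refine (hasSum_single (f := fun n => p.coeff n * (0 : ℂ) ^ n) 0
      fun n hn => by simp [hn]).summable.hasSum
  · obtain ⟨τ, rfl⟩ := exists_e_eq hh h0 hz
    exact (hf τ).summable.hasSum

theorem exists_rep {h : ℕ} (hh : 0 < h) {f : ℍ → ℂ} (hf : MDifferentiable 𝓘(ℂ) 𝓘(ℂ) f)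
    (hper : ∀ τ : ℍ, f ((h : ℝ) +ᵥ τ) = f τ) (hb : IsBoundedAtImInfty f) :
    ∃ p F, Rep p F ∧ ∀ τ : ℍ, F (e ((τ : ℂ) / h)) = f τ := by
  have hh' : (0 : ℝ) < h := by exact_mod_cast hh
  have hper' : Function.Periodic (f ∘ ofComplex) ((h : ℝ) : ℂ) := by
    intro w
    by_cases hw : 0 < w.im
    · have : 0 < (w + (h : ℝ)).im := by simpa using hw
      simp only [Function.comp_apply, ofComplex_apply_of_im_pos this, ofComplex_apply_of_im_pos hw]
      rw [← hper ⟨w, hw⟩]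
      congr 1
      ext
      simp [add_comm]
    · have : (w + (h : ℝ)).im ≤ 0 := by simpa using hw
      rw [Function.comp_apply, Function.comp_apply, ofComplex_apply_of_im_nonpos this,
        ofComplex_apply_of_im_nonpos (not_lt.mp hw)]
  obtain ⟨F, hF⟩ := rep_of_hasSum hh (p := qExpansion (h : ℝ) f) (f := f) fun τ => by
    have := hasSum_qExpansion hh' hper' hf hb τ
    simpa only [qParam_eq_e, smul_eq_mul] using this
  exact ⟨_, F, hF⟩

theorem Rep.tendsto {p : PowerSeries ℂ} {F : ℂ → ℂ} (h : Rep p F) {N : ℕ} (hN : 0 < N) :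
    Tendsto (fun τ : ℍ => F (e ((τ : ℂ) / N))) atImInfty (𝓝 (p.coeff 0)) := by
  have h1 := h.differentiableOn.continuousOn.continuousAt (Metric.ball_mem_nhds (0 : ℂ) one_pos)
  rw [ContinuousAt, h.coeff_zero] at h1
  exact h1.comp (tendsto_e_div N hN)

/-- `f(τ) ∼ L q ^ (n / ℓ)` as `τ → i∞`, with `L ≠ 0`. -/
def OrdAt (ℓ : ℕ) (f : ℍ → ℂ) (n : ℤ) (L : ℂ) : Prop :=
  L ≠ 0 ∧ Tendsto (fun τ : ℍ => f τ * e (-((n : ℂ) / ℓ) * τ)) atImInfty (𝓝 L)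

variable {ℓ : ℕ}

theorem OrdAt.unique (hℓ : 0 < ℓ) {f : ℍ → ℂ} {n n' : ℤ} {L L' : ℂ} (h : OrdAt ℓ f n L)
    (h' : OrdAt ℓ f n' L') : n = n' ∧ L = L' := by
  have key : ∀ {n n' : ℤ} {L L' : ℂ}, OrdAt ℓ f n L → OrdAt ℓ f n' L' → n' ≤ n := by
    intro n n' L L' h h'
    by_contra! hlt
    have h1 : Tendsto (fun τ : ℍ => e ((τ : ℂ) / ℓ) ^ (n' - n).toNat) atImInfty (𝓝 0) := by
      have := (tendsto_e_div ℓ hℓ).pow (n' - n).toNat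
      rwa [zero_pow (by omega)] at this
    have h2 := h'.2.mul h1
    rw [mul_zero] at h2
    refine h.1 (tendsto_nhds_unique h.2 (h2.congr fun τ => ?_))
    rw [← zpow_natCast, Int.toNat_of_nonneg (by omega), ← e_int_mul, mul_assoc, ← e_add]
    congr 2
    push_cast
    ring
  have hn : n = n' := le_antisymm (key h' h) (key h h')
  subst hn
  exact ⟨rfl, tendsto_nhds_unique h.2 h'.2⟩

theorem OrdAt.mul {f g : ℍ → ℂ} {n n' : ℤ} {L L' : ℂ} (h : OrdAt ℓ f n L)
    (h' : OrdAt ℓ g n' L') : OrdAt ℓ (fun τ => f τ * g τ) (n + n') (L * L') := by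
  refine ⟨mul_ne_zero h.1 h'.1, (h.2.mul h'.2).congr fun τ => ?_⟩
  rw [mul_mul_mul_comm, ← e_add]
  congr 2
  push_cast
  ring

theorem OrdAt.inv {f : ℍ → ℂ} {n : ℤ} {L : ℂ} (h : OrdAt ℓ f n L) :
    OrdAt ℓ (fun τ => (f τ)⁻¹) (-n) L⁻¹ := by
  refine ⟨inv_ne_zero h.1, (h.2.inv₀ h.1).congr fun τ => ?_⟩
  rw [mul_inv, e, ← Complex.exp_neg, e]
  congr 2
  push_cast
  ring

theorem ordAt_const {c : ℂ} (hc : c ≠ 0) : OrdAt ℓ (fun _ => c) 0 c := by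
  refine ⟨hc, tendsto_const_nhds.congr fun τ => ?_⟩
  simp [e_zero]

theorem OrdAt.isBounded (hℓ : 0 < ℓ) {f : ℍ → ℂ} {n : ℤ} {L : ℂ} (h : OrdAt ℓ f n L) (hn : 0 ≤ n) :
    IsBoundedAtImInfty f := by
  have h1 := h.2.mul ((tendsto_e_div ℓ hℓ).pow n.toNat)
  refine (h1.congr fun τ => ?_).isBigO_one ℝ
  rw [← zpow_natCast, Int.toNat_of_nonneg hn, ← e_int_mul, mul_assoc, ← e_add, ← mul_one (f τ)]
  congr 1
  · ring
  · rw [← e_zero]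
    congr 1
    ring

theorem OrdAt.congr {f g : ℍ → ℂ} {n : ℤ} {L : ℂ} (h : OrdAt ℓ f n L) (hfg : ∀ τ, f τ = g τ) :
    OrdAt ℓ g n L := by
  rwa [← funext hfg]

theorem mdifferentiable_smul_SL {f : ℍ → ℂ} (hf : MDifferentiable 𝓘(ℂ) 𝓘(ℂ) f) (γ : SL(2, ℤ)) :
    MDifferentiable 𝓘(ℂ) 𝓘(ℂ) (fun τ : ℍ => f (γ • τ)) :=
  hf.comp (mdifferentiable_smul (g := (γ : GL (Fin 2) ℝ)) (by simp))

theorem mdifferentiable_inv {f : ℍ → ℂ} (hf : MDifferentiable 𝓘(ℂ) 𝓘(ℂ) f) (h0 : ∀ τ, f τ ≠ 0) :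
    MDifferentiable 𝓘(ℂ) 𝓘(ℂ) (fun τ : ℍ => (f τ)⁻¹) := by
  rw [UpperHalfPlane.mdifferentiable_iff] at hf ⊢
  exact hf.inv fun z _ => h0 _

theorem mdifferentiable_e (c : ℂ) : MDifferentiable 𝓘(ℂ) 𝓘(ℂ) (fun τ : ℍ => e (c * τ)) := by
  rw [UpperHalfPlane.mdifferentiable_iff]
  have : DifferentiableOn ℂ (fun z : ℂ => e (c * z)) {z | 0 < z.im} := by
    unfold e
    fun_prop
  exact this.congr fun z hz => by rw [Function.comp_apply, ofComplex_apply_of_im_pos hz]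

theorem T_zpow_smul (n : ℤ) (τ : ℍ) : ModularGroup.T ^ n • τ = (n : ℝ) +ᵥ τ :=
  UpperHalfPlane.modular_T_zpow_smul τ n

theorem conj_mem_Gamma {γ δ : SL(2, ℤ)} (h : δ ∈ Gamma ℓ) : γ * δ * γ⁻¹ ∈ Gamma ℓ :=
  (Gamma_normal ℓ).conj_mem δ h γ

theorem smul_invariant {f : ℍ → ℂ} (hf : ∀ δ ∈ Gamma ℓ, ∀ τ : ℍ, f (δ • τ) = f τ)
    (γ : SL(2, ℤ)) : ∀ δ ∈ Gamma ℓ, ∀ τ : ℍ, f (γ • δ • τ) = f (γ • τ) := by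
  intro δ hδ τ
  rw [← hf _ (conj_mem_Gamma (γ := γ) hδ) (γ • τ), smul_smul, smul_smul]
  simp

theorem T_zpow_mem_Gamma : ModularGroup.T ^ (ℓ : ℤ) ∈ Gamma ℓ := by
  simpa using ModularGroup_T_pow_mem_Gamma ℓ ℓ dvd_rfl

theorem vadd_of_invariant {f : ℍ → ℂ} (hf : ∀ δ ∈ Gamma ℓ, ∀ τ : ℍ, f (δ • τ) = f τ) (τ : ℍ) :
    f ((ℓ : ℝ) +ᵥ τ) = f τ := by
  have := hf _ T_zpow_mem_Gamma τ
  rwa [T_zpow_smul, Int.cast_natCast] at this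

/-- Such a function is a modular form of weight 0 for Γ(ℓ). -/
theorem const_of_bounded (hℓ : 0 < ℓ) {f : ℍ → ℂ} (hf : MDifferentiable 𝓘(ℂ) 𝓘(ℂ) f)
    (hinv : ∀ δ ∈ Gamma ℓ, ∀ τ : ℍ, f (δ • τ) = f τ)
    (hb : ∀ γ : SL(2, ℤ), IsBoundedAtImInfty fun τ => f (γ • τ)) : ∃ c, ∀ τ, f τ = c := by
  have : NeZero ℓ := ⟨hℓ.ne'⟩
  let F : ModularForm ((Gamma ℓ : Subgroup SL(2, ℤ)) : Subgroup (GL (Fin 2) ℝ)) 0 :=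
    { toFun := f
      slash_action_eq' := by
        rintro _ ⟨γ, hγ, rfl⟩
        ext τ
        have := ModularForm.SL_slash_apply (k := 0) f γ τ
        rw [neg_zero, zpow_zero, mul_one, hinv γ hγ] at this
        exact this
      holo' := hf
      bdd_at_cusps' := by
        intro c hc
        rw [Subgroup.IsArithmetic.isCusp_iff_isCusp_SL2Z] at hc
        rw [OnePoint.isBoundedAt_iff_forall_SL2Z hc]
        intro γ _
        convert hb γ using 1
        ext τ
        simp [ModularForm.SL_slash_apply] }
  obtain ⟨c, hc⟩ := ModularForm.eq_const_of_weight_zero F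
  exact ⟨c, fun τ => congrFun hc τ⟩

/-- The units of level `ℓ`, without any condition on Fourier coefficients. -/
structure IsCuspUnit (ℓ : ℕ) (f : (ℍ → ℂ)ˣ) : Prop where
  holomorphic : MDifferentiable 𝓘(ℂ) 𝓘(ℂ) (f : ℍ → ℂ)
  invariant : ∀ γ ∈ Gamma ℓ, ∀ τ : ℍ, (f : ℍ → ℂ) (γ • τ) = (f : ℍ → ℂ) τ
  exists_ordAt : ∀ γ : SL(2, ℤ), ∃ n L, OrdAt ℓ (fun τ => (f : ℍ → ℂ) (γ • τ)) n L

/-- The group of units of level `ℓ`. -/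
def cuspUnits (ℓ : ℕ) : Subgroup (ℍ → ℂ)ˣ where
  carrier := {f | IsCuspUnit ℓ f}
  mul_mem' {f g} hf hg := by
    refine ⟨hf.holomorphic.mul hg.holomorphic, fun γ hγ τ => ?_, fun γ => ?_⟩
    · rw [Units.val_mul, Pi.mul_apply, Pi.mul_apply, hf.invariant γ hγ, hg.invariant γ hγ]
    · obtain ⟨n, L, h⟩ := hf.exists_ordAt γ
      obtain ⟨n', L', h'⟩ := hg.exists_ordAt γ
      exact ⟨_, _, h.mul h'⟩
  one_mem' := by
    refine ⟨mdifferentiable_const, fun γ hγ τ => rfl, fun γ => ⟨0, 1, ordAt_const one_ne_zero⟩⟩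
  inv_mem' {f} hf := by
    refine ⟨?_, fun γ hγ τ => ?_, fun γ => ?_⟩
    · rw [show ((f⁻¹ : (ℍ → ℂ)ˣ) : ℍ → ℂ) = _ from funext (unit_inv_apply f)]
      exact mdifferentiable_inv hf.holomorphic (unit_ne_zero f)
    · rw [unit_inv_apply, unit_inv_apply, hf.invariant γ hγ]
    · obtain ⟨n, L, h⟩ := hf.exists_ordAt γ
      exact ⟨_, _, h.inv.congr fun τ => (unit_inv_apply f _).symm⟩

/-- A nonzero constant, as a unit. -/
def constUnit : ℂˣ →* (ℍ → ℂ)ˣ := Units.map (Pi.constRingHom ℍ ℂ : ℂ →* (ℍ → ℂ))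

theorem constUnit_apply (c : ℂˣ) (τ : ℍ) : (constUnit c : ℍ → ℂ) τ = c := rfl

theorem constUnit_mem (c : ℂˣ) : constUnit c ∈ cuspUnits ℓ :=
  ⟨mdifferentiable_const, fun _ _ _ => rfl, fun _ => ⟨0, c, ordAt_const c.ne_zero⟩⟩

theorem eq_constUnit {f : (ℍ → ℂ)ˣ} {c : ℂ} (h : ∀ τ, (f : ℍ → ℂ) τ = c) :
    ∃ u, f = constUnit u :=
  ⟨evalUnit I f, unit_ext fun τ => by rw [h, constUnit_apply, coe_evalUnit, h]⟩

theorem const_of_order_nonneg (hℓ : 0 < ℓ) {f : (ℍ → ℂ)ˣ} (hf : f ∈ cuspUnits ℓ)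
    (h : ∀ γ : SL(2, ℤ), ∀ n L, OrdAt ℓ (fun τ => (f : ℍ → ℂ) (γ • τ)) n L → 0 ≤ n) :
    ∃ u, f = constUnit u := by
  obtain ⟨c, hc⟩ := const_of_bounded hℓ hf.holomorphic hf.invariant fun γ => by
    obtain ⟨n, L, hn⟩ := hf.exists_ordAt γ
    exact hn.isBounded hℓ (h γ n L hn)
  exact eq_constUnit hc

theorem HasFourierExpansion.exists_rep (hℓ : 0 < ℓ) {f : ℍ → ℂ} {c : ℤ → ℂ}
    (h : HasFourierExpansion ℓ f c) {n : ℤ} (hn : ∀ i < n, c i = 0) :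
    ∃ F, Rep (.mk fun k => c (n + k)) F ∧
      ∀ τ : ℍ, F (e ((τ : ℂ) / ℓ)) = f τ * e (-((n : ℂ) / ℓ) * τ) := by
  refine rep_of_hasSum hℓ fun τ => ?_
  have h1 := (h.2 τ).mul_right (e (-((n : ℂ) / ℓ) * τ))
  have hinj : Function.Injective fun k : ℕ => n + (k : ℤ) := fun a b hab => by simpa using hab
  rw [← hinj.hasSum_iff] at h1
  · refine (congrArg (fun g => HasSum g _) (funext fun k => ?_)).mp h1
    rw [PowerSeries.coeff_mk, Function.comp_apply, mul_assoc, ← e_add, ← e_nat_mul]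
    congr 2
    push_cast
    ring
  · intro i hi
    rw [hn i, zero_mul, zero_mul]
    by_contra! h
    exact hi ⟨(i - n).toNat, by simp only; omega⟩

theorem HasFourierExpansion.ordAt (hℓ : 0 < ℓ) {f : ℍ → ℂ} {c : ℤ → ℂ}
    (h : HasFourierExpansion ℓ f c) {n : ℤ} (hn0 : c n ≠ 0) (hn : ∀ i < n, c i = 0) :
    OrdAt ℓ f n (c n) := by
  obtain ⟨F, hF, hFf⟩ := h.exists_rep hℓ hn
  refine ⟨hn0, ?_⟩
  have := hF.tendsto hℓ
  rw [PowerSeries.coeff_mk, Nat.cast_zero, add_zero] at this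
  exact this.congr hFf

theorem HasFourierExpansion.exists_ordAt (hℓ : 0 < ℓ) {f : ℍ → ℂ} {c : ℤ → ℂ}
    (h : HasFourierExpansion ℓ f c) (hf : ∃ τ, f τ ≠ 0) : ∃ n, OrdAt ℓ f n (c n) := by
  obtain ⟨N, hN⟩ := h.1
  have hc : ∃ n, c n ≠ 0 := by
    by_contra! hc
    obtain ⟨τ, hτ⟩ := hf
    have := h.2 τ
    simp only [hc, zero_mul] at this
    exact hτ (this.unique hasSum_zero)
  obtain ⟨n, hn, hmin⟩ := Int.exists_least_of_bdd (P := fun n => c n ≠ 0)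
    ⟨N, fun z hz => by by_contra! hlt; exact hz (hN z hlt)⟩ hc
  exact ⟨n, h.ordAt hℓ hn fun i hi => by by_contra hi0; exact absurd (hmin i hi0) (by omega)⟩

theorem hasFourierExpansion_of_rep {f : ℍ → ℂ} {p : PowerSeries ℂ} {F : ℂ → ℂ}
    (hF : Rep p F) (hℓ : 0 < ℓ) (n : ℤ)
    (hf : ∀ τ : ℍ, F (e ((τ : ℂ) / ℓ)) = f τ * e (-((n : ℂ) / ℓ) * τ)) :
    HasFourierExpansion ℓ f fun i => if n ≤ i then p.coeff (i - n).toNat else 0 := by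
  refine ⟨⟨n, fun i hi => if_neg (by omega)⟩, fun τ => ?_⟩
  have h1 := (hF _ (norm_e_div_lt_one hℓ τ)).mul_right (e ((n : ℂ) / ℓ * τ))
  have hinj : Function.Injective fun k : ℕ => n + (k : ℤ) := fun a b hab => by simpa using hab
  rw [← hinj.hasSum_iff]
  · rw [hf, mul_assoc, ← e_add, neg_mul, neg_add_cancel, e_zero, mul_one] at h1
    refine (congrArg (fun g => HasSum g _) (funext fun k => ?_)).mp h1
    simp only [Function.comp_apply]
    rw [if_pos (by omega), add_sub_cancel_left, Int.toNat_natCast, mul_assoc,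
      ← e_nat_mul, ← e_add]
    congr 2
    push_cast
    ring
  · intro i hi
    simp only
    rw [if_neg, zero_mul]
    intro h
    exact hi ⟨(i - n).toNat, by simp only; omega⟩

theorem OrdAt.exists_fourier (hℓ : 0 < ℓ) {f : ℍ → ℂ} (hf : MDifferentiable 𝓘(ℂ) 𝓘(ℂ) f)
    (hper : ∀ τ : ℍ, f ((ℓ : ℝ) +ᵥ τ) = f τ) {n : ℤ} {L : ℂ} (h : OrdAt ℓ f n L) :
    ∃ c, HasFourierExpansion ℓ f c ∧ c n = L ∧ ∀ i < n, c i = 0 := by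
  have hℓ0 : (ℓ : ℂ) ≠ 0 := by exact_mod_cast hℓ.ne'
  obtain ⟨p, F, hF, hFf⟩ := ModUnits.exists_rep hℓ (f := fun τ => f τ * e (-((n : ℂ) / ℓ) * τ))
    (hf.mul (mdifferentiable_e _)) (fun τ => by
      rw [hper, coe_vadd, mul_add, e_add]
      have : -((n : ℂ) / ℓ) * ((ℓ : ℝ) : ℂ) = ((-n : ℤ) : ℂ) := by
        push_cast
        field_simp
      rw [this, e_int, one_mul]) (h.2.isBigO_one ℝ)
  refine ⟨_, hasFourierExpansion_of_rep hF hℓ n hFf, ?_, fun i hi => if_neg (by omega)⟩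
  rw [if_pos le_rfl, sub_self, Int.toNat_zero]
  exact tendsto_nhds_unique ((hF.tendsto hℓ).congr hFf) h.2

/-- The stabilizer of ∞ in SL₂(ℤ) has lower left entry 0 and so lies in Γ₀(ℓ); the condition on a
cusp thus becomes one on any γ producing it. -/
theorem cusp_mem_cuspsAboveInfty {γ : SL(2, ℤ)} :
    cusp γ ∈ cuspsAboveInfty ℓ ↔ γ ∈ Gamma0 ℓ := by
  refine ⟨fun ⟨δ, hδ, h⟩ => ?_, fun h => ⟨γ, h, rfl⟩⟩
  have h1 : Matrix.SpecialLinearGroup.mapGL ℚ (δ⁻¹ * γ) • (∞ : OnePoint ℚ) = ∞ := by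
    rw [map_mul, mul_smul, map_inv, inv_smul_eq_iff]
    exact h
  have h3 : δ⁻¹ * γ ∈ Gamma0 ℓ := by
    generalize δ⁻¹ * γ = η at h1 ⊢
    rw [OnePoint.smul_infty_eq_self_iff] at h1
    have h2 : η 1 0 = 0 := by simpa using h1
    rw [Gamma0_mem, h2]
    simp
  simpa using mul_mem hδ h3

theorem mem_Gamma0_iff {γ : SL(2, ℤ)} : γ ∈ Gamma0 ℓ ↔ (ℓ : ℤ) ∣ γ 1 0 := by
  rw [Gamma0_mem, ZMod.intCast_zmod_eq_zero_iff_dvd]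

theorem UPlus.mem_cuspUnits (hℓ : 0 < ℓ) {f : (ℍ → ℂ)ˣ} (hf : f ∈ UPlus ℓ) : f ∈ cuspUnits ℓ :=
  ⟨hf.1.holomorphic, hf.1.invariant, fun γ => by
    obtain ⟨c, hc⟩ := hf.1.meromorphic_at_cusps γ
    obtain ⟨n, hn⟩ := hc.exists_ordAt hℓ ⟨I, hf.1.ne_zero _⟩
    exact ⟨n, _, hn⟩⟩

theorem UPlus.ordAt (hℓ : 0 < ℓ) {f : (ℍ → ℂ)ˣ} (hf : f ∈ UPlus ℓ) {γ : SL(2, ℤ)}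
    (hγ : γ ∉ Gamma0 ℓ) : ∃ L, OrdAt ℓ (fun τ => (f : ℍ → ℂ) (γ • τ)) 0 L := by
  obtain ⟨c, hc, h0, h1⟩ := hf.2 γ (by rwa [cusp_mem_cuspsAboveInfty])
  exact ⟨_, hc.ordAt hℓ h0 h1⟩

theorem mem_UPlus (hℓ : 0 < ℓ) {f : (ℍ → ℂ)ˣ} (hf : f ∈ cuspUnits ℓ)
    (hord : ∀ γ : SL(2, ℤ), γ ∉ Gamma0 ℓ → ∃ L, OrdAt ℓ (fun τ => (f : ℍ → ℂ) (γ • τ)) 0 L)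
    (hcoeff : ∃ c, HasFourierExpansion ℓ f c ∧ ∀ n, c n ∈ cycField ℓ) : f ∈ UPlus ℓ := by
  have key {γ : SL(2, ℤ)} {n L} (h : OrdAt ℓ (fun τ => (f : ℍ → ℂ) (γ • τ)) n L) :=
    h.exists_fourier hℓ (mdifferentiable_smul_SL hf.holomorphic γ)
      (vadd_of_invariant (f := fun τ => (f : ℍ → ℂ) (γ • τ)) (smul_invariant hf.invariant γ))
  refine ⟨⟨hf.holomorphic, unit_ne_zero f, hf.invariant, fun γ => ?_, hcoeff⟩, fun γ hγ => ?_⟩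
  · obtain ⟨n, L, h⟩ := hf.exists_ordAt γ
    obtain ⟨c, hc, -⟩ := key h
    exact ⟨c, hc⟩
  · rw [cusp_mem_cuspsAboveInfty] at hγ
    obtain ⟨L, h⟩ := hord γ hγ
    obtain ⟨c, hc, h0, h1⟩ := key h
    exact ⟨c, hc, h0 ▸ h.1, h1⟩

end

/-! ### Integral q-expansions and injectivity of the parametrization -/

section

variable {ℓ : ℕ} [hp : Fact ℓ.Prime]

theorem isClass_of_mem_Gamma0 {γ : SL(2, ℤ)} (hγ : γ ∈ Gamma0 ℓ) :
    ∃ A : Cl ℓ, IsClass A (γ 0 0) := by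
  refine exists_isClass fun h => ?_
  have h1 := det_eq_one γ
  rw [mem_Gamma0_iff] at hγ
  have : (ℓ : ℤ) ∣ 1 := by
    rw [← h1]
    exact dvd_sub (h.mul_right _) (hγ.mul_left _)
  have h2 := Int.le_of_dvd one_pos this
  have := hp.out.one_lt
  omega

theorem sum_shift (v : Cl ℓ → ℤ) (A : Cl ℓ) : ∑ y, v (y * A⁻¹) = ∑ y, v y :=
  Fintype.sum_equiv (Equiv.mulRight A⁻¹) _ _ fun _ => rfl

theorem EP_ordAt (hodd : ℓ ≠ 2) {v : Cl ℓ → ℤ} (hv : ∑ x, v x = 0) {γ : SL(2, ℤ)}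
    (hγ : γ ∈ Gamma0 ℓ) {A : Cl ℓ} (hA : IsClass A (γ 0 0)) :
    ∃ L, OrdAt ℓ (fun τ => (EP v : ℍ → ℂ) (γ • τ)) (ordInfty fun y => v (y * A⁻¹)) L := by
  obtain ⟨c, hc⟩ := mem_Gamma0_iff.mp hγ
  obtain ⟨C, hC, h⟩ := EP_Gamma0 hv hc hA
  refine ⟨C * 1, ?_⟩
  have h1 : OrdAt ℓ (EP fun y => v (y * A⁻¹) : ℍ → ℂ) (ordInfty fun y => v (y * A⁻¹)) 1 :=
    ⟨one_ne_zero, EP_tendsto hodd (by rw [sum_shift, hv])⟩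
  have h2 := (ordAt_const (ℓ := ℓ) hC).mul h1
  rw [zero_add] at h2
  exact h2.congr fun τ => (h τ).symm

theorem EP_ordAt_infty (hodd : ℓ ≠ 2) {v : Cl ℓ → ℤ} (hv : ∑ x, v x = 0) :
    OrdAt ℓ (EP v : ℍ → ℂ) (ordInfty v) 1 := ⟨one_ne_zero, EP_tendsto hodd hv⟩

theorem EP_ordAt_not_Gamma0 {v : Cl ℓ → ℤ} (hv : ∑ x, v x = 0) {γ : SL(2, ℤ)}
    (hγ : γ ∉ Gamma0 ℓ) : ∃ L, OrdAt ℓ (fun τ => (EP v : ℍ → ℂ) (γ • τ)) 0 L := by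
  rw [mem_Gamma0_iff] at hγ
  obtain ⟨L, hL, h⟩ := EP_not_Gamma0 hv hγ
  exact ⟨L, hL, by simpa [e_zero] using h⟩

theorem EP_mem_cuspUnits (hodd : ℓ ≠ 2) {v : Cl ℓ → ℤ} (hv : ∑ x, v x = 0) :
    EP v ∈ cuspUnits ℓ := by
  refine ⟨EP_mdifferentiable hodd hv, fun γ hγ τ => EP_Gamma hodd hv hγ τ, fun γ => ?_⟩
  by_cases hγ : γ ∈ Gamma0 ℓ
  · obtain ⟨A, hA⟩ := isClass_of_mem_Gamma0 hγ
    exact ⟨_, EP_ordAt hodd hv hγ hA⟩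
  · exact ⟨_, EP_ordAt_not_Gamma0 hv hγ⟩

/-- The Euler product over the class `x`, as an integral power series with constant term `1`. -/
def eulerUnit (x : Cl ℓ) : (PowerSeries ℤ)ˣ :=
  (PowerSeries.isUnit_iff_constantCoeff.mpr (by
    rw [← PowerSeries.coeff_zero_eq_constantCoeff_apply, coeff_zero_eulerSer]
    exact isUnit_one) : IsUnit (eulerSer (classSet x))).unit

theorem coe_eulerUnit (x : Cl ℓ) : (eulerUnit x : PowerSeries ℤ) = eulerSer (classSet x) := rfl

/-- The normalized `q`-expansion of `EP v`. -/
def EPSer (v : Cl ℓ → ℤ) : (PowerSeries ℤ)ˣ := ∏ x, eulerUnit x ^ v x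

/-- Extension of scalars from integral to complex power series. -/
def toC : PowerSeries ℤ →+* PowerSeries ℂ := PowerSeries.map (Int.castRingHom ℂ)

theorem toC_injective : Function.Injective toC :=
  PowerSeries.map_injective _ Int.cast_injective

/-- The reciprocal is holomorphic on the disc; its Taylor series times u represents 1, so it is the
formal inverse. -/
theorem Rep.inv {u : (PowerSeries ℂ)ˣ} {F : ℂ → ℂ} (h : Rep u F) (hF : ∀ z, ‖z‖ < 1 → F z ≠ 0) :
    Rep ((u⁻¹ : (PowerSeries ℂ)ˣ) : PowerSeries ℂ) fun z => (F z)⁻¹ := by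
  have h1 := rep_taylor (h.differentiableOn.inv fun z hz => hF z (by simpa using hz))
  have h2 := (h.mul h1).congr (F' := fun _ => 1) fun z hz => mul_inv_cancel₀ (hF z hz)
  have h3 := h2.unique rep_one
  have h4 : taylor (fun z => (F z)⁻¹) = ((u⁻¹ : (PowerSeries ℂ)ˣ) : PowerSeries ℂ) :=
    (Units.inv_eq_of_mul_eq_one_right h3).symm
  rw [← h4]
  exact h1

theorem Rep.zpow {u : (PowerSeries ℂ)ˣ} {F : ℂ → ℂ} (h : Rep u F)
    (hF : ∀ z, ‖z‖ < 1 → F z ≠ 0) (n : ℤ) :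
    Rep ((u ^ n : (PowerSeries ℂ)ˣ) : PowerSeries ℂ) fun z => F z ^ n := by
  cases n with
  | ofNat n => simpa using h.pow n
  | negSucc n =>
    have h1 : Rep ((u ^ (n + 1) : (PowerSeries ℂ)ˣ) : PowerSeries ℂ) fun z => F z ^ (n + 1) := by
      simpa using h.pow (n + 1)
    simpa only [zpow_negSucc] using h1.inv fun z hz => pow_ne_zero _ (hF z hz)

theorem rep_EPSer (v : Cl ℓ → ℤ) :
    Rep (toC (EPSer v)) fun z => ∏ x, eulerProd (classChar x) z ^ v x := by
  have h1 (x : Cl ℓ) : Rep ((Units.map (toC : _ →* _) (eulerUnit x) ^ v x : (PowerSeries ℂ)ˣ) :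
      PowerSeries ℂ) fun z => eulerProd (classChar x) z ^ v x := by
    refine Rep.zpow ?_ (fun z hz => eulerProd_ne_zero (norm_classChar_le x) hz) _
    exact rep_eulerSer (classSet x)
  have h2 := Rep.prod Finset.univ fun (x : Cl ℓ) _ => h1 x
  convert h2 using 1
  have h3 : toC (EPSer v) =
    ((Units.map (toC : _ →* _) (EPSer v) : (PowerSeries ℂ)ˣ) : PowerSeries ℂ) := rfl
  rw [h3, EPSer, map_prod, Units.coe_prod]
  simp only [map_zpow]

theorem constantCoeff_EPSer (v : Cl ℓ → ℤ) : (EPSer v : PowerSeries ℤ).coeff 0 = 1 := by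
  have h := (rep_EPSer v).coeff_zero
  simp only [eulerProd_zero, one_zpow, Finset.prod_const_one] at h
  have : ((EPSer v : PowerSeries ℤ).coeff 0 : ℂ) = 1 := by
    rw [h]; simp [toC]
  exact_mod_cast this

/-- The logarithmic derivative `X u' / u`. -/
def logD : (PowerSeries ℤ)ˣ →* Multiplicative (PowerSeries ℤ) where
  toFun u := .ofAdd (PowerSeries.X * PowerSeries.derivative ℤ (u : PowerSeries ℤ) *
    ((u⁻¹ : (PowerSeries ℤ)ˣ) : PowerSeries ℤ))
  map_one' := by simp
  map_mul' u v := by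
    rw [← ofAdd_add]
    congr 1
    rw [Units.val_mul, Derivation.leibniz, mul_inv, Units.val_mul, smul_eq_mul, smul_eq_mul]
    have hu := u.mul_inv
    have hv := v.mul_inv
    linear_combination (PowerSeries.X * PowerSeries.derivative ℤ (v : PowerSeries ℤ) *
      ((v⁻¹ : (PowerSeries ℤ)ˣ) : PowerSeries ℤ)) * hu + (PowerSeries.X *
      PowerSeries.derivative ℤ (u : PowerSeries ℤ) *
      ((u⁻¹ : (PowerSeries ℤ)ˣ) : PowerSeries ℤ)) * hv

theorem logD_eulerUnit (x : Cl ℓ) : logD (eulerUnit x) = .ofAdd (-sigmaSer (classSet x)) := by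
  refine congrArg Multiplicative.ofAdd ?_
  rw [coe_eulerUnit, X_mul_derivative_eulerSer, ← coe_eulerUnit]
  linear_combination -sigmaSer (classSet x) * (eulerUnit x).mul_inv

theorem X_mul_derivative_EPSer (v : Cl ℓ → ℤ) :
    PowerSeries.X * PowerSeries.derivative ℤ (EPSer v : PowerSeries ℤ) *
      (((EPSer v)⁻¹ : (PowerSeries ℤ)ˣ) : PowerSeries ℤ) = -∑ x, v x • sigmaSer (classSet x) := by
  have h : logD (EPSer v) = .ofAdd (-∑ x, v x • sigmaSer (classSet x)) := by
    rw [EPSer, map_prod]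
    simp only [map_zpow, logD_eulerUnit, ← ofAdd_zsmul, ← Finset.sum_neg_distrib, smul_neg]
    rw [ofAdd_sum]
  exact congrArg Multiplicative.toAdd h

/-- Möbius inversion modulo p, as a strong induction over proper divisors. -/
theorem dvd_of_sum_divisors {p : ℤ} {a : ℕ → ℤ} (h : ∀ n ≠ 0, p ∣ ∑ d ∈ n.divisors, a d) :
    ∀ n ≠ 0, p ∣ a n := by
  intro n
  induction n using Nat.strong_induction_on with
  | _ n ih =>
    intro hn
    have h1 := h n hn
    rw [← Nat.insert_self_properDivisors hn, Finset.sum_insert (by simp)] at h1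
    refine (dvd_add_left (Finset.dvd_sum fun d hd => ?_)).mp h1
    rw [Nat.mem_properDivisors] at hd
    exact ih d hd.2 (Nat.pos_of_dvd_of_pos hd.1 (Nat.pos_of_ne_zero hn)).ne'

theorem exists_mem_classSet {p : ℕ} (hpp : p.Prime) (x : Cl ℓ) : ∃ d ∈ classSet x, ¬ p ∣ d := by
  by_cases h : p ∣ repr x
  · refine ⟨repr x + ℓ, (isClass_iff x _).mpr (Or.inl ⟨1, by push_cast; ring⟩), fun h' => ?_⟩
    have h2 : p = ℓ := (Nat.prime_dvd_prime_iff_eq hpp hp.out).mp ((Nat.dvd_add_right h).mp h')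
    rw [h2] at h
    exact absurd (Nat.le_of_dvd (repr_pos x) h) (by have := repr_lt x; omega)
  · exact ⟨_, isClass_repr x, h⟩

/-- The logarithmic derivative then vanishes modulo p as well, and its coefficients are, up to sign,
the divisor sums of d · v(class of d). Inverting gives p ∣ d · v(x) for every d in the class x, and
some such d is prime to p. This serves both injectivity and saturation. -/
theorem dvd_of_derivative_EPSer {p : ℕ} (hpp : p.Prime) {v : Cl ℓ → ℤ}
    (h : ∀ n, (p : ℤ) ∣ (PowerSeries.derivative ℤ (EPSer v : PowerSeries ℤ)).coeff n) (x : Cl ℓ) :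
    (p : ℤ) ∣ v x := by
  classical
  let a (d : ℕ) : ℤ := ∑ x : Cl ℓ, if d ∈ classSet x then v x * d else 0
  have h1 (n : ℕ) : (p : ℤ) ∣ (PowerSeries.X * PowerSeries.derivative ℤ (EPSer v : PowerSeries ℤ) *
      (((EPSer v)⁻¹ : (PowerSeries ℤ)ˣ) : PowerSeries ℤ)).coeff n := by
    rw [mul_comm PowerSeries.X, mul_assoc, PowerSeries.coeff_mul]
    exact Finset.dvd_sum fun i _ => (h _).mul_right _
  have h2 (n : ℕ) (hn : n ≠ 0) : (p : ℤ) ∣ ∑ d ∈ n.divisors, a d := by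
    have := h1 n
    rw [X_mul_derivative_EPSer, map_neg, dvd_neg, map_sum] at this
    refine this.trans (dvd_of_eq ?_)
    simp only [a]
    rw [Finset.sum_comm]
    refine Finset.sum_congr rfl fun x _ => ?_
    rw [map_zsmul, sigmaSer, PowerSeries.coeff_mk, smul_eq_mul, Finset.mul_sum, Finset.sum_filter]
  obtain ⟨d, hd, hpd⟩ := exists_mem_classSet hpp x
  have hd0 : d ≠ 0 := by
    rintro rfl
    simp at hpd
  have h3 := dvd_of_sum_divisors h2 d hd0
  have h4 : a d = v x * d := by
    simp only [a]
    rw [Finset.sum_eq_single x]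
    · rw [if_pos hd]
    · intro y _ hy
      rw [if_neg (show ¬ d ∈ classSet y from fun hy' => hy (IsClass.unique hy' hd))]
    · simp
  rw [h4] at h3
  refine ((Nat.prime_iff_prime_int.mp hpp).dvd_or_dvd h3).resolve_right fun h => hpd ?_
  exact_mod_cast h

theorem eq_zero_of_EPSer_eq_one {v : Cl ℓ → ℤ} (h : (EPSer v : PowerSeries ℤ) = 1) : v = 0 := by
  funext x
  -- The derivative of 1 is 0, so every prime divides v x; one exceeding |v x| suffices.
  obtain ⟨p, hp1, hp2⟩ := Nat.exists_infinite_primes ((v x).natAbs + 1)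
  have := dvd_of_derivative_EPSer hp2 (v := v) (fun n => by rw [h]; simp) x
  exact Int.eq_zero_of_abs_lt_dvd this (by rw [Int.abs_eq_natAbs]; omega)

/-- Comparing orders and leading coefficients at ∞ gives order 0 and c = 1, so the normalized
q-expansion is the series 1. -/
theorem eq_zero_of_EP_const (hodd : ℓ ≠ 2) {v : Cl ℓ → ℤ} (hv : ∑ x, v x = 0) {c : ℂˣ}
    (h : EP v = constUnit c) : v = 0 := by
  have h1 := EP_ordAt_infty hodd hv
  rw [h] at h1
  obtain ⟨h2, h3⟩ := h1.unique hp.out.pos (ordAt_const c.ne_zero)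
  refine eq_zero_of_EPSer_eq_one (toC_injective ?_)
  rw [map_one]
  refine (rep_EPSer v).unique (rep_one.congr fun z hz => ?_)
  by_cases h0 : z = 0
  · simp [h0, eulerProd_zero]
  · obtain ⟨τ, hτ⟩ := exists_e_eq one_pos h0 hz
    rw [Nat.cast_one, div_one] at hτ
    have := EP_eq hodd hv τ
    rw [h, constUnit_apply, h2, show (c : ℂ) = 1 from h3.symm, hτ] at this
    simpa [e_zero] using this

theorem EP_injective (hodd : ℓ ≠ 2) {v w : Cl ℓ → ℤ} (hv : ∑ x, v x = ∑ x, w x)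
    (h : EP v = EP w) : v = w := by
  have h1 : EP (v - w) = constUnit 1 := by
    rw [map_one, sub_eq_add_neg, EP_add, h, ← EP_add, add_neg_cancel, EP_zero]
  exact sub_eq_zero.mp (eq_zero_of_EP_const hodd (by simp [hv]) h1)

theorem EP_fourier (hodd : ℓ ≠ 2) {v : Cl ℓ → ℤ} (hv : ∑ x, v x = 0) (C : ℂ) :
    ∃ c : ℤ → ℂ, HasFourierExpansion ℓ (fun τ => C * (EP v : ℍ → ℂ) τ) c ∧
      ∀ n, ∃ m : ℤ, c n = C * m := by
  let i (k : ℕ) : ℤ := ordInfty v + ℓ * k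
  have hinj : Function.Injective i := fun a b hab => by
    simpa [i, hp.out.ne_zero] using hab
  have hℓ0 : (ℓ : ℂ) ≠ 0 := by exact_mod_cast hp.out.ne_zero
  let m : ℤ → ℤ := Function.extend i (fun k => (EPSer v : PowerSeries ℤ).coeff k) 0
  refine ⟨fun n => C * m n, ⟨⟨ordInfty v, fun n hn => ?_⟩, fun τ => ?_⟩, fun n => ⟨_, rfl⟩⟩
  · simp only [m]
    rw [Function.extend_apply', Pi.zero_apply, Int.cast_zero, mul_zero]
    rintro ⟨k, rfl⟩
    have : (0 : ℤ) ≤ ℓ * k := by positivity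
    simp only [i] at hn
    omega
  · rw [← hinj.hasSum_iff]
    · have h1 := (rep_EPSer v _ (norm_e_lt_one τ.im_pos)).mul_left
        (C * e ((ordInfty v : ℂ) / ℓ * τ))
      rw [mul_assoc, ← EP_eq hodd hv] at h1
      refine (congrArg (fun g => HasSum g _) (funext fun k => ?_)).mp h1
      simp only [Function.comp_apply, m]
      rw [hinj.extend_apply]
      have h2 : (toC (EPSer v)).coeff k = ((EPSer v : PowerSeries ℤ).coeff k : ℂ) := by simp [toC]
      have h3 : e ((i k : ℂ) / ℓ * τ) = e ((ordInfty v : ℂ) / ℓ * τ) * e τ ^ k := by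
        rw [← e_nat_mul, ← e_add]
        congr 1
        simp only [i]
        push_cast
        field_simp
      rw [h2, h3]
      ring
    · intro n hn
      simp only [m]
      rw [Function.extend_apply' _ _ _ hn]
      simp

theorem mem_UPlus_of_eq (hodd : ℓ ≠ 2) {v : Cl ℓ → ℤ} (hv : ∑ x, v x = 0) {c : ℂˣ}
    (hc : (c : ℂ) ∈ cycField ℓ) : constUnit c * EP v ∈ UPlus ℓ := by
  refine mem_UPlus hp.out.pos (mul_mem (constUnit_mem c) (EP_mem_cuspUnits hodd hv))
    (fun γ hγ => ?_) ?_
  · obtain ⟨L, hL⟩ := EP_ordAt_not_Gamma0 hv hγ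
    have := (ordAt_const (ℓ := ℓ) c.ne_zero).mul hL
    rw [zero_add] at this
    exact ⟨_, this⟩
  · obtain ⟨a, ha, hm⟩ := EP_fourier hodd hv c
    refine ⟨a, ha, fun n => ?_⟩
    obtain ⟨m, hm⟩ := hm n
    rw [hm]
    exact mul_mem hc (intCast_mem _ m)

/-- The expansion of `EP v` has leading coefficient 1, so c is the leading Fourier coefficient of
the product. -/
theorem const_mem_cycField (hodd : ℓ ≠ 2) {v : Cl ℓ → ℤ} (hv : ∑ x, v x = 0) {c : ℂˣ}
    (h : constUnit c * EP v ∈ UPlus ℓ) : (c : ℂ) ∈ cycField ℓ := by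
  obtain ⟨a, ha, hm⟩ := h.1.coeff_mem
  obtain ⟨n, hn⟩ := ha.exists_ordAt hp.out.pos ⟨I, h.1.ne_zero _⟩
  have h2 := (ordAt_const (ℓ := ℓ) c.ne_zero).mul (EP_ordAt_infty hodd hv)
  obtain ⟨-, h3⟩ := h2.unique hp.out.pos hn
  rw [mul_one] at h3
  rw [h3]
  exact hm n

end

/-! ### The operator g − 1 on the group ring and the group U_ℓ^R -/

section

section shiftDiff

variable {G : Type*} [CommGroup G]

/-- The difference operator `w ↦ w(· g⁻¹) - w`. -/
def shiftDiff (g : G) : (G → ℤ) →ₗ[ℤ] (G → ℤ) where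
  toFun w y := w (y * g⁻¹) - w y
  map_add' v w := by
    ext y
    simp only [Pi.add_apply]
    ring
  map_smul' n w := by
    ext y
    simp only [Pi.smul_apply, smul_eq_mul, RingHom.id_apply]
    ring

theorem shiftDiff_apply (g : G) (w : G → ℤ) (y : G) : shiftDiff g w y = w (y * g⁻¹) - w y := rfl

theorem shiftDiff_single [DecidableEq G] (g x : G) :
    shiftDiff g (Pi.single x 1) = Pi.single (x * g) 1 - Pi.single x 1 := by
  ext y
  rw [shiftDiff_apply, Pi.sub_apply]
  congr 1
  simp only [Pi.single_apply, mul_inv_eq_iff_eq_mul]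

theorem sum_shiftDiff [Fintype G] (g : G) (w : G → ℤ) : ∑ y, shiftDiff g w y = 0 := by
  simp only [shiftDiff_apply, Finset.sum_sub_distrib]
  rw [sub_eq_zero]
  exact Fintype.sum_equiv (Equiv.mulRight g⁻¹) _ _ fun _ => rfl

/-- The kernel of `shiftDiff g` consists of the functions on the quotient by `g`. -/
def kerShiftDiffEquiv (g : G) :
    (LinearMap.ker (shiftDiff g)) ≃ₗ[ℤ] (G ⧸ Subgroup.zpowers g → ℤ) where
  toFun w q := q.liftOn' w.1 (by
    intro a b hab
    rw [QuotientGroup.leftRel_apply, Subgroup.mem_zpowers_iff] at hab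
    obtain ⟨n, hn⟩ := hab
    have hw (y : G) : w.1 (y * g) = w.1 y := by
      have := congrFun (LinearMap.mem_ker.mp w.2) (y * g)
      rw [shiftDiff_apply, mul_inv_cancel_right, Pi.zero_apply, sub_eq_zero] at this
      exact this.symm
    have key (n : ℤ) : ∀ y, w.1 (y * g ^ n) = w.1 y := by
      induction n with
      | zero => simp
      | succ n ih => intro y; rw [zpow_add_one, ← mul_assoc, hw, ih]
      | pred n ih =>
        intro y
        rw [zpow_sub_one, ← mul_assoc, ← hw, inv_mul_cancel_right, ih]
    rw [eq_inv_mul_iff_mul_eq] at hn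
    rw [← hn]
    exact (key n a).symm)
  map_add' v w := by
    ext q
    induction q using QuotientGroup.induction_on
    rfl
  map_smul' n w := by
    ext q
    induction q using QuotientGroup.induction_on
    rfl
  invFun w := ⟨fun x => w x, by
    rw [LinearMap.mem_ker]
    ext y
    rw [shiftDiff_apply, Pi.zero_apply, sub_eq_zero]
    congr 1
    rw [QuotientGroup.eq]
    simp⟩
  left_inv w := rfl
  right_inv w := by
    ext q
    induction q using QuotientGroup.induction_on
    rfl

/-- Rank–nullity, the kernel having as rank the index of the subgroup generated by g. -/
theorem finrank_range_shiftDiff [Fintype G] (g : G) :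
    (Module.finrank ℤ (LinearMap.range (shiftDiff g)) : ℚ) =
      Fintype.card G - Fintype.card G / orderOf g := by
  classical
  have h1 := Submodule.finrank_quotient_add_finrank (LinearMap.ker (shiftDiff g))
  rw [(shiftDiff g).quotKerEquivRange.finrank_eq] at h1
  rw [(kerShiftDiffEquiv g).finrank_eq, Module.finrank_fintype_fun_eq_card,
    Module.finrank_fintype_fun_eq_card, ← Nat.card_eq_fintype_card, ← Subgroup.index] at h1
  have h3 := (Subgroup.zpowers g).card_mul_index
  rw [Nat.card_zpowers, Nat.card_eq_fintype_card] at h3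
  have h4 : (orderOf g : ℚ) ≠ 0 := by exact_mod_cast (orderOf_pos g).ne'
  have h5 : (orderOf g : ℚ) * (Subgroup.zpowers g).index = Fintype.card G := by exact_mod_cast h3
  have h6 : (Fintype.card G : ℚ) / orderOf g = (Subgroup.zpowers g).index := by
    rw [div_eq_iff h4, ← h5, mul_comm]
  rw [h6, eq_sub_iff_add_eq]
  exact_mod_cast h1

/-- For a generator g, the augmentation ideal is generated by g − 1: each [gⁿ] − [1] telescopes into
translates of [g] − [1]. -/
theorem mem_range_shiftDiff [Fintype G] {g : G} (hg : Subgroup.zpowers g = ⊤) {v : G → ℤ}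
    (hv : ∑ x, v x = 0) : v ∈ LinearMap.range (shiftDiff g) := by
  classical
  have h1 (n : ℤ) : ∀ y : G, (Pi.single (y * g ^ n) 1 - Pi.single y 1 : G → ℤ) ∈
      LinearMap.range (shiftDiff g) := by
    have h0 (y : G) : (Pi.single (y * g) 1 - Pi.single y 1 : G → ℤ) ∈
      LinearMap.range (shiftDiff g) := ⟨_, shiftDiff_single g y⟩
    induction n with
    | zero => simp
    | succ n ih =>
      intro y
      have := add_mem (h0 (y * g ^ (n : ℤ))) (ih y)
      rwa [sub_add_sub_cancel, mul_assoc, ← zpow_add_one] at this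
    | pred n ih =>
      intro y
      have := sub_mem (ih y) (h0 (y * g ^ (-(n : ℤ) - 1)))
      rw [mul_assoc, ← zpow_add_one, sub_add_cancel] at this
      simpa using this
  have h2 : v = ∑ x, v x • (Pi.single x 1 - Pi.single 1 1 : G → ℤ) := by
    ext y
    simp only [smul_sub, Finset.sum_sub_distrib, Pi.sub_apply, Finset.sum_apply, Pi.smul_apply,
      smul_eq_mul, ← Finset.sum_mul, hv, zero_mul, sub_zero]
    simp [Pi.single_apply]
  rw [h2]
  refine sum_mem fun x _ => Submodule.smul_mem _ _ ?_
  have hx : x ∈ Subgroup.zpowers g := by rw [hg]; trivial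
  obtain ⟨n, rfl⟩ := Subgroup.mem_zpowers_iff.mp hx
  simpa using h1 n 1

end shiftDiff

variable {ℓ : ℕ} [hp : Fact ℓ.Prime]

/-- The class of a natural number prime to `ℓ`. -/
def cls (j : ℕ) : Cl ℓ :=
  if h : (j : ZMod ℓ) ≠ 0 then ((Units.mk0 _ h : (ZMod ℓ)ˣ) : Cl ℓ) else 1

theorem isClass_cls {j : ℕ} (h0 : 0 < j) (h : j < ℓ) : IsClass (cls j : Cl ℓ) j := by
  have hj : (j : ZMod ℓ) ≠ 0 := by
    rw [Ne, ZMod.natCast_eq_zero_iff]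
    exact fun hd => absurd (Nat.le_of_dvd h0 hd) (by omega)
  rw [cls, dif_pos hj]
  exact ⟨_, by simp, rfl⟩

theorem isClass_twoClass (h : Odd ℓ) : IsClass (twoClass ℓ h) 2 :=
  ⟨_, by simp, rfl⟩

theorem cls_two_mul (hodd : Odd ℓ) {j : ℕ} (h0 : 0 < j) (h : 2 * j < ℓ) :
    (cls (2 * j) : Cl ℓ) = cls j * twoClass ℓ hodd := by
  refine (isClass_cls (by omega) h).unique ?_
  have := (isClass_cls (ℓ := ℓ) h0 (by omega)).mul (isClass_twoClass hodd)
  rwa [mul_comm (j : ℤ) 2, ← Nat.cast_two, ← Nat.cast_mul] at this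

/-- `EP` as an additive homomorphism. -/
def EPHom : (Cl ℓ → ℤ) →+ Additive (ℍ → ℂ)ˣ where
  toFun v := .ofMul (EP v)
  map_zero' := by rw [EP_zero, ofMul_one]
  map_add' v w := by rw [EP_add, ofMul_mul]

theorem EPHom_apply (v : Cl ℓ → ℤ) : EPHom v = .ofMul (EP v) := rfl

/-- The numerator index 2j has the class of j times that of 2, so each quotient is `EP` of [g·x] −
[x] with x the class of j and g the class of 2. -/
theorem sUnit_eq_EP (hodd : Odd ℓ) {m : ℕ} (h : 2 * m < ℓ) :
    sUnit ℓ m h = EP (shiftDiff (twoClass ℓ hodd) (∑ j ∈ Finset.Icc 1 m, Pi.single (cls j) 1)) := by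
  classical
  refine Additive.ofMul.injective ?_
  rw [← EPHom_apply, map_sum, map_sum]
  have h1 (j : ℕ) : EPHom (shiftDiff (twoClass ℓ hodd) (Pi.single (cls j : Cl ℓ) 1)) =
      .ofMul (EU (cls j * twoClass ℓ hodd) / EU (cls j : Cl ℓ)) := by
    rw [shiftDiff_single, map_sub, EPHom_apply, EPHom_apply, EP_single, EP_single, ofMul_div]
  simp only [h1]
  rw [← ofMul_prod (Finset.Icc 1 m) fun j => EU (cls j * twoClass ℓ hodd) / EU (cls j : Cl ℓ)]
  refine congrArg Additive.ofMul (unit_ext fun τ => ?_)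
  rw [unit_prod_apply, show (sUnit ℓ m h : ℍ → ℂ) τ = s ℓ m τ from rfl, s]
  refine Finset.prod_congr rfl fun j hj => ?_
  rw [Finset.mem_Icc] at hj
  have h2 := isClass_cls (ℓ := ℓ) (show 0 < 2 * j by omega) (by omega)
  rw [cls_two_mul hodd (by omega) (by omega)] at h2
  have h3 := siegel_eq_EC (by omega) (by omega) h2 τ
  have h4 := siegel_eq_EC (by omega) (by omega)
    (isClass_cls (ℓ := ℓ) (j := j) (by omega) (by omega)) τ
  push_cast at h3
  rw [h3, h4, div_eq_mul_inv, div_eq_mul_inv (EU _), Units.val_mul, Pi.mul_apply, unit_inv_apply]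
  rfl

section prime

variable {k : ℕ} [hpk : Fact (2 * k + 1).Prime]

theorem exists_unique_cls (x : Cl (2 * k + 1)) : ∃! j, j ∈ Finset.Icc 1 k ∧ cls j = x := by
  have h1 := repr_lt x
  have h2 := repr_pos x
  have hu : ∀ i ∈ Finset.Icc 1 k, ∀ j ∈ Finset.Icc 1 k,
      (cls i : Cl (2 * k + 1)) = cls j → i = j := by
    intro i hi j hj hij
    rw [Finset.mem_Icc] at hi hj
    have hi' := isClass_cls (ℓ := 2 * k + 1) (j := i) (by omega) (by omega)
    have hj' := isClass_cls (ℓ := 2 * k + 1) (j := j) (by omega) (by omega)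
    rw [hij] at hi'
    obtain ⟨u, hu, hu'⟩ := hi'
    obtain ⟨w, hw, hw'⟩ := hj'
    rw [← hw', cl_eq_iff] at hu'
    have key : ((2 * k + 1 : ℕ) : ℤ) ∣ i - j ∨ ((2 * k + 1 : ℕ) : ℤ) ∣ i + j := by
      rw [← ZMod.intCast_zmod_eq_zero_iff_dvd, ← ZMod.intCast_zmod_eq_zero_iff_dvd]
      rw [Int.cast_sub, Int.cast_add, ← hu, ← hw]
      rcases hu' with rfl | rfl
      · left; simp
      · right; simp
    rcases key with ⟨c, hc⟩ | ⟨c, hc⟩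
    · have : c = 0 := by
        have : c < 1 := by by_contra h; push_cast at hc; nlinarith
        have : -1 < c := by by_contra h; push_cast at hc; nlinarith
        omega
      rw [this] at hc
      omega
    · exfalso
      have : c < 1 := by by_contra h; push_cast at hc; nlinarith
      have : 0 < c := by by_contra h; push_cast at hc; nlinarith
      omega
  have hex : ∃ j, j ∈ Finset.Icc 1 k ∧ cls j = x := by
    by_cases h : repr x ≤ k
    · exact ⟨repr x, Finset.mem_Icc.mpr ⟨h2, h⟩, (isClass_cls h2 h1).unique (isClass_repr x)⟩
    · refine ⟨2 * k + 1 - repr x, Finset.mem_Icc.mpr ⟨by omega, by omega⟩,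
        (isClass_cls (by omega) (by omega)).unique ?_⟩
      rw [isClass_iff]
      right
      exact ⟨1, by push_cast [Nat.cast_sub h1.le]; ring⟩
  obtain ⟨j, hj⟩ := hex
  exact ⟨j, hj, fun i hi => hu i hi.1 j hj.1 (hi.2.trans hj.2.symm)⟩

theorem card_Cl : Fintype.card (Cl (2 * k + 1)) = k := by
  have : (Finset.Icc 1 k).card = (Finset.univ : Finset (Cl (2 * k + 1))).card := by
    refine Finset.card_bij (fun j _ => cls j) (fun _ _ => Finset.mem_univ _) ?_ ?_
    · intro i hi j hj hij
      exact (exists_unique_cls (cls j)).unique ⟨hi, hij⟩ ⟨hj, rfl⟩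
    · intro x _
      obtain ⟨j, hj, -⟩ := exists_unique_cls x
      exact ⟨j, hj.1, hj.2⟩
  rw [Finset.card_univ, Nat.card_Icc] at this
  omega

theorem sum_single_cls :
    ∑ j ∈ Finset.Icc 1 k, (Pi.single (cls j) 1 : Cl (2 * k + 1) → ℤ) = fun _ => 1 := by
  classical
  ext x
  obtain ⟨j, hj, hu⟩ := exists_unique_cls x
  rw [Finset.sum_apply, Finset.sum_eq_single j]
  · simp [hj.2]
  · intro i hi hij
    rw [Pi.single_apply, if_neg]
    exact fun h => hij (hu i ⟨hi, h.symm⟩)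
  · exact fun h => absurd hj.1 h

/-- Successive quotients of the s_{ℓ,m} are the images of the single classes under g − 1, and 1, …,
k represent all classes once. Hence the generators give the whole image. -/
theorem mem_UR_iff (hk : 2 ≤ k) (hodd : Odd (2 * k + 1)) {f : (ℍ → ℂ)ˣ} :
    f ∈ UR k ↔ ∃ v ∈ LinearMap.range (shiftDiff (twoClass (2 * k + 1) hodd)), f = EP v := by
  classical
  set D := shiftDiff (twoClass (2 * k + 1) hodd) with hD
  constructor
  · intro hf
    let S : Subgroup (ℍ → ℂ)ˣ :=
      AddSubgroup.toSubgroup' ((LinearMap.range D).toAddSubgroup.map EPHom)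
    have hS {g : (ℍ → ℂ)ˣ} : g ∈ S ↔ ∃ v ∈ LinearMap.range D, EP v = g := Iff.rfl
    have h1 : UR k ≤ S := by
      rw [UR, Subgroup.closure_le]
      rintro g ⟨m, hm1, hm2, rfl⟩
      exact hS.mpr ⟨_, ⟨_, rfl⟩, (sUnit_eq_EP hodd _).symm⟩
    obtain ⟨v, hv, rfl⟩ := hS.mp (h1 hf)
    exact ⟨v, hv, rfl⟩
  · rintro ⟨_, ⟨w, rfl⟩, rfl⟩
    have h0 (m : ℕ) (hm : m ≤ k) :
        EP (D (∑ j ∈ Finset.Icc 1 m, Pi.single (cls j) 1)) ∈ UR k := by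
      rcases Nat.eq_zero_or_pos m with rfl | hm0
      · simp [EP_zero, one_mem]
      · rcases hm.lt_or_eq with h | rfl
        · rw [hD, ← sUnit_eq_EP hodd (by omega)]
          exact Subgroup.subset_closure ⟨m, hm0, by omega, rfl⟩
        -- The index m = k is not among the generators, but the sum of all classes is translation
        -- invariant, so its image is trivial.
        · have : D (fun _ => 1) = 0 := by
            ext y
            simp [hD, shiftDiff_apply]
          rw [sum_single_cls, this, EP_zero]
          exact one_mem _
    have h1 (x : Cl (2 * k + 1)) : EP (D (Pi.single x 1)) ∈ UR k := by
      obtain ⟨j, ⟨hj, rfl⟩, -⟩ := exists_unique_cls x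
      rw [Finset.mem_Icc] at hj
      obtain ⟨i, rfl⟩ := Nat.exists_eq_add_of_le' hj.1
      have h2 := h0 (i + 1) hj.2
      rw [Finset.sum_Icc_succ_top (by omega), map_add, EP_add] at h2
      exact (Subgroup.mul_mem_cancel_left _ (h0 i (by omega))).mp h2
    have h2 : w = ∑ x, w x • (Pi.single x 1 : Cl (2 * k + 1) → ℤ) := by
      ext y
      simp [Finset.sum_apply, Pi.single_apply]
    have h3 : EP (D w) = ∏ x, EP (D (Pi.single x 1)) ^ w x := by
      refine Additive.ofMul.injective ?_
      rw [← EPHom_apply]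
      conv_lhs => rw [h2]
      rw [map_sum, map_sum, ofMul_prod]
      refine Finset.sum_congr rfl fun x _ => ?_
      rw [map_zsmul, map_zsmul, EPHom_apply, ofMul_zpow]
    rw [h3]
    exact prod_mem fun x _ => zpow_mem (h1 x) _

theorem sum_of_mem_range {hodd : Odd (2 * k + 1)} {v : Cl (2 * k + 1) → ℤ}
    (hv : v ∈ LinearMap.range (shiftDiff (twoClass (2 * k + 1) hodd))) : ∑ x, v x = 0 := by
  obtain ⟨w, rfl⟩ := hv
  exact sum_shiftDiff _ _

theorem UR_subset_UPlus (hk : 2 ≤ k) : (UR k : Set (ℍ → ℂ)ˣ) ⊆ UPlus (2 * k + 1) := by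
  intro f hf
  obtain ⟨v, hv, rfl⟩ := (mem_UR_iff hk ⟨k, rfl⟩).mp hf
  have := mem_UPlus_of_eq (by omega) (sum_of_mem_range hv) (c := 1) (one_mem _)
  rwa [map_one, one_mul] at this

theorem finrank_UR (hk : 2 ≤ k) (hodd : Odd (2 * k + 1)) :
    (Module.finrank ℤ (Additive (UR k)) : ℚ) = k - k / orderOf (twoClass (2 * k + 1) hodd) := by
  set D := shiftDiff (twoClass (2 * k + 1) hodd) with hD
  let φ : LinearMap.range D →+ Additive (UR k) :=
    { toFun := fun v => .ofMul ⟨EP v.1, (mem_UR_iff hk hodd).mpr ⟨v.1, v.2, rfl⟩⟩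
      map_zero' := by
        refine congrArg Additive.ofMul (Subtype.ext ?_)
        exact EP_zero
      map_add' := fun v w => by
        refine congrArg Additive.ofMul (Subtype.ext ?_)
        exact EP_add _ _ }
  have hφ : Function.Bijective φ := by
    constructor
    · intro v w h
      have h1 : EP v.1 = EP w.1 := congrArg Subtype.val (Additive.ofMul.injective h)
      exact Subtype.ext (EP_injective (by omega)
        ((sum_of_mem_range v.2).trans (sum_of_mem_range w.2).symm) h1)
    · intro f
      obtain ⟨v, hv, h⟩ := (mem_UR_iff hk hodd).mp (Additive.toMul f).2
      exact ⟨⟨v, hv⟩, congrArg Additive.ofMul (Subtype.ext h.symm)⟩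
  rw [← (AddEquiv.ofBijective φ hφ).toIntLinearEquiv.finrank_eq, finrank_range_shiftDiff, card_Cl]

theorem mem_constants {ℓ : ℕ} {f : (ℍ → ℂ)ˣ} :
    f ∈ constants ℓ ↔ ∃ c : ℂˣ, (c : ℂ) ∈ cycField ℓ ∧ f = constUnit c := by
  constructor
  · rintro ⟨u, rfl⟩
    refine ⟨Units.map ((algebraMap (cycField ℓ) ℂ : cycField ℓ →+* ℂ) : cycField ℓ →* ℂ) u,
      (u : cycField ℓ).2, ?_⟩
    exact unit_ext fun τ => rfl
  · rintro ⟨c, hc, rfl⟩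
    have h0 : (⟨c, hc⟩ : cycField ℓ) ≠ 0 := fun h => c.ne_zero (congrArg Subtype.val h)
    exact ⟨Units.mk0 _ h0, unit_ext fun τ => rfl⟩

theorem disjoint_UR_constants (hk : 2 ≤ k) : Disjoint (UR k) (constants (2 * k + 1)) := by
  rw [Subgroup.disjoint_def]
  intro f hf hc
  obtain ⟨v, hv, rfl⟩ := (mem_UR_iff hk ⟨k, rfl⟩).mp hf
  obtain ⟨c, -, h⟩ := mem_constants.mp hc
  rw [eq_zero_of_EP_const (by omega) (sum_of_mem_range hv) h, EP_zero]

theorem sup_constants_eq (hk : 2 ≤ k) (hodd : Odd (2 * k + 1))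
    (htop : Subgroup.zpowers (twoClass (2 * k + 1) hodd) = ⊤)
    (hmain : ∀ f ∈ UPlus (2 * k + 1), ∃ (c : ℂˣ) (v : Cl (2 * k + 1) → ℤ),
      ∑ x, v x = 0 ∧ f = constUnit c * EP v) :
    ((UR k ⊔ constants (2 * k + 1) : Subgroup (ℍ → ℂ)ˣ) : Set (ℍ → ℂ)ˣ) = UPlus (2 * k + 1) := by
  ext f
  rw [SetLike.mem_coe, Subgroup.mem_sup]
  constructor
  · rintro ⟨g, hg, h, hh, rfl⟩
    obtain ⟨v, hv, rfl⟩ := (mem_UR_iff hk hodd).mp hg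
    obtain ⟨c, hc, rfl⟩ := mem_constants.mp hh
    exact mul_comm (constUnit c) (EP v) ▸ mem_UPlus_of_eq (by omega) (sum_of_mem_range hv) hc
  · intro hf
    obtain ⟨c, v, hv, rfl⟩ := hmain f hf
    exact ⟨EP v, (mem_UR_iff hk hodd).mpr ⟨v, mem_range_shiftDiff htop hv, rfl⟩, constUnit c,
      mem_constants.mpr ⟨c, const_mem_cycField (by omega) hv hf, rfl⟩, mul_comm _ _⟩

end prime

end

/-! ### Some power of each unit in U_ℓ^+ is a Siegel product -/

section

/-- Degree-zero vectors and constant vectors together have full rank. Combining W on the former with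
the inclusion of the latter gives an injective endomorphism of ℤ^G, and the adjugate solves the
equation after multiplication by the determinant. -/
theorem exists_integral_preimage {G : Type*} [Fintype G] [Nonempty G]
    (W : (G → ℤ) →ₗ[ℤ] (G → ℤ))
    (H : ∀ v s, ∑ x, v x = 0 → (∀ A, W v A = s) → v = 0) (n : G → ℤ) :
    ∃ N : ℕ, 0 < N ∧ ∃ (v : G → ℤ) (s : ℤ), ∑ x, v x = 0 ∧ ∀ A, W v A + s = N * n A := by
  classical
  let σ : (G → ℤ) →ₗ[ℤ] ℤ := ∑ x, LinearMap.proj x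
  have hσ (e : G → ℤ) : σ e = ∑ x, e x := by simp [σ]
  let one : ℤ →ₗ[ℤ] (G → ℤ) := LinearMap.pi fun _ => LinearMap.id
  have hone (s : ℤ) (x : G) : one s x = s := rfl
  -- The projection onto degree-zero vectors, scaled by |G| to stay integral.
  let P : (G → ℤ) →ₗ[ℤ] (G → ℤ) := (Fintype.card G : ℤ) • LinearMap.id - one ∘ₗ σ
  have hP (e : G → ℤ) (x : G) : P e x = Fintype.card G * e x - ∑ x, e x := by
    simp [P, hone, hσ]
  have hPσ (e : G → ℤ) : ∑ x, P e x = 0 := by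
    simp only [hP, Finset.sum_sub_distrib, ← Finset.mul_sum]
    simp
  let Ψ := W ∘ₗ P + one ∘ₗ σ
  have hΨ (e : G → ℤ) (A : G) : Ψ e A = W (P e) A + ∑ x, e x := by
    simp [Ψ, hone, hσ]
  have hdet : (LinearMap.toMatrix' Ψ).det ≠ 0 := by
    rw [Ne, ← Matrix.exists_mulVec_eq_zero_iff]
    rintro ⟨e, he0, he⟩
    rw [LinearMap.toMatrix'_mulVec] at he
    apply he0
    have h1 (A : G) : W (P e) A = -∑ x, e x := by
      have := congrFun he A
      rw [hΨ, Pi.zero_apply] at this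
      linarith
    have h2 := H _ _ (hPσ e) h1
    have h3 : ∑ x, e x = 0 := by
      have := h1 (Classical.arbitrary G)
      rw [h2, map_zero, Pi.zero_apply] at this
      linarith
    ext x
    have := congrFun h2 x
    rw [hP, h3, sub_zero, Pi.zero_apply, mul_eq_zero] at this
    refine this.resolve_left ?_
    exact_mod_cast Fintype.card_ne_zero
  set D := (LinearMap.toMatrix' Ψ).det with hD
  -- The sign replaces the determinant by its absolute value, giving a positive N.
  let e : G → ℤ := D.sign • ((LinearMap.toMatrix' Ψ).adjugate.mulVec n)
  have he : Ψ e = (D.natAbs : ℤ) • n := by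
    rw [← LinearMap.toMatrix'_mulVec, Matrix.mulVec_smul, Matrix.mulVec_mulVec,
      Matrix.mul_adjugate, Matrix.smul_mulVec, Matrix.one_mulVec, smul_smul, ← hD,
      Int.sign_mul_self_eq_natAbs]
  refine ⟨D.natAbs, Int.natAbs_pos.mpr hdet, P e, ∑ x, e x, hPσ e, fun A => ?_⟩
  rw [← hΨ, he, Pi.smul_apply, smul_eq_mul]

variable {ℓ : ℕ}

theorem OrdAt.zpow_unit {f : (ℍ → ℂ)ˣ} {γ : SL(2, ℤ)} {n : ℤ} {L : ℂ}
    (h : OrdAt ℓ (fun τ => (f : ℍ → ℂ) (γ • τ)) n L) (N : ℕ) :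
    OrdAt ℓ (fun τ => ((f ^ N : (ℍ → ℂ)ˣ) : ℍ → ℂ) (γ • τ)) (N * n) (L ^ N) := by
  induction N with
  | zero => simpa using ordAt_const (ℓ := ℓ) one_ne_zero
  | succ N ih =>
    rw [pow_succ L]
    have h1 := ih.mul h
    rw [show ((N + 1 : ℕ) : ℤ) * n = N * n + n by push_cast; ring]
    refine h1.congr fun τ => ?_
    rw [pow_succ f, Units.val_mul, Pi.mul_apply]

theorem OrdAt.mul_unit {f g : (ℍ → ℂ)ˣ} {γ : SL(2, ℤ)} {n n' : ℤ} {L L' : ℂ}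
    (h : OrdAt ℓ (fun τ => (f : ℍ → ℂ) (γ • τ)) n L)
    (h' : OrdAt ℓ (fun τ => (g : ℍ → ℂ) (γ • τ)) n' L') :
    OrdAt ℓ (fun τ => ((f * g : (ℍ → ℂ)ˣ) : ℍ → ℂ) (γ • τ)) (n + n') (L * L') :=
  (h.mul h').congr fun _ => rfl

theorem OrdAt.inv_unit {f : (ℍ → ℂ)ˣ} {γ : SL(2, ℤ)} {n : ℤ} {L : ℂ}
    (h : OrdAt ℓ (fun τ => (f : ℍ → ℂ) (γ • τ)) n L) :
    OrdAt ℓ (fun τ => ((f⁻¹ : (ℍ → ℂ)ˣ) : ℍ → ℂ) (γ • τ)) (-n) L⁻¹ :=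
  h.inv.congr fun _ => (unit_inv_apply f _).symm

theorem OrdAt.comp_T {f : ℍ → ℂ} {n : ℤ} {L : ℂ} (h : OrdAt ℓ f n L) (m : ℤ) :
    OrdAt ℓ (fun τ => f (ModularGroup.T ^ m • τ)) n (L * e ((n : ℂ) / ℓ * m)) := by
  refine ⟨mul_ne_zero h.1 (e_ne_zero _), ?_⟩
  have h1 : Tendsto (fun τ : ℍ => ModularGroup.T ^ m • τ) atImInfty atImInfty := by
    rw [atImInfty, tendsto_comap_iff]
    refine tendsto_comap.congr fun τ => ?_
    rw [Function.comp_apply, T_zpow_smul, vadd_im]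
  refine ((h.2.comp h1).mul_const _).congr fun τ => ?_
  simp only [Function.comp_apply]
  rw [mul_assoc, ← e_add, T_zpow_smul, coe_vadd]
  congr 2
  push_cast
  ring

variable [hp : Fact ℓ.Prime]

theorem mul_00 (γ δ : SL(2, ℤ)) : (γ * δ) 0 0 = γ 0 0 * δ 0 0 + γ 0 1 * δ 1 0 := by
  simp [Matrix.mul_apply, Fin.sum_univ_two]

theorem IsClass.congr {x : Cl ℓ} {i j : ℤ} (h : IsClass x i) (hij : (ℓ : ℤ) ∣ j - i) :
    IsClass x j := by
  obtain ⟨u, hu, rfl⟩ := h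
  exact ⟨u, by rw [hu, ZMod.intCast_eq_intCast_iff_dvd_sub]; exact hij, rfl⟩

theorem IsClass.mul_Gamma0 {γ δ : SL(2, ℤ)} (hδ : δ ∈ Gamma0 ℓ) {A B : Cl ℓ}
    (hA : IsClass A (γ 0 0)) (hB : IsClass B (δ 0 0)) : IsClass (A * B) ((γ * δ) 0 0) := by
  refine (hA.mul hB).congr ?_
  rw [mul_00, add_sub_cancel_left]
  exact (mem_Gamma0_iff.mp hδ).mul_left _

theorem isClass_one : IsClass (1 : Cl ℓ) 1 := ⟨1, by simp, rfl⟩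

theorem IsClass.inv_Gamma0 {γ : SL(2, ℤ)} (hγ : γ ∈ Gamma0 ℓ) {A : Cl ℓ}
    (hA : IsClass A (γ 0 0)) : IsClass A⁻¹ (γ⁻¹ 0 0) := by
  obtain ⟨B, hB⟩ := isClass_of_mem_Gamma0 (inv_mem hγ)
  have h1 := hA.mul_Gamma0 (inv_mem hγ) hB
  rw [mul_inv_cancel] at h1
  have h2 : A * B = 1 := h1.unique isClass_one
  rwa [inv_eq_of_mul_eq_one_right h2]

theorem exists_Gamma0 (A : Cl ℓ) : ∃ γ ∈ Gamma0 ℓ, IsClass A (γ 0 0) := by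
  have h : IsCoprime (repr A : ℤ) ℓ := by
    refine IsCoprime.symm ?_
    exact (Nat.prime_iff_prime_int.mp hp.out).coprime_iff_not_dvd.mpr (isClass_repr A).not_dvd
  obtain ⟨u, v, h⟩ := h
  let γ : SL(2, ℤ) := ⟨!![(repr A : ℤ), -v; ℓ, u], by rw [Matrix.det_fin_two_of]; linarith⟩
  exact ⟨γ, mem_Gamma0_iff.mpr dvd_rfl, isClass_repr A⟩

/-- The class being trivial, η or −η is unipotent upper triangular modulo ℓ, and a power of T clears
its upper right entry. The sign does not affect the action on ℍ. -/
theorem exists_Gamma_mul_T {η : SL(2, ℤ)} (hη : η ∈ Gamma0 ℓ) (h1 : IsClass (1 : Cl ℓ) (η 0 0)) :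
    ∃ m : ℤ, ∃ δ ∈ Gamma ℓ, ∀ τ : ℍ, η • τ = δ • ModularGroup.T ^ m • τ := by
  have key : ∀ η : SL(2, ℤ), η ∈ Gamma0 ℓ → ((η 0 0 : ℤ) : ZMod ℓ) = 1 →
      η * ModularGroup.T ^ (-η 0 1) ∈ Gamma ℓ := by
    intro η hη h
    have hdet : ((η 0 0 * η 1 1 - η 0 1 * η 1 0 : ℤ) : ZMod ℓ) = 1 := by rw [det_eq_one η]; simp
    rw [Gamma0_mem] at hη
    push_cast [h, hη] at hdet
    rw [one_mul, mul_zero, sub_zero] at hdet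
    rw [Gamma_mem]
    simp [Matrix.mul_apply, Fin.sum_univ_two, ModularGroup.coe_T_zpow, h, hη, hdet]
  obtain ⟨u, hu, hu'⟩ := h1
  rw [← QuotientGroup.mk_one, eq_comm, cl_eq_iff] at hu'
  rcases hu' with rfl | rfl
  · refine ⟨η 0 1, _, key η hη (by rw [← hu]; simp), fun τ => ?_⟩
    rw [smul_smul, mul_assoc, ← zpow_add, neg_add_cancel, zpow_zero, mul_one]
  · have h2 : -η ∈ Gamma0 ℓ := by
      rw [mem_Gamma0_iff] at hη ⊢
      simpa using hη
    refine ⟨(-η) 0 1, _, key (-η) h2 (by simp [← hu]), fun τ => ?_⟩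
    rw [smul_smul, mul_assoc, ← zpow_add, neg_add_cancel, zpow_zero, mul_one,
      ModularGroup.SL_neg_smul]

/-- By `exists_Gamma_mul_T`, γ and γ′ act alike up to Γ(ℓ) and a translation, which changes only the
leading coefficient. So the orders above ∞ form a function on `Cl ℓ`. -/
theorem IsCuspUnit.ordAt_of_class {f : (ℍ → ℂ)ˣ} (hf : IsCuspUnit ℓ f) {γ γ' : SL(2, ℤ)}
    (hγ : γ ∈ Gamma0 ℓ) (hγ' : γ' ∈ Gamma0 ℓ) {A : Cl ℓ} (hA : IsClass A (γ 0 0))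
    (hA' : IsClass A (γ' 0 0)) {n : ℤ} {L : ℂ}
    (h : OrdAt ℓ (fun τ => (f : ℍ → ℂ) (γ • τ)) n L) :
    ∃ L', OrdAt ℓ (fun τ => (f : ℍ → ℂ) (γ' • τ)) n L' := by
  have h1 := (hA.inv_Gamma0 hγ).mul_Gamma0 hγ' hA'
  rw [inv_mul_cancel] at h1
  obtain ⟨m, δ, hδ, hm⟩ := exists_Gamma_mul_T (mul_mem (inv_mem hγ) hγ') h1
  refine ⟨_, (h.comp_T m).congr fun τ => ?_⟩
  rw [← smul_invariant hf.invariant γ δ hδ, ← hm, smul_smul, mul_inv_cancel_left]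

/-- A unit whose orders over `∞` are all equal, and which has order `0` elsewhere, is constant. -/
theorem const_of_orders_eq {f : (ℍ → ℂ)ˣ} (hf : f ∈ cuspUnits ℓ) {s : ℤ}
    (h0 : ∀ γ : SL(2, ℤ), γ ∉ Gamma0 ℓ → ∃ L, OrdAt ℓ (fun τ => (f : ℍ → ℂ) (γ • τ)) 0 L)
    (h1 : ∀ γ : SL(2, ℤ), γ ∈ Gamma0 ℓ → ∃ L, OrdAt ℓ (fun τ => (f : ℍ → ℂ) (γ • τ)) s L) :
    ∃ u, f = constUnit u := by
  have hℓ := hp.out.pos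
  rcases le_total 0 s with hs | hs
  · refine const_of_order_nonneg hℓ hf fun γ n L hn => ?_
    by_cases hγ : γ ∈ Gamma0 ℓ
    · obtain ⟨L', h⟩ := h1 γ hγ
      rw [(hn.unique hℓ h).1]; exact hs
    · obtain ⟨L', h⟩ := h0 γ hγ
      rw [(hn.unique hℓ h).1]
  · obtain ⟨u, hu⟩ := const_of_order_nonneg hℓ (inv_mem hf) fun γ n L hn => by
      by_cases hγ : γ ∈ Gamma0 ℓ
      · obtain ⟨L', h⟩ := h1 γ hγ
        rw [(hn.unique hℓ h.inv_unit).1]; omega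
      · obtain ⟨L', h⟩ := h0 γ hγ
        rw [(hn.unique hℓ h.inv_unit).1, neg_zero]
    exact ⟨u⁻¹, by rw [map_inv, ← hu, inv_inv]⟩

/-- The orders of `EP v` at the cusps over `∞`. -/
def orderMap : (Cl ℓ → ℤ) →ₗ[ℤ] (Cl ℓ → ℤ) where
  toFun v A := ordInfty fun y => v (y * A⁻¹)
  map_add' v w := by
    ext A
    simp [ordInfty, add_mul, Finset.sum_add_distrib]
  map_smul' n v := by
    ext A
    simp [ordInfty, Finset.mul_sum, mul_assoc]

/-- The hypothesis of `exists_integral_preimage` holds because an `EP v` with constant order vector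
is constant, so v = 0. Matching the orders of f^N up to a common shift s leaves a quotient to which
`const_of_orders_eq` applies; the shift need not be shown to vanish. -/
theorem exists_pow_eq (hodd : ℓ ≠ 2) {f : (ℍ → ℂ)ˣ} (hf : f ∈ cuspUnits ℓ)
    (h0 : ∀ γ : SL(2, ℤ), γ ∉ Gamma0 ℓ → ∃ L, OrdAt ℓ (fun τ => (f : ℍ → ℂ) (γ • τ)) 0 L) :
    ∃ N : ℕ, 0 < N ∧ ∃ (c : ℂˣ) (v : Cl ℓ → ℤ), ∑ x, v x = 0 ∧ f ^ N = constUnit c * EP v := by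
  choose γ hγ hγA using fun A : Cl ℓ => exists_Gamma0 A
  choose n L hn using fun A => hf.exists_ordAt (γ A)
  obtain ⟨N, hN, v, s, hv, hs⟩ := exists_integral_preimage (orderMap (ℓ := ℓ)) (fun v s hv hs => by
    obtain ⟨c, hc⟩ := const_of_orders_eq (EP_mem_cuspUnits hodd hv) (s := s)
      (fun γ hγ => EP_ordAt_not_Gamma0 hv hγ) (fun γ hγ => by
        obtain ⟨A, hA⟩ := isClass_of_mem_Gamma0 hγ
        rw [← hs A]
        exact EP_ordAt hodd hv hγ hA)
    exact eq_zero_of_EP_const hodd hv hc) n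
  obtain ⟨c, hc⟩ := const_of_orders_eq (f := f ^ N * (EP v)⁻¹)
    (mul_mem (pow_mem hf N) (inv_mem (EP_mem_cuspUnits hodd hv))) (s := s) (fun γ hγ => by
      obtain ⟨L, hL⟩ := h0 γ hγ
      obtain ⟨L', hL'⟩ := EP_ordAt_not_Gamma0 hv hγ
      have := (hL.zpow_unit N).mul_unit hL'.inv_unit
      rw [mul_zero, neg_zero, add_zero] at this
      exact ⟨_, this⟩) (fun η hη => by
      obtain ⟨A, hA⟩ := isClass_of_mem_Gamma0 hη
      obtain ⟨L, hL⟩ := hf.ordAt_of_class (hγ A) hη (hγA A) hA (hn A)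
      obtain ⟨L', hL'⟩ := EP_ordAt hodd hv hη hA
      have h1 := (hL.zpow_unit N).mul_unit hL'.inv_unit
      have h2 : (N : ℤ) * n A + -(ordInfty fun y => v (y * A⁻¹)) = s := by
        have : orderMap v A = ordInfty fun y => v (y * A⁻¹) := rfl
        rw [← this]
        linarith [hs A]
      rw [h2] at h1
      exact ⟨_, h1⟩)
  exact ⟨N, hN, c, v, hv, by rw [← hc, inv_mul_cancel_right]⟩

end

/-! ### Level-one functions have q-expansions spanned by integral series -/

section

/-- The complex span of the integral power series. -/
def intC : Subalgebra ℂ (PowerSeries ℂ) := Algebra.adjoin ℂ (Set.range toC)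

theorem toC_mem (p : PowerSeries ℤ) : toC p ∈ intC := Algebra.subset_adjoin ⟨p, rfl⟩

theorem C_mem (c : ℂ) : PowerSeries.C c ∈ intC := intC.algebraMap_mem c

theorem X_mem : (PowerSeries.X : PowerSeries ℂ) ∈ intC := by
  have := toC_mem PowerSeries.X
  simpa [toC] using this

/-- `φ` is meromorphic at `∞`, with expansion in powers of `q` in the complex span of the integral
Laurent series. -/
def QInt (φ : ℍ → ℂ) : Prop :=
  ∃ M : ℕ, ∃ p ∈ intC, ∃ F, Rep p F ∧ ∀ τ : ℍ, F (e τ) = φ τ * e (M * τ)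

theorem QInt.mono {φ : ℍ → ℂ} (h : QInt φ) : ∃ M : ℕ, ∀ N : ℕ, M ≤ N →
    ∃ p ∈ intC, ∃ F, Rep p F ∧ ∀ τ : ℍ, F (e τ) = φ τ * e (N * τ) := by
  obtain ⟨M, p, hp, F, hF, hφ⟩ := h
  refine ⟨M, fun N hN => ⟨p * PowerSeries.X ^ (N - M), mul_mem hp (pow_mem X_mem _), _,
    hF.mul (rep_X.pow (N - M)), fun τ => ?_⟩⟩
  rw [hφ, mul_assoc, ← e_nat_mul, ← e_add]
  congr 2
  push_cast [Nat.cast_sub hN]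
  ring

theorem QInt.add {φ ψ : ℍ → ℂ} (h : QInt φ) (h' : QInt ψ) : QInt (φ + ψ) := by
  obtain ⟨M, hM⟩ := h.mono
  obtain ⟨M', hM'⟩ := h'.mono
  obtain ⟨p, hp, F, hF, hφ⟩ := hM (max M M') (le_max_left _ _)
  obtain ⟨p', hp', F', hF', hψ⟩ := hM' (max M M') (le_max_right _ _)
  refine ⟨max M M', p + p', add_mem hp hp', fun z => F z + F' z, hF.add hF', fun τ => ?_⟩
  beta_reduce
  rw [hφ, hψ, Pi.add_apply]
  ring

theorem QInt.mul {φ ψ : ℍ → ℂ} (h : QInt φ) (h' : QInt ψ) : QInt (φ * ψ) := by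
  obtain ⟨M, p, hp, F, hF, hφ⟩ := h
  obtain ⟨M', p', hp', F', hF', hψ⟩ := h'
  refine ⟨M + M', _, mul_mem hp hp', _, hF.mul hF', fun τ => ?_⟩
  rw [hφ, hψ, Pi.mul_apply, Nat.cast_add, add_mul, e_add]
  ring

theorem qInt_const (c : ℂ) : QInt fun _ => c :=
  ⟨0, _, C_mem c, _, rep_C c, fun τ => by simp [e_zero]⟩

theorem QInt.pow {φ : ℍ → ℂ} (h : QInt φ) (n : ℕ) : QInt (φ ^ n) := by
  induction n with
  | zero => exact qInt_const 1
  | succ n ih => rw [pow_succ]; exact ih.mul h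

theorem QInt.sum {ι : Type*} {S : Finset ι} {φ : ι → ℍ → ℂ} (h : ∀ i ∈ S, QInt (φ i)) :
    QInt (∑ i ∈ S, φ i) := by
  classical
  induction S using Finset.induction_on with
  | empty => exact qInt_const 0
  | insert a S ha ih =>
    rw [Finset.sum_insert ha]
    exact (h _ (Finset.mem_insert_self _ _)).add
      (ih fun i hi => h i (Finset.mem_insert_of_mem hi))

/-- The `j`-invariant, without its usual constant factor. -/
def jInv (τ : ℍ) : ℂ := ModularForm.E₄ τ ^ 3 / ModularForm.discriminant τ

theorem jInv_smul (γ : SL(2, ℤ)) (τ : ℍ) : jInv (γ • τ) = jInv τ := by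
  have h1 : ModularForm.E₄ (γ • τ) = denom γ τ ^ (4 : ℤ) * ModularForm.E₄ τ :=
    SlashInvariantForm.slash_action_eqn' (Γ := 𝒮ℒ) ModularForm.E₄ ⟨γ, rfl⟩ τ
  have h2 : CuspForm.discriminant (γ • τ) = denom γ τ ^ (12 : ℤ) * CuspForm.discriminant τ :=
    SlashInvariantForm.slash_action_eqn' (Γ := 𝒮ℒ) CuspForm.discriminant ⟨γ, rfl⟩ τ
  rw [CuspForm.coe_discriminant] at h2
  have h3 : denom γ τ ≠ 0 := denom_ne_zero _ _
  have h4 := ModularForm.discriminant_ne_zero τ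
  rw [jInv, jInv, h1, h2]
  simp only [zpow_ofNat]
  field_simp

theorem mdifferentiable_jInv : MDifferentiable 𝓘(ℂ) 𝓘(ℂ) jInv := by
  have h1 : MDifferentiable 𝓘(ℂ) 𝓘(ℂ) (ModularForm.E₄ : ℍ → ℂ) := ModularForm.E₄.holo'
  have h2 : MDifferentiable 𝓘(ℂ) 𝓘(ℂ) ModularForm.discriminant := CuspForm.discriminant.holo'
  have h3 := (h1.mul (h1.mul h1)).mul (mdifferentiable_inv h2 ModularForm.discriminant_ne_zero)
  have h4 : jInv = _ := funext fun τ => by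
    rw [jInv, div_eq_mul_inv, pow_three]
  rw [h4]
  exact h3

theorem exists_rep_E₄ : ∃ p : PowerSeries ℤ, p.coeff 0 = 1 ∧ ∃ F, Rep (toC p) F ∧
    ∀ τ : ℍ, F (e τ) = ModularForm.E₄ τ := by
  let p : PowerSeries ℤ := .mk fun n => if n = 0 then 1 else 240 * ArithmeticFunction.sigma 3 n
  obtain ⟨F, hF, h⟩ := rep_of_hasSum one_pos (p := toC p) (f := ModularForm.E₄) fun τ => by
    have h1 := ModularForm.hasSum_qExpansion ModularForm.E₄ one_pos one_mem_strictPeriods_SL τ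
    refine (congrArg (fun g => HasSum g _) (funext fun n => ?_)).mp h1
    rw [EisensteinSeries.E_qExpansion_coeff _ (by decide)]
    congr 1
    · rw [bernoulli_eq_bernoulli'_of_ne_one (by norm_num), bernoulli'_four]
      simp only [toC, p, PowerSeries.coeff_map, PowerSeries.coeff_mk]
      split_ifs
      · simp
      · push_cast
        norm_num
    · have := qParam_eq_e (h := 1) τ
      rw [Nat.cast_one] at this
      rw [this]
  refine ⟨p, by simp [p], F, hF, fun τ => ?_⟩
  have := h τ
  rwa [Nat.cast_one, div_one] at this

theorem discriminant_eq (τ : ℍ) :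
    ModularForm.discriminant τ =
      e τ * eulerProd (fun m => if m + 1 ∈ Set.univ then 1 else 0) (e τ) ^ 24 := by
  have h := qParam_eq_e (h := 1) τ
  simp only [Nat.cast_one, div_one] at h
  rw [ModularForm.discriminant_eq_q_prod, h, eulerProd, ← Multipliable.tprod_pow]
  · simp [ModularForm.eta_q, h]
  · exact multipliable_eulerProd (fun m => by simp) (norm_e_lt_one τ.im_pos)

theorem exists_rep_jInv : ∃ p : PowerSeries ℤ, p.coeff 0 = 1 ∧ ∃ F, Rep (toC p) F ∧
    ∀ τ : ℍ, F (e τ) = jInv τ * e τ := by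
  classical
  obtain ⟨p, hp0, F, hF, h⟩ := exists_rep_E₄
  let c : ℕ → ℂ := fun m => if m + 1 ∈ Set.univ then 1 else 0
  have hc : ∀ m, ‖c m‖ ≤ 1 := fun m => by simp [c]
  obtain ⟨u, hu⟩ : IsUnit (eulerSer Set.univ) := PowerSeries.isUnit_iff_constantCoeff.mpr (by
    rw [← PowerSeries.coeff_zero_eq_constantCoeff_apply, coeff_zero_eulerSer]
    exact isUnit_one)
  have h1 : Rep ((Units.map (toC : _ →* _) u : (PowerSeries ℂ)ˣ) : PowerSeries ℂ)
      (eulerProd c) := by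
    have := rep_eulerSer Set.univ
    rw [← hu] at this
    exact this
  have h2 := (h1.inv fun z hz => eulerProd_ne_zero hc hz).pow 24
  have h3 : (toC (p ^ 3 * ((u⁻¹ : (PowerSeries ℤ)ˣ) : PowerSeries ℤ) ^ 24)) = toC p ^ 3 *
      (((Units.map (toC : _ →* _) u)⁻¹ : (PowerSeries ℂ)ˣ) : PowerSeries ℂ) ^ 24 := by
    rw [map_mul, map_pow, map_pow, ← map_inv]
    rfl
  refine ⟨p ^ 3 * ((u⁻¹ : (PowerSeries ℤ)ˣ) : PowerSeries ℤ) ^ 24, ?_,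
    fun z => F z ^ 3 * (eulerProd c z)⁻¹ ^ 24, ?_, fun τ => ?_⟩
  · have hu0 : (u : PowerSeries ℤ).coeff 0 = 1 := by rw [hu, coeff_zero_eulerSer]
    have hu1 := congrArg (PowerSeries.coeff 0) u.mul_inv
    rw [PowerSeries.coeff_zero_eq_constantCoeff_apply] at hp0 hu0 hu1 ⊢
    rw [map_mul, hu0, one_mul] at hu1
    simp [hp0, hu1]
  · exact h3 ▸ (hF.pow 3).mul h2
  · have h4 : eulerProd c (e τ) ≠ 0 := eulerProd_ne_zero hc (norm_e_lt_one τ.im_pos)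
    have h5 := e_ne_zero τ
    beta_reduce
    rw [jInv, discriminant_eq, h]
    change _ = _ / (_ * eulerProd c (e τ) ^ 24) * _
    field_simp

theorem qInt_jInv : QInt jInv := by
  obtain ⟨p, -, F, hF, h⟩ := exists_rep_jInv
  exact ⟨1, _, toC_mem p, F, hF, fun τ => by rw [h, Nat.cast_one, one_mul]⟩

theorem Rep.isBigO {p : PowerSeries ℂ} {F : ℂ → ℂ} (h : Rep p F) (h0 : p.coeff 0 = 0) :
    (fun τ : ℍ => F (e τ)) =O[atImInfty] fun τ : ℍ => e τ := by
  have h1 := (h.differentiableOn.differentiableAt (Metric.ball_mem_nhds (0 : ℂ) one_pos)).isBigO_sub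
  simp only [h.coeff_zero, h0, sub_zero] at h1
  have h2 := tendsto_e_div 1 one_pos
  simp only [Nat.cast_one, div_one] at h2
  exact h1.comp_tendsto h2

/-- Modular functions of level one have integral expansions, up to linear combinations. -/
theorem qInt_of_levelOne (M : ℕ) : ∀ {φ : ℍ → ℂ}, MDifferentiable 𝓘(ℂ) 𝓘(ℂ) φ →
    (∀ (γ : SL(2, ℤ)) (τ : ℍ), φ (γ • τ) = φ τ) →
    IsBoundedAtImInfty (fun τ => φ τ * e (M * τ)) → QInt φ := by
  induction M with
  | zero =>
    intro φ hφ hinv hb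
    obtain ⟨c, hc⟩ := const_of_bounded one_pos hφ (fun γ _ => hinv γ) fun γ => by
      simpa only [hinv, Nat.cast_zero, zero_mul, e_zero, mul_one] using hb
    rw [show φ = fun _ => c from funext hc]
    exact qInt_const c
  | succ M ih =>
    intro φ hφ hinv hb
    have h1 (τ : ℍ) : φ ((1 : ℝ) +ᵥ τ) = φ τ := by
      have := hinv (ModularGroup.T ^ (1 : ℤ)) τ
      rwa [T_zpow_smul, Int.cast_one] at this
    obtain ⟨p, F, hF, hFφ⟩ := exists_rep one_pos (hφ.mul (mdifferentiable_e (M + 1 : ℕ)))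
      (fun τ => by
        rw [Nat.cast_one, Pi.mul_apply, h1, Pi.mul_apply, coe_vadd, mul_add, e_add]
        have := e_int (M + 1 : ℕ)
        push_cast at this ⊢
        rw [mul_one, this, one_mul]) hb
    simp only [Nat.cast_one, div_one, Pi.mul_apply] at hFφ
    obtain ⟨pj, hpj, Fj, hFj, hj⟩ := exists_rep_jInv
    set c := p.coeff 0
    have h2 := hF.add ((hFj.pow (M + 1)).const_mul (-c))
    -- Since `jInv` is q⁻¹ + ⋯, subtracting c · `jInv`^(M+1) kills the polar term of order M + 1,
    -- and the induction hypothesis applies.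
    have h3 : QInt (φ + fun τ => -c * jInv τ ^ (M + 1)) := by
      refine ih ?_ ?_ ?_
      · have h4 : MDifferentiable 𝓘(ℂ) 𝓘(ℂ) fun τ => -c * jInv τ ^ (M + 1) := by
          have := mdifferentiable_jInv
          rw [UpperHalfPlane.mdifferentiable_iff] at this ⊢
          exact (this.pow (M + 1)).const_mul (-c)
        exact hφ.add h4
      · intro γ τ
        simp only [Pi.add_apply]
        rw [hinv, jInv_smul]
      · have h5 := h2.isBigO (by
          simp only [map_add, PowerSeries.coeff_smul, PowerSeries.coeff_zero_eq_constantCoeff_apply,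
            map_pow]
          have : PowerSeries.constantCoeff (toC pj) = 1 := by
            rw [← PowerSeries.coeff_zero_eq_constantCoeff_apply, toC, PowerSeries.coeff_map, hpj,
              map_one]
          rw [this]
          simp [c])
        have h6 := h5.mul (Asymptotics.isBigO_refl (fun τ : ℍ => e (-τ)) atImInfty)
        have h7 : (fun τ : ℍ => e τ * e (-τ)) = fun _ => (1 : ℂ) := by
          funext τ
          rw [← e_add, add_neg_cancel, e_zero]
        rw [h7] at h6
        refine (h6.congr_left fun τ => ?_).trans (Asymptotics.isBigO_const_const _ one_ne_zero _)
        rw [hFφ, hj, mul_pow, ← e_nat_mul, Pi.add_apply]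
        have h8 : e (M * (τ : ℂ)) = e ((M + 1 : ℕ) * (τ : ℂ)) * e (-τ) := by
          rw [← e_add]
          congr 1
          push_cast
          ring
        rw [h8]
        ring
    have h4 : φ = (φ + fun τ => -c * jInv τ ^ (M + 1)) + (fun _ => c) * jInv ^ (M + 1) := by
      ext τ
      simp
    rw [h4]
    exact h3.add ((qInt_const c).mul (qInt_jInv.pow _))

/-- Holomorphic functions on `ℍ`, meromorphic at `∞`. -/
def moderate : Subring (ℍ → ℂ) where
  carrier := {φ | MDifferentiable 𝓘(ℂ) 𝓘(ℂ) φ ∧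
    ∃ M : ℕ, IsBoundedAtImInfty fun τ => φ τ * e (M * τ)}
  mul_mem' {φ ψ} h h' := by
    obtain ⟨h1, M, hM⟩ := h
    obtain ⟨h1', M', hM'⟩ := h'
    refine ⟨h1.mul h1', M + M', ?_⟩
    refine (hM.mul hM').congr_left fun τ => ?_
    rw [Nat.cast_add, add_mul, e_add, Pi.mul_apply, Pi.mul_apply]
    ring
  one_mem' := ⟨mdifferentiable_const, 0, by
    simp only [Nat.cast_zero, zero_mul, e_zero, mul_one]
    exact Asymptotics.isBigO_const_const (1 : ℂ) one_ne_zero _⟩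
  zero_mem' := ⟨mdifferentiable_const, 0, by
    simp only [Pi.zero_apply, zero_mul]
    exact Asymptotics.isBigO_zero _ _⟩
  add_mem' {φ ψ} h h' := by
    obtain ⟨h1, M, hM⟩ := h
    obtain ⟨h1', M', hM'⟩ := h'
    refine ⟨h1.add h1', M + M', ?_⟩
    have key (N : ℕ) : IsBoundedAtImInfty fun τ : ℍ => e (N * τ) := by
      have := (tendsto_e_div 1 one_pos).pow N
      refine (this.isBigO_one ℝ).congr_left fun τ => ?_
      rw [← e_nat_mul, Nat.cast_one, div_one]
    have h2 := hM.mul (key M')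
    have h3 := hM'.mul (key M)
    refine (h2.add h3).congr_left fun τ => ?_
    simp only [Pi.mul_apply, Pi.add_apply]
    simp only [Nat.cast_add, add_mul, e_add]
    ring
  neg_mem' {φ} h := by
    obtain ⟨h1, M, hM⟩ := h
    refine ⟨h1.neg, M, ?_⟩
    refine (Asymptotics.IsBigO.neg_left hM).congr_left fun τ => ?_
    simp

theorem OrdAt.mem_moderate {ℓ : ℕ} (hℓ : 0 < ℓ) {φ : ℍ → ℂ} (hφ : MDifferentiable 𝓘(ℂ) 𝓘(ℂ) φ)
    {n : ℤ} {L : ℂ} (h : OrdAt ℓ φ n L) : φ ∈ moderate := by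
  refine ⟨hφ, n.natAbs, ?_⟩
  have h1 : OrdAt ℓ (fun τ => e (n.natAbs * τ)) (ℓ * n.natAbs) 1 := by
    refine ⟨one_ne_zero, tendsto_const_nhds.congr fun τ => ?_⟩
    have : (ℓ : ℂ) ≠ 0 := by exact_mod_cast hℓ.ne'
    rw [← e_add, ← e_zero]
    congr 1
    simp only [Int.cast_mul, Int.cast_natCast]
    field_simp
    ring
  refine (h.mul h1).isBounded hℓ ?_
  have h2 : (n.natAbs : ℤ) ≤ ℓ * n.natAbs := by
    have : (1 : ℤ) ≤ ℓ := by exact_mod_cast hℓ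
    nlinarith [Int.natCast_nonneg n.natAbs]
  omega

end

/-! ### Lagrange interpolation over an SL₂(ℤ)-orbit -/

section

/-- Composition with the action of `γ`. -/
def comp (γ : SL(2, ℤ)) : (ℍ → ℂ) →+* (ℍ → ℂ) where
  toFun f τ := f (γ • τ)
  map_one' := rfl
  map_mul' _ _ := rfl
  map_zero' := rfl
  map_add' _ _ := rfl

theorem comp_apply (γ : SL(2, ℤ)) (f : ℍ → ℂ) (τ : ℍ) : comp γ f τ = f (γ • τ) := rfl

theorem comp_comp (γ γ' : SL(2, ℤ)) (f : ℍ → ℂ) : comp γ (comp γ' f) = comp (γ' * γ) f :=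
  funext fun τ => by rw [comp_apply, comp_apply, comp_apply, mul_smul]

theorem comp_one (f : ℍ → ℂ) : comp 1 f = f := funext fun τ => by rw [comp_apply, one_smul]

theorem comp_injective (γ : SL(2, ℤ)) : Function.Injective (comp γ) := fun f g h => by
  have := congrArg (comp γ⁻¹) h
  rwa [comp_comp, comp_comp, mul_inv_cancel, comp_one, comp_one] at this

theorem finite_range_comp {ℓ : ℕ} (hℓ : 0 < ℓ) {t : ℍ → ℂ}
    (ht : ∀ δ ∈ Gamma ℓ, ∀ τ, t (δ • τ) = t τ) : (Set.range fun γ => comp γ t).Finite := by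
  have : NeZero ℓ := ⟨hℓ.ne'⟩
  have : Finite (SL(2, ℤ) ⧸ Gamma ℓ) := Subgroup.finite_quotient_of_finiteIndex
  refine (Set.finite_range fun q : SL(2, ℤ) ⧸ Gamma ℓ => comp q.out t).subset ?_
  rintro _ ⟨γ, rfl⟩
  refine ⟨QuotientGroup.mk γ, ?_⟩
  obtain ⟨δ, hδ⟩ := QuotientGroup.mk_out_eq_mul (Gamma ℓ) γ
  refine funext fun τ => ?_
  beta_reduce
  rw [hδ, comp_apply, comp_apply, mul_smul]
  exact smul_invariant ht γ δ δ.2 τ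

open Polynomial in
/-- The numerator of Lagrange interpolation of `F` at the points of `Ω`. -/
def orbitPoly (Ω : Finset (ℍ → ℂ)) (F : (ℍ → ℂ) → ℍ → ℂ) : (ℍ → ℂ)[X] := by
  classical
  exact ∑ u ∈ Ω, C (F u) * ∏ w ∈ Ω.erase u, (X + C (-w))

section
variable {Ω : Finset (ℍ → ℂ)} {F : (ℍ → ℂ) → ℍ → ℂ}

/-- Composition with γ permutes Ω and F is equivariant, so γ permutes the summands. Hence the
coefficients are of level one. -/
theorem map_orbitPoly {γ : SL(2, ℤ)} (hΩ : ∀ u ∈ Ω, comp γ u ∈ Ω)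
    (hF : ∀ u ∈ Ω, F (comp γ u) = comp γ (F u)) :
    (orbitPoly Ω F).map (comp γ) = orbitPoly Ω F := by
  classical
  have h1 : Ω.image (comp γ) = Ω := Finset.eq_of_subset_of_card_le
    (Finset.image_subset_iff.mpr hΩ) (Finset.card_image_of_injective _ (comp_injective γ)).ge
  have h2 : orbitPoly Ω F = orbitPoly (Ω.image (comp γ)) F := by rw [h1]
  conv_rhs => rw [h2, orbitPoly, Finset.sum_image (comp_injective γ).injOn]
  conv_lhs => rw [orbitPoly, Polynomial.map_sum]
  refine Finset.sum_congr rfl fun u hu => ?_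
  rw [← Finset.image_erase (comp_injective γ), Finset.prod_image (comp_injective γ).injOn,
    Polynomial.map_mul, Polynomial.map_prod, hF u hu, Polynomial.map_C]
  congr 1
  refine Finset.prod_congr rfl fun w _ => ?_
  rw [Polynomial.map_add, Polynomial.map_X, Polynomial.map_C, map_neg]

theorem coeff_orbitPoly_mem (hΩ : ∀ u ∈ Ω, u ∈ moderate) (hF : ∀ u ∈ Ω, F u ∈ moderate) (n : ℕ) :
    (orbitPoly Ω F).coeff n ∈ moderate := by
  classical
  have hC {u : ℍ → ℂ} (hu : u ∈ moderate) : Polynomial.C u ∈ Polynomial.lifts moderate.subtype :=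
    Polynomial.C'_mem_lifts ⟨⟨u, hu⟩, rfl⟩
  have h1 : orbitPoly Ω F ∈ Polynomial.lifts moderate.subtype :=
    sum_mem fun u hu => mul_mem (hC (hF u hu)) (prod_mem fun w hw =>
      add_mem (Polynomial.X_mem_lifts _) (hC (neg_mem (hΩ w (Finset.mem_of_mem_erase hw)))))
  obtain ⟨x, hx⟩ := (Polynomial.lifts_iff_coeff_lifts _).mp h1 n
  rw [← hx]
  exact x.2

open scoped Classical in
theorem eval_orbitPoly {t : ℍ → ℂ} (ht : t ∈ Ω) :
    (orbitPoly Ω F).eval t = F t * ∏ w ∈ Ω.erase t, (t - w) := by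
  rw [orbitPoly, Polynomial.eval_finsetSum, Finset.sum_eq_single_of_mem t ht]
  · simp [Polynomial.eval_prod, sub_eq_add_neg]
  · intro u hu hut
    rw [Polynomial.eval_mul, Polynomial.eval_prod,
      Finset.prod_eq_zero (Finset.mem_erase.mpr ⟨hut.symm, ht⟩) (by simp), mul_zero]

theorem qInt_eval_orbitPoly {t : ℍ → ℂ} (hΩm : ∀ u ∈ Ω, u ∈ moderate)
    (hFm : ∀ u ∈ Ω, F u ∈ moderate) (hΩ : ∀ γ, ∀ u ∈ Ω, comp γ u ∈ Ω)
    (hF : ∀ γ, ∀ u ∈ Ω, F (comp γ u) = comp γ (F u)) (ht : QInt t) :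
    QInt ((orbitPoly Ω F).eval t) := by
  rw [Polynomial.eval_eq_sum_range]
  refine QInt.sum fun n _ => QInt.mul ?_ (ht.pow n)
  obtain ⟨h1, M, hM⟩ := coeff_orbitPoly_mem hΩm hFm n
  refine qInt_of_levelOne M h1 (fun γ τ => ?_) hM
  have := congrArg (fun P => P.coeff n) (map_orbitPoly (hΩ γ) (hF γ))
  rw [Polynomial.coeff_map] at this
  exact congrFun this τ

end

/-- A modular function is a quotient of integral ones if it is fixed by the stabilizer of an
integral one. -/
theorem exists_qInt_mul {ℓ : ℕ} (hℓ : 0 < ℓ) {f t : ℍ → ℂ}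
    (ht : ∀ δ ∈ Gamma ℓ, ∀ τ, t (δ • τ) = t τ) (hfm : ∀ γ, comp γ f ∈ moderate)
    (htm : ∀ γ, comp γ t ∈ moderate) (hstab : ∀ η, comp η t = t → comp η f = f) (hq : QInt t) :
    ∃ D : ℍ → ℂ, D ≠ 0 ∧ QInt D ∧ QInt (f * D) := by
  classical
  have hfin := finite_range_comp hℓ ht
  set Ω := hfin.toFinset
  have hΩ {u : ℍ → ℂ} : u ∈ Ω ↔ ∃ γ, comp γ t = u := by simp [Ω]
  let F : (ℍ → ℂ) → ℍ → ℂ := fun u => if h : ∃ γ, comp γ t = u then comp h.choose f else 0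
  have hF (γ : SL(2, ℤ)) : F (comp γ t) = comp γ f := by
    -- F must send t ∘ γ to f ∘ γ whichever γ was chosen; two choices differ by a stabilizer of t,
    -- which fixes f by `hstab`.
    have h : ∃ γ', comp γ' t = comp γ t := ⟨γ, rfl⟩
    simp only [F, dif_pos h]
    have h1 := congrArg (comp γ⁻¹) h.choose_spec
    rw [comp_comp, comp_comp, mul_inv_cancel, comp_one] at h1
    have h2 := congrArg (comp γ) (hstab _ h1)
    rwa [comp_comp, inv_mul_cancel_right] at h2
  have hΩm : ∀ u ∈ Ω, u ∈ moderate := fun u hu => by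
    obtain ⟨γ, rfl⟩ := hΩ.mp hu
    exact htm γ
  have hΩc : ∀ γ, ∀ u ∈ Ω, comp γ u ∈ Ω := fun γ u hu => by
    obtain ⟨γ', rfl⟩ := hΩ.mp hu
    exact hΩ.mpr ⟨γ' * γ, (comp_comp _ _ _).symm⟩
  have htΩ : t ∈ Ω := hΩ.mpr ⟨1, comp_one t⟩
  -- With F = 1 the value at t is D, the product of t − w over the other conjugates w; with the
  -- equivariant F it is f · D.
  have h1 := qInt_eval_orbitPoly (F := fun _ => 1) hΩm (fun _ _ => one_mem _) hΩc
    (fun γ _ _ => (map_one (comp γ)).symm) hq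
  have h2 := qInt_eval_orbitPoly (F := F) hΩm (fun u hu => by
      obtain ⟨γ, rfl⟩ := hΩ.mp hu
      rw [hF]
      exact hfm γ) hΩc (fun γ u hu => by
      obtain ⟨γ', rfl⟩ := hΩ.mp hu
      rw [comp_comp, hF, hF, comp_comp]) hq
  rw [eval_orbitPoly htΩ, one_mul] at h1
  have h3 := hF 1
  rw [comp_one, comp_one] at h3
  rw [eval_orbitPoly htΩ, h3] at h2
  refine ⟨_, fun h0 => ?_, h1, h2⟩
  -- D is nonzero because a finite product of holomorphic functions on ℍ vanishes identically only
  -- if a factor does.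
  rw [UpperHalfPlane.prod_eq_zero_iff fun w hw =>
    (hΩm t htΩ).1.sub (hΩm w (Finset.mem_of_mem_erase hw)).1] at h0
  obtain ⟨w, hw, h⟩ := h0
  exact Finset.ne_of_mem_erase hw (sub_eq_zero.mp h).symm

end

/-! ### Rationality, bounded denominators and p-th powers of power series -/

section

/-- The coefficientwise image of a complex combination of integral series under a rational
functional has bounded denominators. -/
theorem exists_functional_eq {p : PowerSeries ℂ} (hp : p ∈ intC) : ∀ φ : ℂ →ₗ[ℚ] ℚ,
    ∃ N : ℤ, N ≠ 0 ∧ ∃ p' : PowerSeries ℤ, ∀ n, (p'.coeff n : ℚ) = N * φ (p.coeff n) := by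
  -- The integral series are closed under multiplication, so the algebra they generate is their
  -- linear span.
  have h1 : p ∈ Submodule.span ℂ (Set.range toC) := by
    have h2 : (Submonoid.closure (Set.range toC) : Set (PowerSeries ℂ)) = Set.range toC := by
      have : Set.range toC = ((MonoidHom.mrange (toC : PowerSeries ℤ →* PowerSeries ℂ) :
        Submonoid (PowerSeries ℂ)) : Set (PowerSeries ℂ)) := rfl
      rw [this, Submonoid.closure_eq]
    rw [← h2, ← Algebra.adjoin_eq_span]
    exact hp
  clear hp
  induction h1 using Submodule.span_induction with
  | mem x hx =>
    obtain ⟨u, rfl⟩ := hx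
    intro φ
    refine ⟨(φ 1).den, by exact_mod_cast (φ 1).den_ne_zero, PowerSeries.C (φ 1).num * u,
      fun n => ?_⟩
    have h3 : (toC u).coeff n = ((u.coeff n : ℤ) : ℚ) • (1 : ℂ) := by
      rw [toC, PowerSeries.coeff_map, Rat.smul_one_eq_cast]
      simp
    rw [h3, map_smul, PowerSeries.coeff_C_mul, smul_eq_mul]
    have h4 := Rat.mul_den_eq_num (φ 1)
    push_cast
    linear_combination -(u.coeff n : ℚ) * h4
  | zero => exact fun φ => ⟨1, one_ne_zero, 0, fun n => by simp⟩
  | add x y _ _ hx hy =>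
    intro φ
    obtain ⟨N, hN, x', h⟩ := hx φ
    obtain ⟨N', hN', y', h'⟩ := hy φ
    refine ⟨N * N', mul_ne_zero hN hN', PowerSeries.C N' * x' + PowerSeries.C N * y', fun n => ?_⟩
    simp only [map_add, PowerSeries.coeff_C_mul]
    push_cast
    rw [h, h']
    ring
  | smul a x _ hx =>
    intro φ
    -- The scalar a is absorbed into the functional; this is why φ is quantified inside the
    -- induction.
    obtain ⟨N, hN, x', h⟩ := hx (φ ∘ₗ LinearMap.mulLeft ℚ a)
    exact ⟨N, hN, x', fun n => by simpa using h n⟩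

/-- A rational power series that is a quotient of complex combinations of integral series is a
quotient of integral series. -/
theorem exists_integral_quotient {h : PowerSeries ℚ} {d g : PowerSeries ℂ} (hd : d ∈ intC)
    (hg : g ∈ intC) (hd0 : d ≠ 0) (hdg : PowerSeries.map (algebraMap ℚ ℂ) h * d = g) :
    ∃ d' g' : PowerSeries ℤ, d' ≠ 0 ∧
      h * PowerSeries.map (Int.castRingHom ℚ) d' = PowerSeries.map (Int.castRingHom ℚ) g' := by
  obtain ⟨n, hn⟩ : ∃ n, d.coeff n ≠ 0 := by
    by_contra! H
    exact hd0 (PowerSeries.ext H)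
  -- As h has rational coefficients, multiplication by h commutes with applying φ coefficientwise.
  -- It is enough that φ does not kill d.
  obtain ⟨φ, hφ⟩ : ∃ φ : ℂ →ₗ[ℚ] ℚ, φ (d.coeff n) ≠ 0 := by
    by_contra! H
    exact hn ((Module.forall_dual_apply_eq_zero_iff ℚ _).mp H)
  obtain ⟨N, hN, d', hd'⟩ := exists_functional_eq hd φ
  obtain ⟨N', hN', g', hg'⟩ := exists_functional_eq hg φ
  refine ⟨PowerSeries.C N' * d', PowerSeries.C N * g', fun h0 => ?_, ?_⟩
  · have h1 := congrArg (PowerSeries.coeff n) h0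
    rw [PowerSeries.coeff_C_mul, map_zero, mul_eq_zero, or_iff_right hN'] at h1
    have h2 := hd' n
    rw [h1, Int.cast_zero, eq_comm, mul_eq_zero, or_iff_left hφ] at h2
    exact hN (by exact_mod_cast h2)
  · ext m
    have h1 := congrArg (fun s => φ (PowerSeries.coeff m s)) hdg
    simp only [PowerSeries.coeff_mul, PowerSeries.coeff_map] at h1
    rw [map_sum] at h1
    rw [PowerSeries.coeff_mul, PowerSeries.coeff_map, PowerSeries.coeff_C_mul,
      eq_intCast (Int.castRingHom ℚ) (N * _), Int.cast_mul, hg', ← h1, Finset.mul_sum,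
      Finset.mul_sum]
    refine Finset.sum_congr rfl fun x _ => ?_
    rw [PowerSeries.coeff_map, PowerSeries.coeff_C_mul, eq_intCast (Int.castRingHom ℚ),
      Int.cast_mul, hd',
      ← Algebra.smul_def, map_smul, smul_eq_mul]
    ring

/-- The equation n u h′ = u′ h determines the coefficients of h recursively: as u has constant term
1, the m-th coefficient isolates n(m + 1)h_{m+1}. -/
theorem exists_rat_of_pow_eq {n : ℕ} (hn : n ≠ 0) {u : PowerSeries ℤ} (hu0 : u.coeff 0 = 1)
    {h : PowerSeries ℂ} (h0 : h.coeff 0 = 1) (hu : h ^ n = toC u) :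
    ∃ r : PowerSeries ℚ, PowerSeries.map (algebraMap ℚ ℂ) r = h := by
  have hder : (n : PowerSeries ℂ) * (toC u * PowerSeries.derivative ℂ h) =
      PowerSeries.derivative ℂ (toC u) * h := by
    rw [← hu, Derivation.leibniz_pow]
    obtain ⟨m, rfl⟩ := Nat.exists_eq_succ_of_ne_zero hn
    simp only [Nat.succ_eq_add_one, Nat.add_sub_cancel, nsmul_eq_mul, smul_eq_mul]
    ring
  have hK : ∀ m, h.coeff m ∈ (algebraMap ℚ ℂ).fieldRange := by
    intro m
    induction m using Nat.strong_induction_on with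
    | _ m ih =>
    rcases m with _ | m
    · rw [h0]
      exact one_mem _
    have huK (i : ℕ) : (toC u).coeff i ∈ (algebraMap ℚ ℂ).fieldRange := by
      rw [toC, PowerSeries.coeff_map, eq_intCast]
      exact intCast_mem _ _
    have h1 := congrArg (PowerSeries.coeff m) hder
    have h2 : (n : PowerSeries ℂ) = PowerSeries.C (n : ℂ) := (map_natCast _ _).symm
    rw [h2, PowerSeries.coeff_C_mul, PowerSeries.coeff_mul, PowerSeries.coeff_mul,
      ← Finset.add_sum_erase _ _ 
        (Finset.HasAntidiagonal.mem_antidiagonal.mpr (zero_add m) :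
          (0, m) ∈ Finset.HasAntidiagonal.antidiagonal m)] at h1
    have h3 : (toC u).coeff 0 = 1 := by rw [toC, PowerSeries.coeff_map, hu0, map_one]
    simp only [PowerSeries.coeff_derivative, h3, one_mul] at h1
    have h4 : (n : ℂ) ≠ 0 := Nat.cast_ne_zero.mpr hn
    have h5 : (m : ℂ) + 1 ≠ 0 := Nat.cast_add_one_ne_zero m
    rw [mul_add, ← eq_sub_iff_add_eq] at h1
    have h6 : h.coeff (m + 1) = (h.coeff (m + 1) * (m + 1) * n) / ((m + 1 : ℕ) * n) := by
      push_cast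
      field_simp
    rw [h6, mul_comm _ (n : ℂ), h1]
    refine div_mem (sub_mem (sum_mem fun x hx => ?_) (mul_mem (_root_.natCast_mem _ _)
      (sum_mem fun x hx => ?_))) (mul_mem (_root_.natCast_mem _ _) (_root_.natCast_mem _ _))
    · have := Finset.HasAntidiagonal.mem_antidiagonal.mp hx
      exact mul_mem (mul_mem (huK _) (add_mem (_root_.natCast_mem _ _) (one_mem _)))
        (ih _ (by omega))
    · obtain ⟨h7, h8⟩ := Finset.mem_erase.mp hx
      have := Finset.HasAntidiagonal.mem_antidiagonal.mp h8
      have h9 : x.1 ≠ 0 := fun h => h7 (Prod.ext h (by simp; omega))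
      exact mul_mem (huK _) (mul_mem (ih _ (by omega))
        (add_mem (_root_.natCast_mem _ _) (one_mem _)))
  choose r hr using hK
  exact ⟨PowerSeries.mk r, PowerSeries.ext fun m => by simpa using hr m⟩

theorem exists_C_mul_eq {p : ℕ} {d : PowerSeries ℤ}
    (h : PowerSeries.map (Int.castRingHom (ZMod p)) d = 0) :
    ∃ d' : PowerSeries ℤ, d = PowerSeries.C (p : ℤ) * d' := by
  have h1 (n : ℕ) : (p : ℤ) ∣ d.coeff n := by
    have := congrArg (PowerSeries.coeff n) h
    rw [PowerSeries.coeff_map, map_zero, eq_intCast] at this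
    exact (ZMod.intCast_zmod_eq_zero_iff_dvd _ _).mp this
  choose c hc using h1
  exact ⟨PowerSeries.mk c, PowerSeries.ext fun n => by
    rw [PowerSeries.coeff_C_mul, PowerSeries.coeff_mk, hc]⟩

/-- The derivative of an integral series vanishes modulo `p` if the series is a `p`-th power of a
quotient. -/
theorem dvd_derivative_of_pow_eq {p : ℕ} (hp : p.Prime) {u d g : PowerSeries ℤ} (hd : d ≠ 0)
    (h : g ^ p = u * d ^ p) (n : ℕ) : (p : ℤ) ∣ (PowerSeries.derivative ℤ u).coeff n := by
  have : Fact p.Prime := ⟨hp⟩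
  obtain ⟨m, hm⟩ : ∃ m, d.coeff m ≠ 0 := by
    by_contra! H
    exact hd (PowerSeries.ext H)
  -- Descent: while p divides d it also divides g, and cancelling p lowers the absolute value of a
  -- fixed nonzero coefficient of d.
  induction hN : (d.coeff m).natAbs using Nat.strong_induction_on generalizing d g with
  | _ N ih =>
  let π := PowerSeries.map (Int.castRingHom (ZMod p))
  by_cases hπ : π d = 0
  · obtain ⟨d', rfl⟩ := exists_C_mul_eq hπ
    obtain ⟨g', rfl⟩ : ∃ g' : PowerSeries ℤ, g = PowerSeries.C (p : ℤ) * g' := by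
      refine exists_C_mul_eq (pow_eq_zero_iff hp.ne_zero |>.mp ?_)
      rw [← map_pow, h, map_mul, map_pow]
      change _ * (π _) ^ p = 0
      rw [hπ, zero_pow hp.ne_zero, mul_zero]
    have hpC : (PowerSeries.C (p : ℤ)) ^ p ≠ 0 := pow_ne_zero _ fun h0 => by
      have := congrArg (PowerSeries.coeff 0) h0
      simp [hp.ne_zero] at this
    rw [PowerSeries.coeff_C_mul] at hm hN
    refine ih _ ?_ (d := d') (g := g') (fun h0 => hd (by rw [h0, mul_zero])) ?_
      (right_ne_zero_of_mul hm) rfl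
    · rw [← hN, Int.natAbs_mul, Int.natAbs_natCast]
      have := Int.natAbs_pos.mpr (right_ne_zero_of_mul hm)
      nlinarith [hp.two_le]
    · rw [mul_pow, mul_pow] at h
      refine mul_left_cancel₀ hpC (h.trans ?_)
      ring
  -- Once d is nonzero modulo p, differentiating g^p = u d^p in characteristic p leaves u′ d^p = 0.
  · have hchar (s : PowerSeries (ZMod p)) :
        PowerSeries.derivative (ZMod p) (s ^ p) = 0 := by
      rw [Derivation.leibniz_pow, ← Nat.cast_smul_eq_nsmul (ZMod p), ZMod.natCast_self, zero_smul]
    have h1 := congrArg (fun s => PowerSeries.derivative (ZMod p) (π s)) h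
    simp only [map_pow, map_mul] at h1
    rw [hchar, Derivation.leibniz, hchar, smul_zero, zero_add, smul_eq_mul, eq_comm, mul_eq_zero,
      or_iff_right (pow_ne_zero _ hπ)] at h1
    have h2 := congrArg (PowerSeries.coeff n) h1
    rw [map_zero, PowerSeries.coeff_derivative, PowerSeries.coeff_map] at h2
    rw [← ZMod.intCast_zmod_eq_zero_iff_dvd, PowerSeries.coeff_derivative, ← h2]
    simp

end

/-! ### Invariance under T and a presentation as an integral quotient -/

section

theorem Rep.ext_of_e {p p' : PowerSeries ℂ} {F F' : ℂ → ℂ} (h : Rep p F) (h' : Rep p' F')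
    (hF : ∀ τ : ℍ, F (e τ) = F' (e τ)) : p = p' := by
  have h1 := h.tendsto one_pos
  have h2 := h'.tendsto one_pos
  simp only [Nat.cast_one, div_one, hF] at h1 h2
  refine (h.congr fun z hz => ?_).unique h'
  by_cases h0 : z = 0
  · rw [h0, h.coeff_zero, h'.coeff_zero]
    exact tendsto_nhds_unique h1 h2
  · obtain ⟨τ, hτ⟩ := exists_e_eq one_pos h0 hz
    rw [Nat.cast_one, div_one] at hτ
    rw [← hτ, hF]

variable {ℓ : ℕ}

theorem comp_mem_cuspUnits {f : (ℍ → ℂ)ˣ} (hf : f ∈ cuspUnits ℓ) (γ : SL(2, ℤ)) :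
    Units.map (comp γ : (ℍ → ℂ) →* (ℍ → ℂ)) f ∈ cuspUnits ℓ := by
  refine ⟨mdifferentiable_smul_SL hf.holomorphic γ, smul_invariant hf.invariant γ, fun γ' => ?_⟩
  obtain ⟨n, L, h⟩ := hf.exists_ordAt (γ * γ')
  exact ⟨n, L, h.congr fun τ => by rw [mul_smul]; rfl⟩

variable [hp : Fact ℓ.Prime]

theorem exists_eq_constUnit_of_pow {f : (ℍ → ℂ)ˣ} (hf : f ∈ cuspUnits ℓ) {N : ℕ} (hN : 0 < N)
    {c : ℂˣ} (h : f ^ N = constUnit c) : ∃ u, f = constUnit u := by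
  refine const_of_order_nonneg hp.out.pos hf fun γ n L hn => ?_
  have h1 := hn.zpow_unit N
  rw [h] at h1
  have h2 := (h1.unique hp.out.pos (ordAt_const c.ne_zero)).1
  rcases mul_eq_zero.mp h2 with h3 | h3
  · exact absurd (by exact_mod_cast h3) hN.ne'
  · exact h3.ge

theorem ordInfty_smul (m : ℤ) (w : Cl ℓ → ℤ) : ordInfty (m • w) = m * ordInfty w := by
  simp [ordInfty, Finset.mul_sum, mul_assoc]

/-- The vector w = [2] − [1] works: twice its order at ∞ is 3 − ℓ, and ℓ does not divide 3. It
twists orders to be divisible by ℓ, and ℓ · w supplies the interpolation function. -/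
theorem exists_weight (h5 : 5 ≤ ℓ) : ∃ w : Cl ℓ → ℤ, ∑ x, w x = 0 ∧ ¬ (ℓ : ℤ) ∣ ordInfty w ∧
    ∀ A : Cl ℓ, (fun y => w (y * A⁻¹)) = w → A = 1 := by
  classical
  have hodd : ℓ ≠ 2 := by omega
  have hwt {x : Cl ℓ} {j : ℤ} (h : IsClass x j) (h0 : 0 < j) (hj : j < ℓ) :
      2 * wt x = j * (j - ℓ) := by
    have h1 : (0 : ℤ) < repr x := by exact_mod_cast repr_pos x
    have h2 : (repr x : ℤ) < ℓ := by exact_mod_cast repr_lt x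
    rw [two_mul_wt hodd]
    rcases (isClass_iff x j).mp h with ⟨m, rfl⟩ | ⟨m, rfl⟩
    · obtain rfl : m = 0 := by
        have : m < 1 := by nlinarith
        have : -1 < m := by nlinarith
        omega
      ring
    · obtain rfl : m = 1 := by
        have : m < 2 := by nlinarith
        have : 0 < m := by nlinarith
        omega
      ring
  obtain ⟨c, hc⟩ : ∃ c : Cl ℓ, IsClass c 2 := exists_isClass fun h => by
    have := Int.le_of_dvd two_pos h
    omega
  have h1 := hwt (isClass_one (ℓ := ℓ)) one_pos (by omega)
  have h2 := hwt hc two_pos (by omega)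
  have hc1 : c ≠ 1 := by
    rintro rfl
    omega
  refine ⟨Pi.single c 1 - Pi.single 1 1, by simp, fun h => ?_, fun A hA => ?_⟩
  · have h3 : ordInfty (Pi.single c 1 - Pi.single 1 1 : Cl ℓ → ℤ) = wt c - wt (1 : Cl ℓ) := by
      simp [ordInfty, sub_mul, Finset.sum_sub_distrib, Pi.single_apply]
    rw [h3] at h
    have h4 : (ℓ : ℤ) ∣ 3 := by
      have h5 : (3 : ℤ) = 2 * (wt c - wt (1 : Cl ℓ)) + ℓ := by linarith
      rw [h5]
      exact dvd_add (h.mul_left _) dvd_rfl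
    have := Int.le_of_dvd three_pos h4
    omega
  · by_contra hA1
    have := congrFun hA A
    rw [mul_inv_cancel] at this
    by_cases hAc : A = c <;> simp [hc1.symm, hc1, hA1, hAc] at this

theorem qInt_EP (hodd : ℓ ≠ 2) {v : Cl ℓ → ℤ} (hv : ∑ x, v x = 0) {n : ℤ}
    (hn : ordInfty v = ℓ * n) : QInt (EP v : ℍ → ℂ) := by
  have hℓ0 : (ℓ : ℂ) ≠ 0 := by exact_mod_cast hp.out.ne_zero
  refine ⟨n.natAbs, PowerSeries.X ^ (n + n.natAbs).toNat * toC (EPSer v),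
    mul_mem (pow_mem X_mem _) (toC_mem _), _, (rep_X.pow _).mul (rep_EPSer v), fun τ => ?_⟩
  have h1 : e τ ^ (n + n.natAbs).toNat = e (((n : ℂ) + n.natAbs) * τ) := by
    rw [← zpow_natCast, Int.toNat_of_nonneg (by omega), ← e_int_mul]
    rw [Int.cast_add, Int.cast_natCast]
  rw [EP_eq hodd hv, h1, hn, add_mul, e_add]
  have h2 : ((ℓ * n : ℤ) : ℂ) / ℓ = n := by
    push_cast
    field_simp
  rw [h2]
  ring

/-- The expansion of `EP v` then involves only integral powers of q, so f ∘ T^m / f has N-th power 1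
and is constant. Since ℓ divides the order of f, translation leaves the leading coefficient
unchanged and the constant is 1. -/
theorem apply_T_smul (hodd : ℓ ≠ 2) {f : (ℍ → ℂ)ˣ} (hf : f ∈ cuspUnits ℓ) {N : ℕ} (hN : 0 < N)
    {c : ℂˣ} {v : Cl ℓ → ℤ} (hv : ∑ x, v x = 0) (h : f ^ N = constUnit c * EP v) {r : ℤ} {L : ℂ}
    (hr : OrdAt ℓ (f : ℍ → ℂ) (ℓ * r) L) (m : ℤ) (τ : ℍ) :
    (f : ℍ → ℂ) (ModularGroup.T ^ m • τ) = (f : ℍ → ℂ) τ := by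
  have hℓ0 : (ℓ : ℂ) ≠ 0 := by exact_mod_cast hp.out.ne_zero
  have hpow (τ : ℍ) : (f : ℍ → ℂ) τ ^ N = c * (EP v : ℍ → ℂ) τ :=
    congrFun (congrArg Units.val h) τ
  have hord : (ordInfty v : ℂ) / ℓ = (N * r : ℤ) := by
    have h1 : OrdAt ℓ (fun τ => (f : ℍ → ℂ) ((1 : SL(2, ℤ)) • τ)) (ℓ * r) L := by simpa using hr
    have h2 := h1.zpow_unit N
    simp only [one_smul, h] at h2
    have h3 := (h2.unique hp.out.pos ((ordAt_const c.ne_zero).mul (EP_ordAt_infty hodd hv))).1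
    rw [zero_add] at h3
    rw [← h3]
    push_cast
    field_simp
  let g := Units.map (comp (ModularGroup.T ^ m) : (ℍ → ℂ) →* (ℍ → ℂ)) f
  have hg (τ : ℍ) : (g : ℍ → ℂ) τ = (f : ℍ → ℂ) (ModularGroup.T ^ m • τ) := rfl
  have hgf : (g * f⁻¹) ^ N = constUnit 1 := by
    refine unit_ext fun τ => ?_
    have h1 : (EP v : ℍ → ℂ) (ModularGroup.T ^ m • τ) = (EP v : ℍ → ℂ) τ := by
      rw [EP_eq hodd hv, EP_eq hodd hv, T_zpow_smul, coe_vadd, hord, mul_add, e_add, e_add]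
      have h2 := e_int (N * r * m)
      have h3 := e_int m
      push_cast at h2 h3 ⊢
      rw [h2, h3, one_mul, one_mul]
    have h4 : (EP v : ℍ → ℂ) τ ≠ 0 := unit_ne_zero _ _
    have h5 := c.ne_zero
    rw [Units.val_pow_eq_pow_val, Pi.pow_apply, Units.val_mul, Pi.mul_apply, unit_inv_apply, hg,
      mul_pow, inv_pow, hpow, hpow, h1, constUnit_apply, Units.val_one]
    field_simp
  obtain ⟨u, hu⟩ := exists_eq_constUnit_of_pow
    (mul_mem (comp_mem_cuspUnits hf (ModularGroup.T ^ m)) (inv_mem hf)) hN hgf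
  have hgu (τ : ℍ) : (g : ℍ → ℂ) τ = u * (f : ℍ → ℂ) τ := by
    have h1 : g = constUnit u * f := by rw [← hu, inv_mul_cancel_right]
    rw [h1]
    rfl
  have h1 := hr.comp_T m
  have h2 := (ordAt_const (ℓ := ℓ) u.ne_zero).mul hr
  rw [zero_add] at h2
  have h3 := (h1.unique hp.out.pos (h2.congr fun τ => (hgu τ).symm)).2
  have h4 : ((ℓ * r : ℤ) : ℂ) / ℓ * m = (r * m : ℤ) := by
    push_cast
    field_simp
  rw [h4, e_int, mul_one, eq_comm, mul_eq_right₀ hr.1] at h3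
  rw [← hg, hgu, h3, one_mul]

/-- Interpolation at t = `EP (ℓ • w)`. An element fixing t lies in Γ₀(ℓ), since t has nonzero order
at ∞, and has trivial class, since only the trivial translation fixes w; so it acts as an element of
Γ(ℓ) times a power of T and fixes f. -/
theorem exists_qInt_mul_of_pow (h5 : 5 ≤ ℓ) {f : (ℍ → ℂ)ˣ} (hf : f ∈ cuspUnits ℓ)
    (hT : ∀ (m : ℤ) (τ : ℍ), (f : ℍ → ℂ) (ModularGroup.T ^ m • τ) = (f : ℍ → ℂ) τ) :
    ∃ D : ℍ → ℂ, D ≠ 0 ∧ QInt D ∧ QInt (f * D) := by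
  have hodd : ℓ ≠ 2 := by omega
  obtain ⟨w, hw, hwℓ, hwA⟩ := exists_weight h5
  have hw' : ∑ x, ((ℓ : ℤ) • w) x = 0 := by
    simp only [Pi.smul_apply, smul_eq_mul]
    rw [← Finset.mul_sum, hw, mul_zero]
  have hm {g : (ℍ → ℂ)ˣ} (hg : g ∈ cuspUnits ℓ) (γ : SL(2, ℤ)) : comp γ (g : ℍ → ℂ) ∈ moderate := by
    obtain ⟨n, L, h⟩ := hg.exists_ordAt γ
    exact h.mem_moderate hp.out.pos (mdifferentiable_smul_SL hg.holomorphic γ)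
  have ht := EP_mem_cuspUnits hodd hw'
  refine exists_qInt_mul hp.out.pos (t := EP ((ℓ : ℤ) • w)) ht.invariant (hm hf) (hm ht)
    (fun η hη => ?_) (qInt_EP hodd hw' (ordInfty_smul _ _))
  have hη' (τ : ℍ) : (EP ((ℓ : ℤ) • w) : ℍ → ℂ) (η • τ) = (EP ((ℓ : ℤ) • w) : ℍ → ℂ) τ :=
    congrFun hη τ
  have hηΓ : η ∈ Gamma0 ℓ := by
    by_contra hηΓ
    obtain ⟨L, hL⟩ := EP_ordAt_not_Gamma0 hw' hηΓ
    have h1 := ((hL.congr hη').unique hp.out.pos (EP_ordAt_infty hodd hw')).1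
    rw [ordInfty_smul, eq_comm, mul_eq_zero, or_iff_right (by exact_mod_cast hp.out.ne_zero)] at h1
    exact hwℓ (h1 ▸ dvd_zero _)
  obtain ⟨A, hA⟩ := isClass_of_mem_Gamma0 hηΓ
  obtain ⟨c, hc⟩ := mem_Gamma0_iff.mp hηΓ
  obtain ⟨C, hC, h⟩ := EP_Gamma0 hw' hc hA
  have h1 : EP ((fun y => ((ℓ : ℤ) • w) (y * A⁻¹)) - (ℓ : ℤ) • w) =
      constUnit (Units.mk0 C hC)⁻¹ := by
    refine unit_ext fun τ => ?_
    have h2 := h τ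
    have h3 := unit_ne_zero (EP ((ℓ : ℤ) • w)) τ
    rw [hη'] at h2
    rw [sub_eq_add_neg, EP_add, ← neg_one_zsmul, EP_zsmul, zpow_neg_one, Units.val_mul,
      Pi.mul_apply, unit_inv_apply, constUnit_apply, Units.val_inv_eq_inv_val, Units.val_mk0]
    field_simp
    rw [mul_comm]
    exact h2.symm
  have h2 := eq_zero_of_EP_const hodd (by
    simp only [Pi.sub_apply]
    rw [Finset.sum_sub_distrib, sum_shift, sub_self]) h1
  have hA1 : A = 1 := hwA A (by
    funext y
    have h3 := congrFun h2 y
    simp only [Pi.sub_apply, Pi.smul_apply, smul_eq_mul, Pi.zero_apply] at h3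
    exact mul_left_cancel₀ (by exact_mod_cast hp.out.ne_zero) (sub_eq_zero.mp h3))
  obtain ⟨m, δ, hδ, hm⟩ := exists_Gamma_mul_T hηΓ (hA1 ▸ hA)
  refine funext fun τ => ?_
  rw [comp_apply, hm, hf.invariant δ hδ, hT]

end

/-! ### Saturation and the description of U_ℓ^+ -/

section

variable {ℓ : ℕ} [hp : Fact ℓ.Prime]

theorem dvd_of_pow_eq_of_ordAt (h5 : 5 ≤ ℓ) {p : ℕ} (hpp : p.Prime) {f : (ℍ → ℂ)ˣ}
    (hf : f ∈ cuspUnits ℓ) {v : Cl ℓ → ℤ} (hv : ∑ x, v x = 0) {c : ℂˣ}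
    (h : f ^ p = constUnit c * EP v) {r : ℤ} {L : ℂ} (hr : OrdAt ℓ (f : ℍ → ℂ) (ℓ * r) L)
    (x : Cl ℓ) : (p : ℤ) ∣ v x := by
  have hodd : ℓ ≠ 2 := by omega
  have hℓ0 : (ℓ : ℂ) ≠ 0 := by exact_mod_cast hp.out.ne_zero
  have hT := apply_T_smul hodd hf hpp.pos hv h hr
  have hpow (τ : ℍ) : (f : ℍ → ℂ) τ ^ p = c * (EP v : ℍ → ℂ) τ :=
    congrFun (congrArg Units.val h) τ
  have hrℓ : ((ℓ * r : ℤ) : ℂ) / ℓ = r := by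
    push_cast
    field_simp
  obtain ⟨hord, hL⟩ : ordInfty v = p * (ℓ * r) ∧ L ^ p = c := by
    have h1 : OrdAt ℓ (fun τ => (f : ℍ → ℂ) ((1 : SL(2, ℤ)) • τ)) (ℓ * r) L := by simpa using hr
    have h2 := h1.zpow_unit p
    simp only [one_smul, h] at h2
    have h3 := h2.unique hp.out.pos ((ordAt_const c.ne_zero).mul (EP_ordAt_infty hodd hv))
    rw [zero_add, mul_one] at h3
    exact ⟨h3.1.symm, h3.2⟩
  have hlim := hr.2
  rw [hrℓ] at hlim
  obtain ⟨P, F, hF, hFf⟩ := exists_rep one_pos (f := fun τ => (f : ℍ → ℂ) τ * e (-r * τ))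
    (hf.holomorphic.mul (mdifferentiable_e _)) (fun τ => by
      have h1 := hT 1 τ
      have h2 := e_int (-r)
      rw [T_zpow_smul, Int.cast_one] at h1
      push_cast at h2
      rw [Nat.cast_one, h1, coe_vadd, mul_add, e_add, Complex.ofReal_one, mul_one, h2, one_mul])
    (hlim.isBigO_one ℝ)
  have hP0 : P.coeff 0 = L := by
    have h1 := hF.tendsto one_pos
    simp only [hFf] at h1
    exact tendsto_nhds_unique h1 hlim
  simp only [Nat.cast_one, div_one] at hFf
  have hPp : P ^ p = (c : ℂ) • toC (EPSer v) := by
    refine (hF.pow p).ext_of_e ((rep_EPSer v).const_mul c) fun τ => ?_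
    have h1 : ((p * (ℓ * r) : ℤ) : ℂ) / ℓ = p * r := by
      push_cast
      field_simp
    rw [hFf, mul_pow, hpow, EP_eq hodd hv, hord, h1, ← e_nat_mul]
    have h2 : e (p * r * (τ : ℂ)) * e (p * (-r * (τ : ℂ))) = 1 := by
      rw [← e_add, ← e_zero]
      congr 1
      ring
    linear_combination (c : ℂ) * (∏ x, eulerProd (classChar x) (e τ) ^ v x) * h2
  obtain ⟨d, g, hd, hg, hd0, hdg⟩ : ∃ d g, d ∈ intC ∧ g ∈ intC ∧ d ≠ 0 ∧ P * d = g := by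
    obtain ⟨D, hD0, hD, hfD⟩ := exists_qInt_mul_of_pow h5 hf hT
    obtain ⟨M, hM⟩ := hD.mono
    obtain ⟨M', hM'⟩ := hfD.mono
    obtain ⟨d, hd, Fd, hFd, hdD⟩ := hM (M + M' + r.natAbs) (by omega)
    -- P is the expansion of f q^{−r}, so the series of f · D needs an exponent smaller by r than
    -- that of D for P · d = g.
    obtain ⟨g, hg, Fg, hFg, hgD⟩ := hM' (M + M' + r.natAbs - r).toNat (by omega)
    refine ⟨d, g, hd, hg, fun h0 => hD0 (funext fun τ => ?_),
      (hF.mul hFd).ext_of_e hFg fun τ => ?_⟩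
    · have h1 := hdD τ
      have h2 := hFd (e τ) (norm_e_lt_one τ.im_pos)
      simp only [h0, map_zero, zero_mul] at h2
      rw [← hasSum_zero.unique h2, eq_comm, mul_eq_zero, or_iff_left (e_ne_zero _)] at h1
      exact h1
    · have h1 : (((M + M' + r.natAbs - r : ℤ).toNat : ℕ) : ℂ) =
          ((M + M' + r.natAbs : ℕ) : ℂ) - r := by
        have := Int.toNat_of_nonneg (show 0 ≤ (M + M' + r.natAbs - r : ℤ) by omega)
        have h2 := congrArg (Int.cast : ℤ → ℂ) this
        rw [Int.cast_natCast] at h2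
        rw [h2]
        simp only [Int.cast_sub, Int.cast_add, Int.cast_natCast, Nat.cast_add]
      rw [hFf, hdD, hgD, h1, sub_mul, sub_eq_add_neg, e_add, Pi.mul_apply, neg_mul]
      ring
  have hL0 := hr.1
  obtain ⟨s, hs⟩ := exists_rat_of_pow_eq (h := L⁻¹ • P) hpp.ne_zero (constantCoeff_EPSer v)
    (by rw [PowerSeries.coeff_smul, hP0, smul_eq_mul, inv_mul_cancel₀ hL0])
    (by rw [smul_pow, hPp, smul_smul, inv_pow, hL, inv_mul_cancel₀ c.ne_zero, one_smul])
  obtain ⟨d', g', hd', hdg'⟩ := exists_integral_quotient (h := s) hd (intC.smul_mem hg L⁻¹) hd0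
    (by rw [hs, smul_mul_assoc, hdg])
  have hsp : s ^ p = PowerSeries.map (Int.castRingHom ℚ) (EPSer v : PowerSeries ℤ) := by
    refine PowerSeries.map_injective _ (algebraMap ℚ ℂ).injective ?_
    rw [map_pow, hs, smul_pow, hPp, smul_smul, inv_pow, hL, inv_mul_cancel₀ c.ne_zero, one_smul]
    ext n
    simp [toC]
  have hpow' : g' ^ p = (EPSer v : PowerSeries ℤ) * d' ^ p := by
    refine PowerSeries.map_injective _ (Int.castRingHom ℚ).injective_int ?_
    rw [map_pow, ← hdg', mul_pow, hsp, map_mul, map_pow]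
  exact dvd_of_derivative_EPSer hpp (dvd_derivative_of_pow_eq hpp hd' hpow') x

/-- Multiplying f by `EP` of a multiple of w makes its order at ∞ divisible by ℓ, while v changes
only by a multiple of p. -/
theorem dvd_of_pow_eq (h5 : 5 ≤ ℓ) {p : ℕ} (hpp : p.Prime) {f : (ℍ → ℂ)ˣ}
    (hf : f ∈ cuspUnits ℓ) {v : Cl ℓ → ℤ} (hv : ∑ x, v x = 0) {c : ℂˣ}
    (h : f ^ p = constUnit c * EP v) (x : Cl ℓ) : (p : ℤ) ∣ v x := by
  have hodd : ℓ ≠ 2 := by omega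
  obtain ⟨w, hw, hwℓ, -⟩ := exists_weight h5
  obtain ⟨r, L, hr⟩ := hf.exists_ordAt 1
  simp only [one_smul] at hr
  -- From aℓ + b · `ordInfty w` = 1, the twist by −rb · w changes the order r into raℓ.
  obtain ⟨a, b, hab⟩ := (Nat.prime_iff_prime_int.mp hp.out).coprime_iff_not_dvd.mpr hwℓ
  have hmw (m : ℤ) : ∑ x, (m • w) x = 0 := by
    simp only [Pi.smul_apply, smul_eq_mul]
    rw [← Finset.mul_sum, hw, mul_zero]
  have h1 := hr.mul (EP_ordAt_infty hodd (hmw (-r * b)))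
  have h2 : r + ordInfty ((-r * b) • w) = ℓ * (r * a) := by
    rw [ordInfty_smul]
    linear_combination -r * hab
  rw [h2] at h1
  have h3 := dvd_of_pow_eq_of_ordAt h5 hpp (mul_mem hf (EP_mem_cuspUnits hodd (hmw (-r * b))))
    (v := v + ((p : ℤ) * (-r * b)) • w) (by
      simp only [Pi.add_apply]
      rw [Finset.sum_add_distrib, hv, hmw, add_zero]) (c := c) (by
      rw [mul_pow, h, EP_add, mul_assoc, EP_zsmul, EP_zsmul, mul_comm (p : ℤ),
        zpow_mul _ (-r * b), zpow_natCast]) h1 x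
  rw [Pi.add_apply, Pi.smul_apply, smul_eq_mul, mul_assoc] at h3
  exact (dvd_add_left (dvd_mul_right _ _)).mp h3

/-- Prime factors of N are removed one at a time: with N = pM and v = p · v′, the quotient of f^M by
`EP v′` has constant p-th power, hence is itself constant. -/
theorem exists_eq_of_pow_eq (h5 : 5 ≤ ℓ) {f : (ℍ → ℂ)ˣ} (hf : f ∈ cuspUnits ℓ) {N : ℕ} :
    ∀ {c : ℂˣ} {v : Cl ℓ → ℤ}, 0 < N → ∑ x, v x = 0 → f ^ N = constUnit c * EP v →
    ∃ (c : ℂˣ) (v : Cl ℓ → ℤ), ∑ x, v x = 0 ∧ f = constUnit c * EP v := by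
  induction N using Nat.strong_induction_on with
  | _ N ih =>
  intro c v hN hv h
  by_cases hN1 : N = 1
  · exact ⟨c, v, hv, by rw [← h, hN1, pow_one]⟩
  have hpp := Nat.minFac_prime hN1
  obtain ⟨M, hM⟩ := Nat.minFac_dvd N
  set p := N.minFac
  have hM0 : 0 < M := Nat.pos_of_ne_zero fun h0 => by
    rw [h0, mul_zero] at hM
    omega
  have hg := pow_mem hf M
  have h1 : (f ^ M) ^ p = constUnit c * EP v := by rw [← pow_mul, mul_comm, ← hM, h]
  choose v' hv' using dvd_of_pow_eq h5 hpp hg hv h1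
  have hv0 : ∑ x, v' x = 0 := by
    simp only [hv', ← Finset.mul_sum] at hv
    exact (mul_eq_zero.mp hv).resolve_left (by exact_mod_cast hpp.ne_zero)
  have hvv : v = (p : ℤ) • v' := funext hv'
  have h2 : (f ^ M * (EP v')⁻¹) ^ p = constUnit c := by
    rw [mul_pow, h1, hvv, EP_zsmul, zpow_natCast, inv_pow, mul_inv_cancel_right]
  obtain ⟨u, hu⟩ := exists_eq_constUnit_of_pow
    (mul_mem hg (inv_mem (EP_mem_cuspUnits (by omega) hv0))) hpp.pos h2
  refine ih M ?_ hM0 hv0 (c := u) (by rw [← hu, inv_mul_cancel_right])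
  have := hpp.two_le
  nlinarith

theorem UPlus.exists_eq (h5 : 5 ≤ ℓ) {f : (ℍ → ℂ)ˣ} (hf : f ∈ UPlus ℓ) :
    ∃ (c : ℂˣ) (v : Cl ℓ → ℤ), ∑ x, v x = 0 ∧ f = constUnit c * EP v := by
  have hℓ := hp.out.pos
  obtain ⟨N, hN, c, v, hv, h⟩ := exists_pow_eq (by omega) (UPlus.mem_cuspUnits hℓ hf)
    fun γ hγ => UPlus.ordAt hℓ hf hγ
  exact exists_eq_of_pow_eq h5 (UPlus.mem_cuspUnits hℓ hf) hN hv h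

end

end

end ModUnits

theorem theorem1p3 (ℓ k : ℕ) (hℓk : ℓ = 2 * k + 1) (hℓ5 : 5 ≤ ℓ) (hℓ : ℓ.Prime) :
    (ModUnits.UR k : Set (UpperHalfPlane → ℂ)ˣ) ⊆ ModUnits.UPlus ℓ ∧
    (Module.finrank ℤ (Additive (ModUnits.UR k)) : ℚ) =
      k - k / orderOf (ModUnits.twoClass ℓ ⟨k, hℓk⟩) ∧
    (Subgroup.zpowers (ModUnits.twoClass ℓ ⟨k, hℓk⟩) = ⊤ →
      Disjoint (ModUnits.UR k) (ModUnits.constants ℓ) ∧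
      ((ModUnits.UR k ⊔ ModUnits.constants ℓ : Subgroup (UpperHalfPlane → ℂ)ˣ) :
        Set (UpperHalfPlane → ℂ)ˣ) = ModUnits.UPlus ℓ) := by
  subst hℓk
  have : Fact (2 * k + 1).Prime := ⟨hℓ⟩
  have hk : 2 ≤ k := by omega
  exact ⟨ModUnits.UR_subset_UPlus hk, ModUnits.finrank_UR hk _, fun htop =>
    ⟨ModUnits.disjoint_UR_constants hk, ModUnits.sup_constants_eq hk _ htop
      fun _ hf => ModUnits.UPlus.exists_eq hℓ5 hf⟩⟩
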